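/- Planar algebras are over $\mathbb{C}$, and planar diagrams (inner discs and strings in a disc with marked boundary point) are considered up to planar isotopy fixing the boundary. An (unoriented or oriented) planar algebra $P$ assigns a vector space $P_w$ to each boundary $w$ (a number of boundary points, in the oriented case with an orientation of each of them), with a multilinear action of (unoriented or oriented) planar diagrams, compatible with composition. Definitions. (1) $\mathrm{Rep}(O(2))$ is the unoriented planar algebra whose space with $n$ boundary points is $\mathrm{Hom}_{O(2)}(\mathbf 1,X^{\otimes n})=(X^{\otimes n})^{O(2)}$, where $X=\mathbb{C}^2$ is the standard representation of the (real) orthogonal group $O(2)$; planar diagrams act by contraction of tensors along the strings with the standard symmetric bilinear form. (2) For $a\in\mathbb{C}^\times$, $\mathrm{Rep}(S^1,a)$ is the oriented planar algebra of linear combinations of oriented (framed) virtual tangle diagrams, that is, planar diagrams with over-, under- and virtual crossings, modulo isotopy, all orientations of the virtual Reidemeister moves (Reidemeister II and III, virtual Reidemeister I, II and III, the mixed move in which a string with only virtual crossings passes a crossing; neither the forbidden move nor Reidemeister I for real crossings), and the following local relations: an oriented circle (either orientation) equals $1$; the virtual, over- and undercrossing of two upward strings equal $1$, $a$ and $a^{-1}$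 times the diagram of two parallel upward strings, respectively. (The overcrossing is the one in which the string from the bottom left to the top right runs above; a quarter turn exchanges over- and undercrossings of unoriented strings.) (3) An oriented planar algebra $P$ has an underlying unoriented planar algebra $P^{\mathrm{un}}$: its space with $n$ boundary points is $\bigoplus_{\varepsilon\in\{+,-\}^n}P_\varepsilon$, and an unoriented diagram acts as the sum of all the oriented diagrams obtained from it by choosing orientations of its strings (closed strings included), where an inner disc labelled by $(x_\varepsilon)_\varepsilon$ receives the component $x_\varepsilon$ for the induced orientation $\varepsilon$ of its boundary points. Theorem. Let $a\in\mathbb{C}^\times$. Then $\mathrm{Rep}(S^1,a)$ contains $\mathrm{Rep}(O(2))$ as a sub-planar algebra: there is an injective map of planar algebras $$f:\mathrm{Rep}(O(2))\hookrightarrow \mathrm{Rep}(S^1,a)^{\mathrm{un}}$$ that sends every unoriented diagram to the sum of all its orientations. Here an unoriented diagram with crossings represents an element of $\mathrm{Rep}(O(2))$ as follows: the virtual crossing is the flip $v\otimes w\mapsto w\otimes v$ of $X\otimes X$, and the over- and undercrossing are $$\text{over}=\tfrac{a-a^{-1}}{2}\,\mathrm{id}-\tfrac{a-a^{-1}}{2}\,\cup\!\cap+\tfrac{a+a^{-1}}{2}\,\mathrm{virt},\qquad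 \text{under}=\tfrac{a^{-1}-a}{2}\,\mathrm{id}-\tfrac{a^{-1}-a}{2}\,\cup\!\cap+\tfrac{a+a^{-1}}{2}\,\mathrm{virt},$$ where $\mathrm{id}$ is the diagram of two parallel vertical strings and $\cup\!\cap$ is a minimum above a maximum. -/

import Mathlib

namespace PlanarAlg

/-- A set of types of strings, with the operation "reverse the direction of the string". -/
class StringType (C : Type) where
  dual : C → C
  dual_dual : ∀ c, dual (dual c) = c


/-- Unoriented strings: one type, equal to its own reverse. -/
instance : StringType Unit := ⟨id, fun _ => rfl⟩

/-- Oriented strings: at an endpoint on the top, `true` (written `+`) is a string going up and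
`false` (written `-`) is a string going down. -/
instance : StringType Bool := ⟨not, Bool.not_not⟩

section Diagrams

variable {C : Type}

/-- The elementary pieces of a planar diagram in standard form: a string with a minimum, a string
with a maximum, an inner disc with label `x` and boundary `w` (drawn as a rectangle with its starred
region on the left and all its endpoints, listed clockwise, on the top). -/
inductive Piece (L : List C → Type) : Type
  | cup (c : C) : Piece L
  | cap (c : C) : Piece L
  | box (w : List C) (x : L w) : Piece L

variable {L M : List C → Type}

/-- A horizontal slice of a planar diagram: one piece, with `pos` vertical strings to its left. -/
structure Slice (L : List C → Type) : Type where
  pos : ℕ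
  piece : Piece L

/-- A planar diagram in standard form, as the list of its slices from the bottom to the top. -/
abbrev Word (L : List C → Type) : Type := List (Slice L)

/-- Put `n` vertical strings to the left of a diagram. -/
def shift (n : ℕ) (T : Word L) : Word L := T.map fun s => ⟨n + s.pos, s.piece⟩

/-- Apply a function to the labels of all inner discs. -/
def Piece.map (f : ∀ w, L w → M w) : Piece L → Piece M
  | cup c => cup c
  | cap c => cap c
  | box w x => box w (f w x)

/-- Apply a function to the labels of all inner discs. -/
def relabel (f : ∀ w, L w → M w) (T : Word L) : Word M :=
  T.map fun s => ⟨s.pos, s.piece.map f⟩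

theorem shift_append (n : ℕ) (S T : Word L) : shift n (S ++ T) = shift n S ++ shift n T := by
  simp [shift]

theorem shift_shift (m n : ℕ) (S : Word L) : shift m (shift n S) = shift (m + n) S := by
  simp [shift, Function.comp_def, add_assoc]

theorem shift_zero (S : Word L) : shift 0 S = S := by
  simp [shift]

@[simp] theorem length_shift (n : ℕ) (S : Word L) : (shift n S).length = S.length := by
  simp [shift]

theorem relabel_shift (f : ∀ w, L w → M w) (n : ℕ) (T : Word L) :
    relabel f (shift n T) = shift n (relabel f T) := by
  simp [relabel, shift, Function.comp_def]

theorem relabel_append (f : ∀ w, L w → M w) (S T : Word L) :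
    relabel f (S ++ T) = relabel f S ++ relabel f T := by
  simp [relabel]

variable [StringType C]

/-- The strings entering a piece from below. -/
def Piece.dom : Piece L → List C
  | cup _ => []
  | cap c => [c, StringType.dual c]
  | box _ _ => []

/-- The strings leaving a piece at its top. -/
def Piece.cod : Piece L → List C
  | cup c => [c, StringType.dual c]
  | cap _ => []
  | box w _ => w

/-- The slice `s` leads from the row of strings `u` to the row of strings `v`. -/
def Slice.Typed (u : List C) (s : Slice L) (v : List C) : Prop :=
  ∃ l r : List C, l.length = s.pos ∧ u = l ++ s.piece.dom ++ r ∧ v = l ++ s.piece.cod ++ r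

/-- `T` is a diagram with bottom boundary `u` and top boundary `v`. -/
def Typed : List C → Word L → List C → Prop
  | u, [], v => u = v
  | u, s :: T, v => ∃ x, s.Typed u x ∧ Typed x T v

/-- Rotation by one click of a diagram whose endpoints are all on the top, the first one being of
type `c`: the first endpoint is led around the diagram, counterclockwise below it, and becomes the
last one. -/
def rot (c : C) (S : Word L) : Word L :=
  ⟨0, .cup (StringType.dual c)⟩ :: (shift 1 S ++ [⟨0, .cap (StringType.dual c)⟩])

/-- Successive rotations by one click, one for each entry of the list. -/
def rotAll : Word L → List C → Word L
  | S, [] => S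
  | S, c :: w => rotAll (rot c S) w

/-- Planar isotopy of diagrams with bottom boundary `u` and top boundary `v`, relative to the
boundary: the congruence for stacking (`comp`) and for adding vertical strings on both sides
(`whisker`) which is generated by sliding distant parts of a diagram past each other in height,
straightening a string with a maximum and a minimum, and a full turn of a disc. -/
inductive Isotopic : List C → List C → Word L → Word L → Prop
  | refl {u v S} : Typed u S v → Isotopic u v S S
  | symm {u v S T} : Isotopic u v S T → Isotopic u v T S
  | trans {u v S T X} : Isotopic u v S T → Isotopic u v T X → Isotopic u v S X
  | comp {u v w S S' T T'} : Isotopic u v S S' → Isotopic v w T T' →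
      Isotopic u w (S ++ T) (S' ++ T')
  | whisker {u v S T} (l r : List C) : Isotopic u v S T →
      Isotopic (l ++ u ++ r) (l ++ v ++ r) (shift l.length S) (shift l.length T)
  | interchange {u v u' v' S S'} : Typed u S v → Typed u' S' v' →
      Isotopic (u ++ u') (v ++ v') (S ++ shift v.length S') (shift u.length S' ++ S)
  | zigzag_left (c : C) : Isotopic [c] [c]
      [⟨0, .cup c⟩, ⟨1, .cap (StringType.dual c)⟩] []
  | zigzag_right (c : C) : Isotopic [c] [c]
      [⟨1, .cup (StringType.dual c)⟩, ⟨0, .cap c⟩] []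
  | full_turn {w S} : Typed [] S w → Isotopic [] w (rotAll S w) S

/-- Planar diagrams with outer boundary `w` (all endpoints on the top), whose inner discs carry
labels from `L`. -/
abbrev Diagram (L : List C → Type) (w : List C) : Type := {T : Word L // Typed [] T w}

/-! Basic facts about boundaries of diagrams. -/

theorem typed_append {S T : Word L} {u v : List C} :
    Typed u (S ++ T) v ↔ ∃ x, Typed u S x ∧ Typed x T v := by
  induction S generalizing u with
  | nil => simp [Typed]
  | cons s S ih => simp only [List.cons_append, Typed, ih]; grind

theorem Slice.typed_unique {s : Slice L} {u v v' : List C} (h : s.Typed u v) (h' : s.Typed u v') :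
    v = v' := by
  obtain ⟨l, r, h1, rfl, rfl⟩ := h
  obtain ⟨l', r', h1', h2, rfl⟩ := h'
  simp only [List.append_assoc] at *
  obtain ⟨rfl, h3⟩ := List.append_inj h2 (by omega)
  have := List.append_cancel_left h3
  rw [this]

theorem typed_unique {T : Word L} {u v v' : List C} (h : Typed u T v) (h' : Typed u T v') :
    v = v' := by
  induction T generalizing u with
  | nil => exact h.symm.trans h'
  | cons s T ih =>
    obtain ⟨x, h1, h2⟩ := h
    obtain ⟨x', h1', h2'⟩ := h'
    obtain rfl := s.typed_unique h1 h1'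
    exact ih h2 h2'

theorem typed_whisker {T : Word L} {u v : List C} (l r : List C) (h : Typed u T v) :
    Typed (l ++ u ++ r) (shift l.length T) (l ++ v ++ r) := by
  induction T generalizing u with
  | nil => obtain rfl : u = v := h; rfl
  | cons s T ih =>
    obtain ⟨x, ⟨l', r', h1, rfl, rfl⟩, h2⟩ := h
    exact ⟨_, ⟨l ++ l', r' ++ r, by simp [h1], by simp, rfl⟩, by simpa [shift] using ih h2⟩

theorem typed_singleton {s : Slice L} {u v : List C} : Typed u [s] v ↔ s.Typed u v := by
  simp [Typed]

theorem typed_box (l r w : List C) (x : L w) :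
    (⟨l.length, .box w x⟩ : Slice L).Typed (l ++ r) (l ++ w ++ r) :=
  ⟨l, r, rfl, by simp [Piece.dom], by simp [Piece.cod]⟩

theorem typed_rot {S : Word L} {c : C} {w : List C} (h : Typed [] S (c :: w)) :
    Typed [] (rot c S) (w ++ [c]) := by
  refine ⟨[StringType.dual c, c], ⟨[], [], rfl, rfl, ?_⟩, ?_⟩
  · simp [Piece.cod, StringType.dual_dual]
  · rw [typed_append]
    refine ⟨_, typed_whisker [StringType.dual c] [c] h, ?_⟩
    rw [typed_singleton]
    exact ⟨[], w ++ [c], rfl, by simp [Piece.dom, StringType.dual_dual], by simp [Piece.cod]⟩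

theorem typed_rotAll {S : Word L} {w w' : List C} (h : Typed [] S (w ++ w')) :
    Typed [] (rotAll S w) (w' ++ w) := by
  induction w generalizing S w' with
  | nil => simpa [rotAll] using h
  | cons c w ih =>
    have := ih (S := rot c S) (w' := w' ++ [c]) (by simpa using typed_rot h)
    simpa [rotAll] using this

theorem typed_interchange {S S' : Word L} {u v u' v' : List C} (h : Typed u S v)
    (h' : Typed u' S' v') : Typed (u ++ u') (S ++ shift v.length S') (v ++ v') ∧
      Typed (u ++ u') (shift u.length S' ++ S) (v ++ v') := by
  simp only [typed_append]
  refine ⟨⟨v ++ u', ?_, ?_⟩, ⟨u ++ v', ?_, ?_⟩⟩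
  · simpa [shift_zero] using typed_whisker [] u' h
  · simpa using typed_whisker v [] h'
  · simpa using typed_whisker u [] h'
  · simpa [shift_zero] using typed_whisker [] v' h

theorem typed_zigzag_left (c : C) : Typed (L := L) [c]
    [⟨0, .cup c⟩, ⟨1, .cap (StringType.dual c)⟩] [c] :=
  ⟨[c, StringType.dual c, c], ⟨[], [c], rfl, rfl, rfl⟩, [c],
    ⟨[c], [], rfl, by simp [Piece.dom, StringType.dual_dual], rfl⟩, rfl⟩

theorem typed_zigzag_right (c : C) : Typed (L := L) [c]
    [⟨1, .cup (StringType.dual c)⟩, ⟨0, .cap c⟩] [c] :=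
  ⟨[c, StringType.dual c, c], ⟨[c], [], rfl, rfl, by simp [Piece.cod, StringType.dual_dual]⟩, [c],
    ⟨[], [c], rfl, rfl, rfl⟩, rfl⟩

theorem Isotopic.typed {u v : List C} {S T : Word L} (h : Isotopic u v S T) :
    Typed u S v ∧ Typed u T v := by
  induction h with
  | refl h => exact ⟨h, h⟩
  | symm _ ih => exact ih.symm
  | trans _ _ ih ih' => exact ⟨ih.1, ih'.2⟩
  | comp _ _ ih ih' =>
    exact ⟨typed_append.2 ⟨_, ih.1, ih'.1⟩, typed_append.2 ⟨_, ih.2, ih'.2⟩⟩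
  | whisker l r _ ih => exact ⟨typed_whisker l r ih.1, typed_whisker l r ih.2⟩
  | interchange h h' => exact typed_interchange h h'
  | zigzag_left c => exact ⟨typed_zigzag_left c, rfl⟩
  | zigzag_right c => exact ⟨typed_zigzag_right c, rfl⟩
  | full_turn h =>
    exact ⟨by simpa using typed_rotAll (w' := []) (by simpa using h), h⟩

theorem Slice.typed_relabel (f : ∀ w, L w → M w) {s : Slice L} {u v : List C} :
    (⟨s.pos, s.piece.map f⟩ : Slice M).Typed u v ↔ s.Typed u v := by
  obtain ⟨p, _ | _ | _⟩ := s <;> rfl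

theorem typed_relabel (f : ∀ w, L w → M w) {T : Word L} {u v : List C} :
    Typed u (relabel f T) v ↔ Typed u T v := by
  induction T generalizing u with
  | nil => rfl
  | cons s T ih =>
    have ih' : ∀ x, Typed x (relabel f T) v ↔ Typed x T v := fun x => ih
    simp only [relabel, List.map_cons, Typed] at ih' ⊢
    simp only [ih', Slice.typed_relabel]

theorem relabel_rot (f : ∀ w, L w → M w) (c : C) (S : Word L) :
    relabel f (rot c S) = rot c (relabel f S) := by
  simp [rot, relabel, shift, Function.comp_def, Piece.map]

theorem relabel_rotAll (f : ∀ w, L w → M w) (w : List C) (S : Word L) :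
    relabel f (rotAll S w) = rotAll (relabel f S) w := by
  induction w generalizing S with
  | nil => rfl
  | cons c w ih => rw [rotAll, ih, relabel_rot, rotAll]

theorem Isotopic.relabel (f : ∀ w, L w → M w) {u v : List C} {S T : Word L}
    (h : Isotopic u v S T) : Isotopic u v (relabel f S) (relabel f T) := by
  induction h with
  | refl h => exact .refl ((typed_relabel f).2 h)
  | symm _ ih => exact ih.symm
  | trans _ _ ih ih' => exact ih.trans ih'
  | comp _ _ ih ih' => simpa only [relabel_append] using ih.comp ih'
  | whisker l r _ ih => simpa only [relabel_shift] using ih.whisker l r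
  | interchange h h' =>
    simpa only [relabel_append, relabel_shift] using
      Isotopic.interchange ((typed_relabel f).2 h) ((typed_relabel f).2 h')
  | zigzag_left c => exact .zigzag_left c
  | zigzag_right c => exact .zigzag_right c
  | full_turn h => simpa only [relabel_rotAll] using Isotopic.full_turn ((typed_relabel f).2 h)

/-- A diagram with the labels of its inner discs changed. -/
def Diagram.relabel {w : List C} (f : ∀ w, L w → M w) (D : Diagram L w) : Diagram M w :=
  ⟨PlanarAlg.relabel f D.1, (typed_relabel f).2 D.2⟩

/-- The diagram that consists of the inner disc `x` and of vertical strings from it to the outer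
boundary. -/
def Diagram.single {w : List C} (x : L w) : Diagram L w :=
  ⟨[⟨0, .box w x⟩], typed_singleton.2 (by simpa using typed_box [] [] w x)⟩

theorem slice_whisker_inv {q : Piece L} {p m : ℕ} {l r u' y : List C}
    (h : (⟨l.length + p, q⟩ : Slice L).Typed (l ++ u' ++ r) y)
    (hu : u'.length = p + q.dom.length + m) :
    ∃ v', y = l ++ v' ++ r ∧ v'.length = p + q.cod.length + m ∧
      (⟨p, q⟩ : Slice L).Typed u' v' := by
  obtain ⟨a, b, h1, h2, rfl⟩ := h
  simp only [List.append_assoc] at h1 h2 ⊢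
  have e1 : a = l ++ u'.take p := by
    calc a = (a ++ (q.dom ++ b)).take (l.length + p) := by rw [← h1, List.take_left' rfl]
      _ = (l ++ (u' ++ r)).take (l.length + p) := by rw [h2]
      _ = l ++ (u' ++ r).take p := List.take_length_add_append _
      _ = l ++ u'.take p := by rw [List.take_append_of_le_length (by omega)]
  subst e1
  simp only [List.append_assoc, List.append_cancel_left_eq] at h2
  have h3 : u'.drop p ++ r = q.dom ++ b := by
    rw [← List.append_cancel_left_eq (as := u'.take p), ← h2, ← List.append_assoc,
      List.take_append_drop]
  have e2 : q.dom = (u'.drop p).take q.dom.length := by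
    have := congrArg (List.take q.dom.length) h3
    rw [List.take_append_of_le_length (by simp; omega), List.take_left'] at this
    · exact this.symm
    · rfl
  have e3 : b = (u'.drop p).drop q.dom.length ++ r := by
    have := congrArg (List.drop q.dom.length) h3
    rw [List.drop_append_of_le_length (by simp; omega), List.drop_left'] at this
    · exact this.symm
    · rfl
  have hp : (u'.take p).length = p := by simp; omega
  refine ⟨u'.take p ++ q.cod ++ (u'.drop p).drop q.dom.length, by simp [e3], by simp; omega, ?_⟩
  refine ⟨u'.take p, (u'.drop p).drop q.dom.length, hp, ?_, rfl⟩
  conv_lhs => rw [← List.take_append_drop p u', ← List.take_append_drop q.dom.length (u'.drop p)]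
  simp only [List.append_assoc]
  rw [← e2]

theorem zigzag_left_iff {x y a b : C} :
    Typed (L := L) [x] [⟨0, .cup a⟩, ⟨1, .cap b⟩] [y] ↔
      a = x ∧ b = StringType.dual x ∧ x = y := by
  constructor
  · rintro ⟨z, ⟨l, r, hl, h1, rfl⟩, h2⟩
    obtain rfl : l = [] := List.length_eq_zero_iff.1 hl
    simp only [Piece.dom, List.append_nil, List.nil_append] at h1
    subst h1
    rw [typed_singleton] at h2
    obtain ⟨l, r, hl, h3, h4⟩ := h2
    obtain ⟨e, rfl⟩ := List.length_eq_one_iff.1 hl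
    simp only [Piece.dom, Piece.cod, List.nil_append, List.cons_append, List.cons.injEq,
      List.append_nil] at h3 h4
    obtain ⟨rfl, rfl, rfl, rfl⟩ := h3
    obtain ⟨rfl, -⟩ := h4
    simp [StringType.dual_dual]
  · rintro ⟨rfl, rfl, rfl⟩
    exact typed_zigzag_left _

theorem zigzag_right_iff {x y a b : C} :
    Typed (L := L) [x] [⟨1, .cup a⟩, ⟨0, .cap b⟩] [y] ↔
      a = StringType.dual x ∧ b = x ∧ x = y := by
  constructor
  · rintro ⟨z, ⟨l, r, hl, h1, rfl⟩, h2⟩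
    obtain ⟨e, rfl⟩ := List.length_eq_one_iff.1 hl
    simp only [Piece.dom, List.append_nil, List.cons_append, List.nil_append, List.cons.injEq] at h1
    obtain ⟨rfl, rfl⟩ := h1
    rw [typed_singleton] at h2
    obtain ⟨l, r, hl, h3, h4⟩ := h2
    obtain rfl : l = [] := List.length_eq_zero_iff.1 hl
    simp only [Piece.dom, Piece.cod, List.nil_append, List.cons_append, List.cons.injEq,
      List.append_nil] at h3 h4
    obtain ⟨rfl, rfl, rfl⟩ := h3
    simp only [StringType.dual_dual, List.cons.injEq, and_true] at h4
    simp [h4]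
  · rintro ⟨rfl, rfl, rfl⟩
    exact typed_zigzag_right _

section PlanarAlgebras

/-- A planar algebra over `ℂ` with strings of types `C` (an unoriented planar algebra for `C = Unit`,
an oriented one for `C = Bool`): a vector space `V w` for every boundary `w` and an action of planar
diagrams. The output of the diagram `T` with the elements `v₁, …, v_k` inserted in its inner discs is
`act` of the diagram `T` whose inner discs are labelled `v₁, …, v_k`. The action is multilinear,
invariant under isotopy, and compatible with the composition of diagrams, that is, with inserting a
diagram into an inner disc of another one. -/
structure PlanarAlgebra (C : Type) [StringType C] where
  V : List C → Type
  [addCommGroup : ∀ w, AddCommGroup (V w)]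
  [module : ∀ w, Module ℂ (V w)]
  act : ∀ {w : List C}, Diagram V w → V w
  act_linear : ∀ {w k : List C} (A B : Word V) (p : ℕ)
    (h : ∀ x : V k, Typed [] (A ++ ⟨p, .box k x⟩ :: B) w),
    IsLinearMap ℂ fun x : V k => act ⟨A ++ ⟨p, .box k x⟩ :: B, h x⟩
  act_isotopic : ∀ {w : List C} (S T : Diagram V w), Isotopic [] w S.1 T.1 → act S = act T
  act_single : ∀ {w : List C} (x : V w), act (Diagram.single x) = x
  act_insert : ∀ {w k : List C} (A B : Word V) (p : ℕ) (D : Diagram V k)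
    (h : Typed [] (A ++ ⟨p, .box k (act D)⟩ :: B) w) (h' : Typed [] (A ++ shift p D.1 ++ B) w),
    act ⟨A ++ ⟨p, .box k (act D)⟩ :: B, h⟩ = act ⟨A ++ shift p D.1 ++ B, h'⟩

attribute [instance] PlanarAlgebra.addCommGroup PlanarAlgebra.module

/-- A map of planar algebras: linear maps of the box spaces that intertwine the actions of all
planar diagrams. -/
structure PlanarAlgebra.Hom (P Q : PlanarAlgebra C) where
  toFun : ∀ w, P.V w →ₗ[ℂ] Q.V w
  map_act : ∀ {w : List C} (D : Diagram P.V w),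
    toFun w (P.act D) = Q.act (D.relabel fun w => toFun w)

theorem typed_change {A B : Word L} {p : ℕ} {k : List C} (x y : L k) {u v : List C}
    (h : Typed u (A ++ ⟨p, .box k x⟩ :: B) v) : Typed u (A ++ ⟨p, .box k y⟩ :: B) v := by
  rw [typed_append] at h ⊢
  obtain ⟨a, h1, b, h2, h3⟩ := h
  exact ⟨a, h1, b, h2, h3⟩

theorem Diagram.relabel_box {f : ∀ w, L w → M w} {A B : Word L} {p : ℕ} {k w : List C} {x : L k}
    (h : Typed [] (A ++ ⟨p, .box k x⟩ :: B) w) :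
    Diagram.relabel f ⟨A ++ ⟨p, .box k x⟩ :: B, h⟩ =
      ⟨PlanarAlg.relabel f A ++ ⟨p, .box k (f k x)⟩ :: PlanarAlg.relabel f B, by
        simpa [PlanarAlg.relabel, Piece.map] using (typed_relabel f).2 h⟩ :=
  Subtype.ext (by simp [Diagram.relabel, PlanarAlg.relabel, Piece.map])

/-- The planar subalgebra given by subspaces that are closed under the action. -/
def PlanarAlgebra.sub (P : PlanarAlgebra C) (S : ∀ w, Submodule ℂ (P.V w))
    (hS : ∀ (w : List C) (D : Diagram (fun w => S w) w),
      P.act (D.relabel fun w (x : S w) => (x : P.V w)) ∈ S w) : PlanarAlgebra C where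
  V w := S w
  act D := ⟨_, hS _ D⟩
  act_linear A B p h := by
    have hh := P.act_linear (relabel (fun w (x : S w) => (x : P.V w)) A)
      (relabel (fun w (x : S w) => (x : P.V w)) B) p (k := _) (fun x => typed_change 0 x (by
        simpa [relabel, Piece.map] using
          (typed_relabel (fun w (x : S w) => (x : P.V w))).2 (h 0)))
    constructor
    · intro x y
      apply Subtype.ext
      simp only [Diagram.relabel_box]
      exact hh.map_add x y
    · intro z x
      apply Subtype.ext
      simp only [Diagram.relabel_box]
      exact hh.map_smul z x
  act_isotopic D D' h := Subtype.ext (P.act_isotopic _ _ (h.relabel _))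
  act_single x := Subtype.ext (P.act_single _)
  act_insert A B p D h h' := by
    apply Subtype.ext
    simp only [Diagram.relabel_box]
    refine (P.act_insert _ _ p (D.relabel fun w (x : S w) => (x : P.V w)) _ ?_).trans ?_
    · simpa [Diagram.relabel, relabel_append, relabel_shift] using
        (typed_relabel (fun w (x : S w) => (x : P.V w))).2 h'
    · congr 1
      exact Subtype.ext (by simp [Diagram.relabel, relabel_append, relabel_shift])

open Classical in
/-- The action of a diagram, set to zero on lists of slices that are not diagrams with outer
boundary `w`. -/
noncomputable def PlanarAlgebra.ev (P : PlanarAlgebra C) (w : List C) (T : Word P.V) : P.V w :=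
  if h : Typed [] T w then P.act ⟨T, h⟩ else 0

open Classical in
theorem PlanarAlgebra.ev_of_typed (P : PlanarAlgebra C) {w : List C} {T : Word P.V}
    (h : Typed [] T w) : P.ev w T = P.act ⟨T, h⟩ := dif_pos h

open Classical in
theorem PlanarAlgebra.ev_of_not (P : PlanarAlgebra C) {w : List C} {T : Word P.V}
    (h : ¬ Typed [] T w) : P.ev w T = 0 := dif_neg h

theorem PlanarAlgebra.ev_linear (P : PlanarAlgebra C) {w k : List C} (A B : Word P.V) (p : ℕ) :
    IsLinearMap ℂ fun x : P.V k => P.ev w (A ++ ⟨p, .box k x⟩ :: B) := by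
  by_cases h : Typed [] (A ++ ⟨p, .box k (0 : P.V k)⟩ :: B) w
  · have h' : ∀ x : P.V k, Typed [] (A ++ ⟨p, .box k x⟩ :: B) w := fun x => typed_change 0 x h
    have e : (fun x : P.V k => P.ev w (A ++ ⟨p, .box k x⟩ :: B)) = fun x => P.act ⟨_, h' x⟩ :=
      funext fun x => P.ev_of_typed (h' x)
    rw [e]
    exact P.act_linear A B p h'
  · have e : (fun x : P.V k => P.ev w (A ++ ⟨p, .box k x⟩ :: B)) = fun _ => 0 :=
      funext fun x => P.ev_of_not fun h' => h (typed_change x 0 h')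
    rw [e]
    exact ⟨by simp, by simp⟩

theorem PlanarAlgebra.ev_isotopic (P : PlanarAlgebra C) {w : List C} {S T : Word P.V}
    (h : Isotopic [] w S T) : P.ev w S = P.ev w T := by
  rw [P.ev_of_typed h.typed.1, P.ev_of_typed h.typed.2]
  exact P.act_isotopic _ _ h

theorem PlanarAlgebra.ev_insert (P : PlanarAlgebra C) {w k x r : List C} {A B D : Word P.V}
    {p : ℕ} (hA : Typed [] A (x ++ r)) (hx : x.length = p) (hD : Typed [] D k) :
    P.ev w (A ++ ⟨p, .box k (P.ev k D)⟩ :: B) = P.ev w (A ++ shift p D ++ B) := by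
  subst hx
  have h1 : Typed (x ++ r) (shift x.length D) (x ++ k ++ r) := by
    simpa using typed_whisker x r hD
  have key : Typed [] (A ++ ⟨x.length, .box k (P.ev k D)⟩ :: B) w ↔
      Typed [] (A ++ shift x.length D ++ B) w := by
    simp only [typed_append, Typed]
    constructor
    · rintro ⟨y, h2, z, h3, h4⟩
      obtain rfl := typed_unique h2 hA
      obtain rfl := Slice.typed_unique h3 (typed_box x r k _)
      exact ⟨_, ⟨_, hA, h1⟩, h4⟩
    · rintro ⟨y, ⟨z, h2, h3⟩, h4⟩
      obtain rfl := typed_unique h2 hA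
      obtain rfl := typed_unique h3 h1
      exact ⟨_, hA, _, typed_box x r k _, h4⟩
  by_cases h : Typed [] (A ++ shift x.length D ++ B) w
  · rw [P.ev_of_typed h, P.ev_of_typed (key.2 h)]
    have := P.act_insert A B x.length ⟨D, hD⟩
      (by rw [← P.ev_of_typed hD]; exact key.2 h) h
    rw [← this]
    congr 1
    apply Subtype.ext
    simp only [P.ev_of_typed hD]
  · rw [P.ev_of_not h, P.ev_of_not fun h' => h (key.1 h')]

section Presentations

variable {C : Type} [StringType C] {L : List C → Type}

theorem typed_context {A S B : Word L} {l r u v w : List C} (hA : Typed [] A (l ++ u ++ r))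
    (hS : Typed u S v) (hB : Typed (l ++ v ++ r) B w) :
    Typed [] (A ++ shift l.length S ++ B) w :=
  typed_append.2 ⟨_, typed_append.2 ⟨_, hA, typed_whisker l r hS⟩, hB⟩

/-- The linear combinations of diagrams that are set to zero in the planar algebra presented by
the relations `R`, where `R u v S z T` stands for the relation `S = z T` between diagrams with bottom
boundary `u` and top boundary `v`: differences of isotopic diagrams, and `R`-related diagrams put
into any diagram. -/
inductive IsRelator (R : List C → List C → Word L → ℂ → Word L → Prop) (w : List C) :
    (Diagram L w →₀ ℂ) → Prop
  | isotopy (S T : Diagram L w) (h : Isotopic [] w S.1 T.1) :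
      IsRelator R w (Finsupp.single S 1 - Finsupp.single T 1)
  | skein {A S T B : Word L} {l r u v : List C} {z : ℂ} (h : R u v S z T)
      (hA : Typed [] A (l ++ u ++ r)) (hS : Typed u S v) (hT : Typed u T v)
      (hB : Typed (l ++ v ++ r) B w) :
      IsRelator R w (Finsupp.single ⟨A ++ shift l.length S ++ B, typed_context hA hS hB⟩ 1 -
        z • Finsupp.single ⟨A ++ shift l.length T ++ B, typed_context hA hT hB⟩ 1)

/-- The linear combinations of diagrams that vanish as a consequence of the relations. -/
noncomputable def relators (R : List C → List C → Word L → ℂ → Word L → Prop) (w : List C) :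
    Submodule ℂ (Diagram L w →₀ ℂ) :=
  Submodule.span ℂ {x | IsRelator R w x}

/-- The box spaces of a presented planar algebra. -/
abbrev Presented (R : List C → List C → Word L → ℂ → Word L → Prop) (w : List C) : Type :=
  (Diagram L w →₀ ℂ) ⧸ relators R w

variable (R : List C → List C → Word L → ℂ → Word L → Prop)

open Classical in
/-- The class of a diagram (zero for lists of slices that are not diagrams with boundary `w`). -/
noncomputable def cls (w : List C) (T : Word L) : Presented R w :=
  if h : Typed [] T w then (relators R w).mkQ (Finsupp.single ⟨T, h⟩ 1) else 0

variable {R}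

theorem cls_of_typed {w : List C} {T : Word L} (h : Typed [] T w) :
    cls R w T = (relators R w).mkQ (Finsupp.single ⟨T, h⟩ 1) := dif_pos h

theorem cls_isotopic {w : List C} {S T : Word L} (h : Isotopic [] w S T) :
    cls R w S = cls R w T := by
  rw [cls_of_typed h.typed.1, cls_of_typed h.typed.2, ← sub_eq_zero, ← map_sub]
  refine (Submodule.Quotient.mk_eq_zero _).2 (Submodule.subset_span ?_)
  exact .isotopy ⟨S, _⟩ ⟨T, _⟩ h

theorem cls_skein {w l r u v : List C} {A S T B : Word L} {z : ℂ} (h : R u v S z T)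
    (hA : Typed [] A (l ++ u ++ r)) (hS : Typed u S v) (hT : Typed u T v)
    (hB : Typed (l ++ v ++ r) B w) :
    cls R w (A ++ shift l.length S ++ B) = z • cls R w (A ++ shift l.length T ++ B) := by
  rw [cls_of_typed (typed_context hA hS hB), cls_of_typed (typed_context hA hT hB), ← sub_eq_zero,
    ← map_smul, ← map_sub]
  exact (Submodule.Quotient.mk_eq_zero _).2 (Submodule.subset_span (.skein h hA hS hT hB))

/-- Insert linear combinations of diagrams into the inner discs of a diagram and expand
multilinearly, applying the function `φ` to each of the resulting diagrams. -/
noncomputable def expand {W : Type} [AddCommGroup W] [Module ℂ W] :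
    Word (fun w => Diagram L w →₀ ℂ) → (Word L → W) → W
  | [], φ => φ []
  | ⟨p, .cup c⟩ :: T, φ => expand T fun Y => φ (⟨p, .cup c⟩ :: Y)
  | ⟨p, .cap c⟩ :: T, φ => expand T fun Y => φ (⟨p, .cap c⟩ :: Y)
  | ⟨p, .box _ f⟩ :: T, φ => f.sum fun D z => z • expand T fun Y => φ (shift p D.1 ++ Y)

variable {W : Type} [AddCommGroup W] [Module ℂ W]

theorem expand_append (S T : Word fun w => Diagram L w →₀ ℂ) (φ : Word L → W) :
    expand (S ++ T) φ = expand S fun X => expand T fun Y => φ (X ++ Y) := by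
  induction S generalizing φ with
  | nil => rfl
  | cons s S ih =>
    obtain ⟨p, _ | _ | _⟩ := s <;>
      simp only [List.cons_append, expand, ih, List.append_assoc]

theorem expand_map {W' : Type} [AddCommGroup W'] [Module ℂ W'] (Λ : W →ₗ[ℂ] W')
    (T : Word fun w => Diagram L w →₀ ℂ) (φ : Word L → W) :
    Λ (expand T φ) = expand T fun X => Λ (φ X) := by
  induction T generalizing φ with
  | nil => rfl
  | cons s T ih =>
    obtain ⟨p, _ | _ | _⟩ := s
    · exact ih _
    · exact ih _
    · simp only [expand, Finsupp.sum, map_sum, map_smul, ih]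

theorem expand_shift (n : ℕ) (T : Word fun w => Diagram L w →₀ ℂ) (φ : Word L → W) :
    expand (shift n T) φ = expand T fun X => φ (shift n X) := by
  induction T generalizing φ with
  | nil => rfl
  | cons s T ih =>
    have e : shift n (s :: T) = ⟨n + s.pos, s.piece⟩ :: shift n T := rfl
    obtain ⟨p, _ | _ | _⟩ := s
    · exact ih _
    · exact ih _
    · simp only [e, expand, ih, shift_append, shift_shift]

theorem expand_finsupp {ι : Type} (f : ι →₀ ℂ) (T : Word fun w => Diagram L w →₀ ℂ)
    (φ : ι → Word L → W) :
    (f.sum fun i z => z • expand T (φ i)) = expand T fun Y => f.sum fun i z => z • φ i Y := by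
  induction T generalizing φ with
  | nil => rfl
  | cons s T ih =>
    obtain ⟨p, _ | _ | ⟨w, g⟩⟩ := s
    · exact ih _
    · exact ih _
    · simp only [expand, ← ih]
      simp only [Finsupp.sum, Finset.smul_sum]
      rw [Finset.sum_comm]
      exact Finset.sum_congr rfl fun _ _ => Finset.sum_congr rfl fun _ _ => smul_comm _ _ _

theorem expand_comm (S T : Word fun w => Diagram L w →₀ ℂ) (φ : Word L → Word L → W) :
    (expand S fun X => expand T fun Y => φ X Y) = expand T fun Y => expand S fun X => φ X Y := by
  induction S generalizing φ with
  | nil => rfl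
  | cons s S ih =>
    obtain ⟨p, _ | _ | ⟨w, g⟩⟩ := s
    · exact ih _
    · exact ih _
    · simp only [expand, ih, ← expand_finsupp]

theorem expand_congr {T : Word fun w => Diagram L w →₀ ℂ} {u v : List C} (hT : Typed u T v)
    {φ ψ : Word L → W} (h : ∀ X, Typed u X v → φ X = ψ X) : expand T φ = expand T ψ := by
  induction T generalizing u φ ψ with
  | nil =>
    obtain rfl : u = v := hT
    exact h _ rfl
  | cons s T ih =>
    obtain ⟨x, hs, hT⟩ := hT
    obtain ⟨p, c | c | ⟨w, g⟩⟩ := s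
    · exact ih hT fun Y hY => h _ ⟨x, hs, hY⟩
    · exact ih hT fun Y hY => h _ ⟨x, hs, hY⟩
    · obtain ⟨l, r, rfl, rfl, rfl⟩ := hs
      simp only [expand]
      refine Finsupp.sum_congr fun D _ => ?_
      congr 1
      refine ih hT fun Y hY => h _ (typed_append.2 ⟨_, ?_, hY⟩)
      exact typed_whisker l r D.2

theorem expand_rotAll (S : Word fun w => Diagram L w →₀ ℂ) (w : List C) (φ : Word L → W) :
    expand (rotAll S w) φ = expand S fun X => φ (rotAll X w) := by
  induction w generalizing S φ with
  | nil => rfl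
  | cons c w ih =>
    simp only [rotAll, ih, rot, expand, expand_append, expand_shift]

theorem expand_isotopic {u v : List C} {S T : Word fun w => Diagram L w →₀ ℂ}
    (h : Isotopic u v S T) {φ : Word L → W} (hφ : ∀ X Y, Isotopic u v X Y → φ X = φ Y) :
    expand S φ = expand T φ := by
  induction h generalizing φ with
  | refl _ => rfl
  | symm _ ih => exact (ih hφ).symm
  | trans _ _ ih ih' => exact (ih hφ).trans (ih' hφ)
  | comp h h' ih ih' =>
    rw [expand_append, expand_append]
    refine (expand_congr h.typed.1 fun X hX => ih' fun Y Y' hY => ?_).trans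
      (ih fun X X' hX => expand_congr h'.typed.2 fun Y hY => ?_)
    · exact hφ _ _ ((Isotopic.refl hX).comp hY)
    · exact hφ _ _ (hX.comp (.refl hY))
  | whisker l r _ ih =>
    rw [expand_shift, expand_shift]
    exact ih fun X Y hXY => hφ _ _ (hXY.whisker l r)
  | interchange h h' =>
    rw [expand_append, expand_append]
    simp only [expand_shift]
    rw [expand_comm]
    refine expand_congr h' fun Y hY => expand_congr h fun X hX => ?_
    exact hφ _ _ (.interchange hX hY)
  | zigzag_left c => exact hφ _ _ (.zigzag_left c)
  | zigzag_right c => exact hφ _ _ (.zigzag_right c)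
  | full_turn h =>
    rw [expand_rotAll]
    exact expand_congr h fun X hX => hφ _ _ (.full_turn hX)

/-- The dependence of an expansion on the linear combination in one of the inner discs. -/
noncomputable def expandAt (A B : Word fun w => Diagram L w →₀ ℂ) (p : ℕ) (k : List C)
    (φ : Word L → W) : (Diagram L k →₀ ℂ) →ₗ[ℂ] W :=
  Finsupp.lsum ℂ fun D => LinearMap.toSpanSingleton ℂ W
    (expand A fun X => expand B fun Y => φ (X ++ (shift p D.1 ++ Y)))

theorem expandAt_apply (A B : Word fun w => Diagram L w →₀ ℂ) (p : ℕ) (k : List C)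
    (φ : Word L → W) (f : Diagram L k →₀ ℂ) :
    expandAt A B p k φ f = expand (A ++ ⟨p, .box k f⟩ :: B) φ := by
  rw [expand_append]
  simp only [expand, ← expand_finsupp]
  rfl

theorem expandAt_single (A B : Word fun w => Diagram L w →₀ ℂ) (p : ℕ) (k : List C)
    (φ : Word L → W) (D : Diagram L k) : expandAt A B p k φ (Finsupp.single D 1) =
      expand A fun X => expand B fun Y => φ (X ++ (shift p D.1 ++ Y)) := by
  simp [expandAt]

theorem relators_le_ker {A B : Word fun w => Diagram L w →₀ ℂ} {p : ℕ} {k w : List C}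
    (f : Diagram L k →₀ ℂ) (h : Typed [] (A ++ ⟨p, .box k f⟩ :: B) w) :
    relators R k ≤ LinearMap.ker (expandAt A B p k (cls R w)) := by
  obtain ⟨y, hA, y', ⟨l, r, rfl, rfl, rfl⟩, hB⟩ := typed_append.1 h
  simp only [Piece.dom, Piece.cod, List.append_nil] at hA hB
  refine Submodule.span_le.2 ?_
  intro g hg
  change expandAt A B l.length k (cls R w) g = 0
  cases hg with
  | isotopy S T h =>
    rw [map_sub, expandAt_single, expandAt_single, sub_eq_zero]
    refine expand_congr hA fun X hX => expand_congr hB fun Y hY => cls_isotopic ?_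
    have := h.whisker l r
    rw [List.append_nil] at this
    exact (Isotopic.refl hX).comp (this.comp (.refl hY))
  | @skein A' S T B' l' r' u v z h hA' hS hT hB' =>
    rw [map_sub, map_smul, expandAt_single, expandAt_single, sub_eq_zero,
      ← LinearMap.lsmul_apply (R := ℂ) (M := Presented R w), expand_map]
    refine expand_congr hA fun X hX => ?_
    rw [expand_map]
    refine expand_congr hB fun Y hY => ?_
    have h1 : Typed [] (X ++ shift l.length A') ((l ++ l') ++ u ++ (r' ++ r)) :=
      typed_append.2 ⟨_, hX, by simpa using typed_whisker l r hA'⟩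
    have h2 : Typed ((l ++ l') ++ v ++ (r' ++ r)) (shift l.length B' ++ Y) w :=
      typed_append.2 ⟨_, by simpa using typed_whisker l r hB', hY⟩
    have := cls_skein h h1 hS hT h2
    simpa [shift_append, shift_shift] using this

variable (R)

/-- A linear combination of diagrams that represents an element. -/
noncomputable def lift (w : List C) (x : Presented R w) : Diagram L w →₀ ℂ :=
  Function.surjInv (relators R w).mkQ_surjective x

variable {R}

theorem mkQ_lift {w : List C} (x : Presented R w) : (relators R w).mkQ (lift R w x) = x :=
  Function.surjInv_eq _ _

/-- The dependence of the action on one of the inputs. -/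
noncomputable def actAt {A B : Word (Presented R)} {p : ℕ} {k w : List C} {x : Presented R k}
    (h : Typed [] (A ++ ⟨p, .box k x⟩ :: B) w) : Presented R k →ₗ[ℂ] Presented R w :=
  (relators R k).liftQ (expandAt (relabel (lift R) A) (relabel (lift R) B) p k (cls R w))
    (relators_le_ker (lift R k x) (by
      simpa [relabel, Piece.map] using (typed_relabel (lift R)).2 h))

theorem actAt_mkQ {A B : Word (Presented R)} {p : ℕ} {k w : List C} {x : Presented R k}
    (h : Typed [] (A ++ ⟨p, .box k x⟩ :: B) w) (f : Diagram L k →₀ ℂ) :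
    actAt h ((relators R k).mkQ f) =
      expandAt (relabel (lift R) A) (relabel (lift R) B) p k (cls R w) f := by
  simp [actAt]

theorem actAt_apply {A B : Word (Presented R)} {p : ℕ} {k w : List C} {x : Presented R k}
    (h : Typed [] (A ++ ⟨p, .box k x⟩ :: B) w) (y : Presented R k) :
    actAt h y = expand (relabel (lift R) (A ++ ⟨p, .box k y⟩ :: B)) (cls R w) := by
  conv_lhs => rw [← mkQ_lift y]
  rw [actAt_mkQ, expandAt_apply]
  simp [relabel, Piece.map]

theorem finsupp_sum_cls {w : List C} (f : Diagram L w →₀ ℂ) :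
    (f.sum fun D z => z • cls R w D.1) = (relators R w).mkQ f := by
  conv_rhs => rw [← Finsupp.sum_single f, Finsupp.sum, map_sum]
  refine Finset.sum_congr rfl fun D _ => ?_
  change f D • cls R w D.1 = _
  rw [cls_of_typed D.2, ← map_smul, Finsupp.smul_single_one]

variable (R)

/-- The planar algebra presented by generators `L` and relations `R`: linear combinations of planar
diagrams whose inner discs carry labels from `L`, modulo isotopy and the relations `R` applied
inside any diagram. Planar diagrams act by insertion. -/
noncomputable def presented : PlanarAlgebra C where
  V := Presented R
  act {w} D := expand (relabel (lift R) D.1) (cls R w)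
  act_linear A B p h := by
    constructor
    · intro x y
      simp only [← actAt_apply (h 0), map_add]
    · intro z x
      simp only [← actAt_apply (h 0), map_smul]
  act_isotopic S T h := expand_isotopic (h.relabel _) fun _ _ => cls_isotopic
  act_single {w} x := by
    have : expand (relabel (lift R) (Diagram.single x).1) (cls R w) =
        (lift R w x).sum fun D z => z • cls R w D.1 := by
      simp [Diagram.single, relabel, Piece.map, expand, shift_zero]
    rw [this, finsupp_sum_cls, mkQ_lift]
  act_insert {w k} A B p D h h' := by
    rw [← actAt_apply h, expand_map]
    simp only [relabel_append, relabel_shift, expand_append, expand_shift]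
    rw [expand_comm]
    refine expand_congr ((typed_relabel _).2 D.2) fun Z hZ => ?_
    rw [cls_of_typed hZ, actAt_mkQ, expandAt_single]
    simp only [List.append_assoc]

end Presentations

end PlanarAlgebras

end Diagrams

/-- Sequences of length `n`, as lists. -/
abbrev Seq (C : Type) (n : ℕ) : Type := {l : List C // l.length = n}

instance (C : Type) [Fintype C] (n : ℕ) : Fintype (Seq C n) :=
  inferInstanceAs (Fintype (List.Vector C n))

section Orientations

variable {C : Type} [Fintype C] {L : List Unit → Type} {M : List C → Type}

/-- The choices of types for the strings of a piece of an unoriented diagram, where `lab` lists the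
choices of a boundary and of a label for an inner disc. -/
def Piece.colourings (lab : ∀ u, L u → Multiset (Σ e, M e)) : Piece L → Multiset (Piece M)
  | .cup _ => Finset.univ.val.map fun c => .cup c
  | .cap _ => Finset.univ.val.map fun c => .cap c
  | .box u x => (lab u x).map fun y => .box y.1 y.2

/-- The choices of types for the strings of all pieces of an unoriented diagram; a list of slices in
this multiset is a diagram, that is, satisfies `Typed`, if and only if the choices agree along each
string. -/
def colourings (lab : ∀ u, L u → Multiset (Σ e, M e)) : Word L → Multiset (Word M)
  | [] => {[]}
  | s :: T => (s.piece.colourings lab).bind fun q => (colourings lab T).map fun X => ⟨s.pos, q⟩ :: X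

variable {lab : ∀ u, L u → Multiset (Σ e, M e)} {A : Type} [AddCommMonoid A]

/-- The sum of a function over all choices of types for the strings. -/
def colourSum (lab : ∀ u, L u → Multiset (Σ e, M e)) (T : Word L) (φ : Word M → A) : A :=
  ((colourings lab T).map φ).sum

@[simp] theorem colourSum_nil (φ : Word M → A) : colourSum lab [] φ = φ [] := by
  simp [colourSum, colourings]

theorem colourSum_cons (s : Slice L) (T : Word L) (φ : Word M → A) :
    colourSum lab (s :: T) φ = ((s.piece.colourings lab).map fun q =>
      colourSum lab T fun X => φ (⟨s.pos, q⟩ :: X)).sum := by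
  simp only [colourSum, colourings, Multiset.map_bind, Multiset.map_map, Function.comp_def,
    Multiset.sum_bind]

theorem colourSum_append (S T : Word L) (φ : Word M → A) :
    colourSum lab (S ++ T) φ = colourSum lab S fun X => colourSum lab T fun Y => φ (X ++ Y) := by
  induction S generalizing φ with
  | nil => simp
  | cons s S ih => simp only [List.cons_append, colourSum_cons, ih]

theorem colourSum_shift (n : ℕ) (T : Word L) (φ : Word M → A) :
    colourSum lab (shift n T) φ = colourSum lab T fun X => φ (shift n X) := by
  induction T generalizing φ with
  | nil => simp [shift]
  | cons s S ih =>
    have ih' : ∀ φ : Word M → A, colourSum lab (S.map fun s => ⟨n + s.pos, s.piece⟩) φ =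
      colourSum lab S fun X => φ (shift n X) := ih
    simp only [shift, List.map_cons, colourSum_cons, ih']

theorem colourSum_congr {T : Word L} {φ ψ : Word M → A}
    (h : ∀ X ∈ colourings lab T, φ X = ψ X) : colourSum lab T φ = colourSum lab T ψ := by
  simp only [colourSum, Multiset.map_congr rfl h]

theorem colourSum_sum {T : Word L} {ι : Type*} (m : Multiset ι) (φ : Word M → ι → A) :
    colourSum lab T (fun X => (m.map (φ X)).sum) =
      (m.map fun i => colourSum lab T fun X => φ X i).sum := by
  simp only [colourSum]
  exact Multiset.sum_map_sum_map _ _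

theorem colourSum_comm {L' : List Unit → Type} {M' : List C → Type}
    {lab' : ∀ u, L' u → Multiset (Σ e, M' e)} {S : Word L} {T : Word L'}
    (φ : Word M → Word M' → A) :
    colourSum lab S (fun X => colourSum lab' T fun Y => φ X Y) =
      colourSum lab' T (fun Y => colourSum lab S fun X => φ X Y) :=
  colourSum_sum _ _

theorem colourSum_zero {T : Word L} : colourSum lab T (fun _ => (0 : A)) = 0 := by
  simp [colourSum]

theorem isLinearMap_colourSum {V W : Type} [AddCommGroup V] [Module ℂ V] [AddCommGroup W]
    [Module ℂ W] (T : Word L) {φ : V → Word M → W} (h : ∀ X, IsLinearMap ℂ fun v => φ v X) :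
    IsLinearMap ℂ fun v => colourSum lab T (φ v) := by
  constructor
  · intro x y
    simp only [colourSum, (h _).map_add, Multiset.sum_map_add]
  · intro z x
    simp only [colourSum, (h _).map_smul, Multiset.smul_sum, Multiset.map_map, Function.comp_def]

variable [StringType C]

theorem length_of_mem_colourings (hlab : ∀ u x, ∀ y ∈ lab u x, y.1.length = u.length)
    {p : Piece L} {q : Piece M} (h : q ∈ p.colourings lab) :
    q.dom.length = p.dom.length ∧ q.cod.length = p.cod.length := by
  cases p with
  | cup c =>
    simp only [Piece.colourings, Multiset.mem_map] at h
    obtain ⟨c, -, rfl⟩ := h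
    simp [Piece.dom, Piece.cod]
  | cap c =>
    simp only [Piece.colourings, Multiset.mem_map] at h
    obtain ⟨c, -, rfl⟩ := h
    simp [Piece.dom, Piece.cod]
  | box u x =>
    simp only [Piece.colourings, Multiset.mem_map] at h
    obtain ⟨y, hy, rfl⟩ := h
    simp [Piece.dom, Piece.cod, hlab u x y hy]

theorem typed_whisker_inv (hlab : ∀ u x, ∀ y ∈ lab u x, y.1.length = u.length)
    {T : Word L} {u v : List Unit} (h : Typed u T v) {X : Word M} (hX : X ∈ colourings lab T)
    {l r u' y : List C} (hu : u'.length = u.length)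
    (hy : Typed (l ++ u' ++ r) (shift l.length X) y) :
    ∃ v', y = l ++ v' ++ r ∧ v'.length = v.length ∧ Typed u' X v' := by
  induction T generalizing u u' X with
  | nil =>
    obtain rfl : u = v := h
    simp only [colourings, Multiset.mem_singleton] at hX
    subst hX
    exact ⟨u', Eq.symm hy, hu, rfl⟩
  | cons s T ih =>
    simp only [colourings, Multiset.mem_bind, Multiset.mem_map] at hX
    obtain ⟨q, hq, X, hX, rfl⟩ := hX
    obtain ⟨x, ⟨a, b, h1, rfl, rfl⟩, h2⟩ := h
    obtain ⟨z, hz1, hz2⟩ := hy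
    obtain ⟨d1, d2⟩ := length_of_mem_colourings hlab hq
    obtain ⟨x', rfl, hx', hs⟩ := slice_whisker_inv (m := b.length) hz1 (by simp at hu ⊢; omega)
    obtain ⟨v', rfl, hv', ht⟩ := ih h2 hX (u' := x') (by simp at hx' ⊢; omega) hz2
    exact ⟨v', rfl, hv', _, hs, ht⟩

theorem typed_length (hlab : ∀ u x, ∀ y ∈ lab u x, y.1.length = u.length)
    {T : Word L} {u v : List Unit} (h : Typed u T v) {X : Word M} (hX : X ∈ colourings lab T)
    {u' y : List C} (hu : u'.length = u.length) (hy : Typed u' X y) : y.length = v.length := by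
  obtain ⟨v', rfl, h1, -⟩ := typed_whisker_inv hlab h hX (l := []) (r := []) hu
    (by simpa [shift_zero] using hy)
  simpa using h1

open Classical in
/-- The sum of a function over all choices of types for the strings that are consistent and induce
given types at the bottom and at the top. -/
noncomputable def typedSum (lab : ∀ u, L u → Multiset (Σ e, M e)) (u' v' : List C) (T : Word L)
    (φ : Word M → A) : A :=
  colourSum lab T fun X => if Typed u' X v' then φ X else 0

open Classical in
theorem typedSum_append (hlab : ∀ u x, ∀ y ∈ lab u x, y.1.length = u.length)
    {S T : Word L} {u v : List Unit} (hS : Typed u S v)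
    {u' w' : List C} (hu : u'.length = u.length) (φ : Word M → A) :
    typedSum lab u' w' (S ++ T) φ = ∑ v' : Seq C v.length,
      typedSum lab u' v'.1 S fun X => typedSum lab v'.1 w' T fun Y => φ (X ++ Y) := by
  simp only [typedSum, colourSum_append]
  have : ∀ X ∈ colourings lab S,
      colourSum lab T (fun Y => if Typed u' (X ++ Y) w' then φ (X ++ Y) else 0) =
      ∑ v' : Seq C v.length, if Typed u' X v'.1 then
        colourSum lab T (fun Y => if Typed v'.1 Y w' then φ (X ++ Y) else 0) else 0 := by
    intro X hX
    by_cases hx : ∃ x, Typed u' X x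
    · obtain ⟨x, hx⟩ := hx
      have hl := typed_length hlab hS hX hu hx
      rw [Finset.sum_eq_single (⟨x, hl⟩ : Seq C v.length)]
      · rw [if_pos hx]
        apply colourSum_congr
        intro Y _
        congr 1
        rw [typed_append]
        apply propext
        constructor
        · rintro ⟨z, h1, h2⟩
          obtain rfl := typed_unique hx h1
          exact h2
        · intro h; exact ⟨x, hx, h⟩
      · intro b _ hb
        rw [if_neg]
        intro h
        exact hb (Subtype.ext (typed_unique h hx))
      · simp
    · have e : ∀ Y, ¬ Typed u' (X ++ Y) w' := fun Y h => by
        rw [typed_append] at h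
        obtain ⟨x, h, -⟩ := h
        exact hx ⟨x, h⟩
      push Not at hx
      simp [e, hx, colourSum_zero]
  rw [colourSum_congr this]
  exact colourSum_sum _ _

theorem typedSum_congr {T : Word L} {u' v' : List C} {φ ψ : Word M → A}
    (h : ∀ X ∈ colourings lab T, Typed u' X v' → φ X = ψ X) :
    typedSum lab u' v' T φ = typedSum lab u' v' T ψ := by
  apply colourSum_congr
  intro X hX
  split_ifs with hh
  · exact h X hX hh
  · rfl

theorem typed_rot_iff (hlab : ∀ u x, ∀ y ∈ lab u x, y.1.length = u.length)
    {S : Word L} {c : Unit} {w : List Unit} (hS : Typed [] S (c :: w)) {X : Word M}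
    (hX : X ∈ colourings lab S) {a b d : C} {y : List C} :
    Typed [] (⟨0, .cup a⟩ :: (shift 1 X ++ [⟨0, .cap b⟩])) (y ++ [d]) ↔
      a = StringType.dual d ∧ b = StringType.dual d ∧ Typed [] X (d :: y) := by
  constructor
  · rintro ⟨x, ⟨l, r, hl, h1, rfl⟩, h2⟩
    simp only [Piece.dom, List.append_nil, List.nil_eq, List.append_eq_nil_iff] at h1
    obtain ⟨rfl, rfl⟩ := h1
    rw [typed_append] at h2
    obtain ⟨z, h2, h3⟩ := h2
    obtain ⟨v', rfl, hv, h4⟩ := typed_whisker_inv hlab hS hX (l := [a])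
      (r := [StringType.dual a]) (u' := []) rfl h2
    rw [typed_singleton] at h3
    obtain ⟨l, r, hl, h5, h6⟩ := h3
    obtain rfl : l = [] := List.length_eq_zero_iff.1 hl
    cases v' with
    | nil => simp at hv
    | cons e v' =>
      simp only [List.cons_append, List.nil_append, Piece.dom, List.cons.injEq, Piece.cod] at h5 h6
      obtain ⟨rfl, rfl, rfl⟩ := h5
      obtain ⟨rfl, h7⟩ := List.append_inj' h6 rfl
      simp only [List.cons.injEq, and_true] at h7
      subst h7
      simp only [StringType.dual_dual]
      exact ⟨trivial, trivial, h4⟩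
  · rintro ⟨rfl, rfl, h⟩
    exact typed_rot h

open Classical in
theorem typedSum_rot (hlab : ∀ u x, ∀ y ∈ lab u x, y.1.length = u.length)
    {S : Word L} {c : Unit} {w : List Unit} (hS : Typed [] S (c :: w)) (d : C) (y : List C)
    (φ : Word M → A) :
    typedSum lab [] (y ++ [d]) (rot c S) φ =
      typedSum lab [] (d :: y) S fun X => φ (rot d X) := by
  have key : ∀ ψ : Word M → A, colourSum lab (rot c S) ψ = colourSum lab S fun X =>
      ∑ a : C, ∑ b : C, ψ (⟨0, .cup a⟩ :: (shift 1 X ++ [⟨0, .cap b⟩])) := by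
    intro ψ
    simp only [rot, colourSum_cons, colourSum_append, Piece.colourings, colourSum_shift,
      colourSum_nil, Multiset.map_map, Function.comp_def]
    rw [← colourSum_sum]
    rfl
  rw [typedSum, key]
  apply colourSum_congr
  intro X hX
  simp only [typed_rot_iff hlab hS hX]
  by_cases h : Typed [] X (d :: y)
  · simp [h, ite_and, rot]
  · simp [h]

theorem typedSum_rotAll (hlab : ∀ u x, ∀ y ∈ lab u x, y.1.length = u.length)
    {S : Word L} {w w' : List Unit} (hS : Typed [] S (w ++ w')) {y y' : List C}
    (hy : y.length = w.length) (φ : Word M → A) :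
    typedSum lab [] (y' ++ y) (rotAll S w) φ =
      typedSum lab [] (y ++ y') S fun X => φ (rotAll X y) := by
  induction w generalizing S w' y y' with
  | nil =>
    obtain rfl := List.length_eq_zero_iff.1 hy
    simp [rotAll]
  | cons c w ih =>
    cases y with
    | nil => simp at hy
    | cons d y =>
      have h1 : Typed [] (rot c S) (w ++ (w' ++ [c])) := by simpa using typed_rot hS
      have h2 := ih h1 (y := y) (y' := y' ++ [d]) (by simpa using hy)
      have h3 := typedSum_rot hlab hS d (y ++ y') fun X => φ (rotAll X y)
      simp only [rotAll, List.append_assoc, List.cons_append, List.nil_append] at h2 h3 ⊢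
      exact h2.trans h3

theorem interchange_inv (hlab : ∀ u x, ∀ y ∈ lab u x, y.1.length = u.length)
    {S S' : Word L} {u v u' v' : List Unit} (hS : Typed u S v) (hS' : Typed u' S' v')
    {X X' : Word M} (hX : X ∈ colourings lab S) (hX' : X' ∈ colourings lab S')
    {x x' y y' : List C} (hx : x.length = u.length) (hx' : x'.length = u'.length)
    (hy : y.length = v.length) :
    (Typed (x ++ x') (X ++ shift v.length X') (y ++ y') ↔ Typed x X y ∧ Typed x' X' y') ∧
    (Typed (x ++ x') (shift u.length X' ++ X) (y ++ y') ↔ Typed x X y ∧ Typed x' X' y') := by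
  refine ⟨⟨fun h => ?_, fun h => ?_⟩, ⟨fun h => ?_, fun h => ?_⟩⟩
  · obtain ⟨z, h1, h2⟩ := typed_append.1 h
    obtain ⟨z, rfl, h3, h4⟩ := typed_whisker_inv hlab hS hX (l := []) (r := x') hx
      (by simpa [shift_zero] using h1)
    rw [← h3] at h2
    obtain ⟨z', h5, h6, h7⟩ := typed_whisker_inv hlab hS' hX' (l := z) (r := []) hx'
      (by simpa using h2)
    rw [List.append_nil] at h5
    obtain ⟨rfl, rfl⟩ := List.append_inj h5 (by omega)
    exact ⟨h4, h7⟩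
  · rw [← hy]
    exact (typed_interchange h.1 h.2).1
  · obtain ⟨z, h1, h2⟩ := typed_append.1 h
    rw [← hx] at h1
    obtain ⟨z, rfl, h3, h4⟩ := typed_whisker_inv hlab hS' hX' (l := x) (r := []) hx'
      (by simpa using h1)
    obtain ⟨z', h5, h6, h7⟩ := typed_whisker_inv hlab hS hX (l := []) (r := z) hx
      (by simpa [shift_zero] using h2)
    rw [List.nil_append] at h5
    obtain ⟨rfl, rfl⟩ := List.append_inj h5 (by omega)
    exact ⟨h7, h4⟩
  · rw [← hx]
    exact (typed_interchange h.1 h.2).2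

open Classical in
theorem typedSum_isotopic (hlab : ∀ u x, ∀ y ∈ lab u x, y.1.length = u.length)
    {u v : List Unit} {S T : Word L} (h : Isotopic u v S T) {u' v' : List C}
    (hu : u'.length = u.length) (hv : v'.length = v.length) (φ : Word M → A)
    (hφ : ∀ X Y, Isotopic u' v' X Y → φ X = φ Y) :
    typedSum lab u' v' S φ = typedSum lab u' v' T φ := by
  induction h generalizing u' v' φ with
  | refl _ => rfl
  | symm _ ih => exact (ih hu hv φ hφ).symm
  | trans _ _ ih ih' => exact (ih hu hv φ hφ).trans (ih' hu hv φ hφ)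
  | @comp u v w S S' T T' h h' ih ih' =>
    rw [typedSum_append hlab h.typed.1 hu, typedSum_append hlab h.typed.2 hu]
    refine Finset.sum_congr rfl fun x _ => ?_
    have e1 : (typedSum lab u' x.1 S fun X => typedSum lab x.1 v' T fun Y => φ (X ++ Y)) =
        typedSum lab u' x.1 S fun X => typedSum lab x.1 v' T' fun Y => φ (X ++ Y) := by
      refine typedSum_congr fun X _ hX => ih' x.2 hv _ fun Y Y' hY => ?_
      exact hφ _ _ ((Isotopic.refl hX).comp hY)
    rw [e1]
    refine ih hu x.2 _ fun X X' hX => ?_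
    refine typedSum_congr fun Y _ hY => ?_
    exact hφ _ _ (hX.comp (.refl hY))
  | @whisker u v S T l r h ih =>
    obtain ⟨l', m, rfl, hl', hm⟩ : ∃ l' m, u' = l' ++ m ∧ l'.length = l.length ∧
        m.length = u.length + r.length :=
      ⟨u'.take l.length, u'.drop l.length, by simp, by simp at hu ⊢; omega,
        by simp at hu ⊢; omega⟩
    obtain ⟨x, r', rfl, hx, hr'⟩ : ∃ x r', m = x ++ r' ∧ x.length = u.length ∧
        r'.length = r.length :=
      ⟨m.take u.length, m.drop u.length, by simp, by simp; omega, by simp; omega⟩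
    rw [← List.append_assoc] at hu hφ ⊢
    simp only [typedSum, colourSum_shift, ← hl']
    by_cases hy : ∃ y, v' = l' ++ y ++ r' ∧ y.length = v.length
    · obtain ⟨y, rfl, hy⟩ := hy
      have e : ∀ (W : Word L), Typed u W v → ∀ X ∈ colourings lab W,
          (if Typed (l' ++ x ++ r') (shift l'.length X) (l' ++ y ++ r') then φ (shift l'.length X)
            else 0) = if Typed x X y then φ (shift l'.length X) else 0 := by
        intro W hW X hX
        congr 1
        apply propext
        constructor
        · intro hh
          obtain ⟨z, h1, -, h3⟩ := typed_whisker_inv hlab hW hX hx hh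
          simp only [List.append_assoc, List.append_cancel_left_eq,
            List.append_cancel_right_eq] at h1
          rwa [h1]
        · exact typed_whisker l' r'
      rw [colourSum_congr (e S h.typed.1), colourSum_congr (e T h.typed.2)]
      exact ih hx hy _ fun X Y hXY => hφ _ _ (hXY.whisker l' r')
    · have e : ∀ (W : Word L), Typed u W v → ∀ X ∈ colourings lab W,
          (if Typed (l' ++ x ++ r') (shift l'.length X) v' then φ (shift l'.length X)
            else 0) = 0 := by
        intro W hW X hX
        rw [if_neg]
        intro hh
        obtain ⟨z, h1, h2, -⟩ := typed_whisker_inv hlab hW hX hx hh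
        exact hy ⟨z, h1, h2⟩
      rw [colourSum_congr (e S h.typed.1), colourSum_congr (e T h.typed.2), colourSum_zero,
        colourSum_zero]
  | @interchange u v w w' S S' h h' =>
    obtain ⟨x, x', rfl, hx, hx'⟩ : ∃ x x', u' = x ++ x' ∧ x.length = u.length ∧
        x'.length = w.length :=
      ⟨u'.take u.length, u'.drop u.length, by simp, by simp at hu ⊢; omega,
        by simp at hu ⊢; omega⟩
    obtain ⟨y, y', rfl, hy, hy'⟩ : ∃ y y', v' = y ++ y' ∧ y.length = v.length ∧
        y'.length = w'.length :=
      ⟨v'.take v.length, v'.drop v.length, by simp, by simp at hv ⊢; omega,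
        by simp at hv ⊢; omega⟩
    simp only [typedSum, colourSum_append, colourSum_shift]
    rw [colourSum_comm]
    apply colourSum_congr
    intro Y hY
    apply colourSum_congr
    intro X hX
    obtain ⟨e1, e2⟩ := interchange_inv hlab h h' hX hY (y' := y') hx hx' hy
    simp only [e1, e2]
    split_ifs with hh
    · rw [← hx, ← hy]
      exact hφ _ _ (.interchange hh.1 hh.2)
    · rfl
  | zigzag_left c =>
    obtain ⟨x, rfl⟩ := List.length_eq_one_iff.1 hu
    obtain ⟨y, rfl⟩ := List.length_eq_one_iff.1 hv
    simp only [typedSum, colourSum_cons, colourSum_nil, Piece.colourings, Multiset.map_map,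
      Function.comp_def, zigzag_left_iff]
    change (∑ a : C, ∑ b : C, _) = _
    by_cases hxy : x = y
    · subst hxy
      simpa [ite_and, Typed] using hφ _ _ (.zigzag_left x)
    · simp [hxy, Typed]
  | zigzag_right c =>
    obtain ⟨x, rfl⟩ := List.length_eq_one_iff.1 hu
    obtain ⟨y, rfl⟩ := List.length_eq_one_iff.1 hv
    simp only [typedSum, colourSum_cons, colourSum_nil, Piece.colourings, Multiset.map_map,
      Function.comp_def, zigzag_right_iff]
    change (∑ a : C, ∑ b : C, _) = _
    by_cases hxy : x = y
    · subst hxy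
      simpa [ite_and, Typed] using hφ _ _ (.zigzag_right x)
    · simp [hxy, Typed]
  | @full_turn w S h =>
    obtain rfl := List.length_eq_zero_iff.1 hu
    have := typedSum_rotAll hlab (w := w) (w' := []) (by simpa using h) (y' := []) hv φ
    simp only [List.nil_append, List.append_nil] at this
    rw [this]
    refine typedSum_congr fun X _ hX => ?_
    exact hφ _ _ (.full_turn hX)

theorem typedSum_ev (P : PlanarAlgebra C) {lab : ∀ u, L u → Multiset (Σ e, P.V e)} (w : List C)
    (T : Word L) : typedSum lab [] w T (P.ev w) = colourSum lab T (P.ev w) := by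
  apply colourSum_congr
  intro X _
  split_ifs with h
  · rfl
  · exact (P.ev_of_not h).symm

/-- The choices of a boundary for an inner disc of an unoriented diagram that carries a family of
elements of `P`, one for each choice. -/
def familyLabels (P : PlanarAlgebra C) (u : List Unit) (x : ∀ e : Seq C u.length, P.V e.1) :
    Multiset (Σ e, P.V e) :=
  Finset.univ.val.map fun e : Seq C u.length => ⟨e.1, x e⟩

theorem length_familyLabels (P : PlanarAlgebra C) :
    ∀ u x, ∀ y ∈ familyLabels P u x, y.1.length = u.length := by
  intro u x y hy
  simp only [familyLabels, Multiset.mem_map] at hy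
  obtain ⟨e, -, rfl⟩ := hy
  exact e.2

theorem colourSum_box (P : PlanarAlgebra C) (p : ℕ) (k : List Unit)
    (x : ∀ e : Seq C k.length, P.V e.1) (B : Word fun u : List Unit => ∀ e : Seq C u.length, P.V e.1)
    (φ : Word P.V → A) :
    colourSum (familyLabels P) (⟨p, .box k x⟩ :: B) φ = ∑ e : Seq C k.length,
      colourSum (familyLabels P) B fun Y => φ (⟨p, .box e.1 (x e)⟩ :: Y) := by
  simp only [colourSum_cons, Piece.colourings, familyLabels, Multiset.map_map, Function.comp_def]
  rfl

/-- The inner disc labelled by the family `x` may be replaced by the sum over all choices of types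
for the strings of the diagram `D`, if this sum is the family `x`. -/
theorem colourSum_insert (P : PlanarAlgebra C)
    {A B : Word fun u : List Unit => ∀ e : Seq C u.length, P.V e.1} {p : ℕ} {k w : List Unit}
    {D : Word fun u : List Unit => ∀ e : Seq C u.length, P.V e.1} (hD : Typed [] D k)
    {x : ∀ e : Seq C k.length, P.V e.1}
    (hx : ∀ e, x e = colourSum (familyLabels P) D (P.ev e.1))
    (h : Typed [] (A ++ ⟨p, .box k x⟩ :: B) w) (e : List C) :
    colourSum (familyLabels P) (A ++ ⟨p, .box k x⟩ :: B) (P.ev e) =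
      colourSum (familyLabels P) (A ++ shift p D ++ B) (P.ev e) := by
  simp only [colourSum_append, colourSum_box, colourSum_shift]
  apply colourSum_congr
  intro X hX
  obtain ⟨y, hA, z, ⟨l, r, h1, rfl, rfl⟩, -⟩ := typed_append.1 h
  simp only [Piece.dom, List.append_nil] at hA h1
  have e1 : ∀ c : Seq C k.length, (colourSum (familyLabels P) B fun Y =>
      P.ev e (X ++ ⟨p, .box c.1 (x c)⟩ :: Y)) = colourSum (familyLabels P) D fun Z =>
        colourSum (familyLabels P) B fun Y => P.ev e (X ++ ⟨p, .box c.1 (P.ev c.1 Z)⟩ :: Y) := by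
    intro c
    rw [hx, colourSum_comm]
    apply colourSum_congr
    intro Y _
    let Λ : P.V c.1 →ₗ[ℂ] P.V e := (P.ev_linear X Y p).mk'
    change Λ _ = ((colourings (familyLabels P) D).map fun Z => Λ (P.ev c.1 Z)).sum
    rw [colourSum, map_multiset_sum, Multiset.map_map]
    rfl
  simp only [e1]
  change ((Finset.univ : Finset (Seq C k.length)).val.map fun c =>
    colourSum (familyLabels P) D fun Z => colourSum (familyLabels P) B fun Y =>
      P.ev e (X ++ ⟨p, .box c.1 (P.ev c.1 Z)⟩ :: Y)).sum = _
  rw [← colourSum_sum]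
  apply colourSum_congr
  intro Z hZ
  rw [← colourSum_sum]
  apply colourSum_congr
  intro Y _
  change ∑ c : Seq C k.length, P.ev e (X ++ ⟨p, .box c.1 (P.ev c.1 Z)⟩ :: Y) = _
  by_cases hX' : ∃ a, Typed [] X a
  · obtain ⟨a, ha⟩ := hX'
    have hl := typed_length (length_familyLabels P) hA hX rfl ha
    obtain ⟨a, b, rfl, hpa⟩ : ∃ a' b, a = a' ++ b ∧ a'.length = p :=
      ⟨a.take p, a.drop p, by simp, by simp at hl ⊢; omega⟩
    by_cases hZ' : ∃ z, Typed [] Z z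
    · obtain ⟨z, hz⟩ := hZ'
      have hlz := typed_length (length_familyLabels P) hD hZ rfl hz
      rw [Finset.sum_eq_single (⟨z, hlz⟩ : Seq C k.length)]
      · rw [P.ev_insert ha hpa hz]
      · intro c _ hc
        rw [P.ev_of_not (T := Z), (P.ev_linear X Y p).map_zero]
        intro hh
        exact hc (Subtype.ext (typed_unique hh hz))
      · simp
    · push Not at hZ'
      rw [Finset.sum_eq_zero, P.ev_of_not]
      · intro hh
        rw [typed_append, ] at hh
        obtain ⟨y, hh, -⟩ := hh
        obtain ⟨y', h2, h3⟩ := typed_append.1 hh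
        obtain rfl := typed_unique h2 ha
        rw [← hpa] at h3
        obtain ⟨v', -, -, h4⟩ := typed_whisker_inv (length_familyLabels P) hD hZ (l := a) (r := b)
          (u' := []) rfl (by simpa using h3)
        exact hZ' _ h4
      · intro c _
        rw [P.ev_of_not (hZ' _), (P.ev_linear X Y p).map_zero]
  · push Not at hX'
    have e2 : ∀ W : Word P.V, P.ev e (X ++ W) = 0 := fun W => P.ev_of_not fun hh => by
      obtain ⟨y, hh, -⟩ := typed_append.1 hh
      exact hX' _ hh
    simp [e2]

/-- The unoriented planar algebra underlying a planar algebra with strings of types `C`: its elements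
with boundary points `u` are the families of elements of `P`, one for each choice of types of the
boundary points, and an unoriented diagram acts as the sum of all diagrams obtained from it by
choosing types for its strings. For `C = Bool` this is the sum over all orientations of the
strings, closed strings included. -/
noncomputable def PlanarAlgebra.unoriented (P : PlanarAlgebra C) : PlanarAlgebra Unit where
  V u := ∀ e : Seq C u.length, P.V e.1
  act D := fun e => colourSum (familyLabels P) D.1 (P.ev e.1)
  act_linear := by
    intro w k A B p h
    have key : ∀ e : List C, IsLinearMap ℂ fun x : ∀ e : Seq C k.length, P.V e.1 =>
        colourSum (familyLabels P) (A ++ ⟨p, .box k x⟩ :: B) (P.ev e) := by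
      intro e
      simp only [colourSum_append]
      refine isLinearMap_colourSum A fun X => ?_
      simp only [colourSum_box]
      constructor
      · intro x y
        rw [← Finset.sum_add_distrib]
        refine Finset.sum_congr rfl fun c _ => ?_
        exact (isLinearMap_colourSum B fun Y => P.ev_linear X Y p).map_add _ _
      · intro z x
        rw [Finset.smul_sum]
        refine Finset.sum_congr rfl fun c _ => ?_
        exact (isLinearMap_colourSum B fun Y => P.ev_linear X Y p).map_smul _ _
    exact ⟨fun x y => funext fun e => (key e.1).map_add x y,
      fun z x => funext fun e => (key e.1).map_smul z x⟩
  act_isotopic S T h := by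
    funext e
    rw [← typedSum_ev, ← typedSum_ev]
    exact typedSum_isotopic (length_familyLabels P) h rfl e.2 _ fun X Y hXY => P.ev_isotopic hXY
  act_single x := by
    funext e
    simp only [Diagram.single, colourSum_box, colourSum_nil]
    rw [Finset.sum_eq_single e]
    · exact (P.ev_of_typed (Diagram.single (x e)).2).trans (P.act_single _)
    · intro c _ hc
      refine P.ev_of_not fun hh => hc (Subtype.ext ?_)
      exact typed_unique (Diagram.single (x c)).2 hh
    · simp
  act_insert A B p D h h' := by
    funext e
    exact colourSum_insert P D.2 (fun _ => rfl) h e.1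

end Orientations

section Tensors

/-- The contribution of a piece to a product over inner discs. -/
def Piece.weight {C : Type} : Piece (fun _ : List C => ℂ) → ℂ
  | .cup _ => 1
  | .cap _ => 1
  | .box _ x => x

/-- The product of the labels of the inner discs. -/
def weight {C : Type} (T : Word fun _ : List C => ℂ) : ℂ := (T.map fun s => s.piece.weight).prod

theorem weight_append {C : Type} (S T : Word fun _ : List C => ℂ) :
    weight (S ++ T) = weight S * weight T := by
  simp [weight]

theorem weight_shift {C : Type} (n : ℕ) (T : Word fun _ : List C => ℂ) :
    weight (shift n T) = weight T := by
  simp [weight, shift, Function.comp_def]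

theorem weight_cons {C : Type} (s : Slice fun _ : List C => ℂ) (T : Word fun _ : List C => ℂ) :
    weight (s :: T) = s.piece.weight * weight T := by
  simp [weight]

theorem weight_rotAll {C : Type} [StringType C] (w : List C) (T : Word fun _ : List C => ℂ) :
    weight (rotAll T w) = weight T := by
  induction w generalizing T with
  | nil => rfl
  | cons c w ih =>
    rw [rotAll, ih, rot, weight_cons, weight_append, weight_shift]
    simp [weight, Piece.weight]

theorem weight_isotopic {C : Type} [StringType C] {u v : List C} {S T : Word fun _ : List C => ℂ}
    (h : Isotopic u v S T) : weight S = weight T := by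
  induction h with
  | refl _ => rfl
  | symm _ ih => exact ih.symm
  | trans _ _ ih ih' => exact ih.trans ih'
  | comp _ _ ih ih' => rw [weight_append, weight_append, ih, ih']
  | whisker l r _ ih => rw [weight_shift, weight_shift, ih]
  | interchange _ _ => rw [weight_append, weight_append, weight_shift, weight_shift, mul_comm]
  | zigzag_left c => simp [weight, Piece.weight]
  | zigzag_right c => simp [weight, Piece.weight]
  | full_turn _ => exact weight_rotAll _ _

/-- The planar algebra all of whose box spaces are `ℂ` and in which a diagram acts by
multiplication of its inputs. -/
def scalars (C : Type) [StringType C] : PlanarAlgebra C where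
  V _ := ℂ
  act D := weight D.1
  act_linear A B p h := by
    constructor <;> intros <;> simp [weight_append, weight_cons, Piece.weight] <;> ring
  act_isotopic S T h := weight_isotopic h
  act_single x := by simp [Diagram.single, weight, Piece.weight]
  act_insert A B p D h h' := by
    simp [weight_append, weight_cons, Piece.weight, weight_shift]

/-- Indices of a basis, used as types of strings: the basis is self-dual. -/
instance (m : ℕ) : StringType (Fin m) := ⟨id, fun _ => rfl⟩

/-- The planar algebra of tensors over `ℂ²`: the elements with `n` boundary points are the elements
of `(ℂ²)^{⊗n}`, given by their coordinates with respect to the standard basis, and a diagram acts by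
contraction of tensors along its strings with respect to the standard symmetric bilinear form, that
is, by summation over all assignments of basis indices to the strings. -/
noncomputable def tensors : PlanarAlgebra Unit := (scalars (Fin 2)).unoriented

open scoped TensorProduct in
/-- The tensor with given coordinates. -/
noncomputable def tensorOf (n : ℕ) :
    (Seq (Fin 2) n → ℂ) →ₗ[ℂ] (⨂[ℂ] _ : Fin n, (Fin 2 → ℂ)) :=
  ∑ x : Seq (Fin 2) n, (LinearMap.proj x).smulRight
    (PiTensorProduct.tprod ℂ fun i : Fin n =>
      (Pi.single (x.1.get (i.cast x.2.symm)) (1 : ℂ) : Fin 2 → ℂ))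

/-- The standard representation of `O(2)` on `ℂ²`. -/
noncomputable def stdRep :
    Representation ℂ (Matrix.orthogonalGroup (Fin 2) ℝ) (Fin 2 → ℂ) :=
  ((Matrix.toLinAlgEquiv' (R := ℂ) (n := Fin 2) :
      Matrix (Fin 2) (Fin 2) ℂ →* ((Fin 2 → ℂ) →ₗ[ℂ] (Fin 2 → ℂ))).comp
    ((Complex.ofRealHom.mapMatrix : Matrix (Fin 2) (Fin 2) ℝ →+* Matrix (Fin 2) (Fin 2) ℂ) :
      Matrix (Fin 2) (Fin 2) ℝ →* Matrix (Fin 2) (Fin 2) ℂ)).comp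
    (Matrix.orthogonalGroup (Fin 2) ℝ).subtype

open scoped TensorProduct in
/-- The `n`-th tensor power of the standard representation of `O(2)`. -/
noncomputable def tensorRep (n : ℕ) :
    Representation ℂ (Matrix.orthogonalGroup (Fin 2) ℝ) (⨂[ℂ] _ : Fin n, (Fin 2 → ℂ)) :=
  PiTensorProduct.mapMonoidHom.comp (MonoidHom.pi fun _ => stdRep)

/-- The coordinates of the elements of `(ℂ²)^{⊗n}` that are invariant under `O(2)`. -/
noncomputable def invariantTensors (u : List Unit) : Submodule ℂ (tensors.V u) :=
  (tensorRep u.length).invariants.comap (tensorOf u.length)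

/-- Product of entries of a matrix. -/
def entries (g : Matrix (Fin 2) (Fin 2) ℂ) (x y : List (Fin 2)) : ℂ :=
  (List.zipWith (fun a b => g a b) x y).prod

theorem stdRep_apply (g : Matrix.orthogonalGroup (Fin 2) ℝ) (v : Fin 2 → ℂ) :
    stdRep g v = (g.1.map Complex.ofReal).mulVec v := rfl

theorem mem_invariantTensors {u : List Unit} (t : Seq (Fin 2) u.length → ℂ) :
    t ∈ invariantTensors u ↔ ∀ (g : Matrix.orthogonalGroup (Fin 2) ℝ) (x : Seq (Fin 2) u.length),
      ∑ y : Seq (Fin 2) u.length, entries (g.1.map Complex.ofReal) x.1 y.1 * t y = t x := by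
  let idx : Seq (Fin 2) u.length → Fin u.length → Fin 2 :=
    fun x i => x.1.get (i.cast x.2.symm)
  have hidx : Function.Injective idx := by
    intro x y h
    apply Subtype.ext
    apply List.ext_get (x.2.trans y.2.symm)
    intro n h1 h2
    exact congrFun h ⟨n, by rw [← x.2]; exact h1⟩
  have hsurj : ∀ p, ∃ x, idx x = p := fun p =>
    ⟨⟨List.ofFn p, by simp⟩, by funext i; simp [idx]⟩
  let b := Basis.piTensorProduct (fun _ : Fin u.length => Pi.basisFun ℂ (Fin 2))
  have hb : ∀ (v : Fin u.length → Fin 2 → ℂ) p,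
      b.repr (PiTensorProduct.tprod ℂ v) p = ∏ i, v i (p i) := by
    intro v p
    simp [b, Basis.piTensorProduct_repr_tprod_apply]
  have h1 : ∀ x, b.repr (tensorOf u.length t) (idx x) = t x := by
    intro x
    simp only [tensorOf, LinearMap.sum_apply, LinearMap.smulRight_apply, LinearMap.proj_apply,
      map_sum, map_smul, Finsupp.coe_finsetSum, Finset.sum_apply, Finsupp.smul_apply, smul_eq_mul,
      hb]
    rw [Finset.sum_eq_single x]
    · simp [idx]
    · intro y _ hy
      have : ∃ i, idx y i ≠ idx x i := by
        by_contra hh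
        push Not at hh
        exact hy (hidx (funext hh))
      obtain ⟨i, hi⟩ := this
      rw [Finset.prod_eq_zero (Finset.mem_univ i), mul_zero]
      exact Pi.single_eq_of_ne (Ne.symm hi) _
    · simp
  have h2 : ∀ (g : Matrix.orthogonalGroup (Fin 2) ℝ) x,
      b.repr (tensorRep u.length g (tensorOf u.length t)) (idx x) =
        ∑ y : Seq (Fin 2) u.length, entries (g.1.map Complex.ofReal) x.1 y.1 * t y := by
    intro g x
    have e : tensorRep u.length g = PiTensorProduct.map fun _ => stdRep g := rfl
    simp only [e, tensorOf, LinearMap.sum_apply, LinearMap.smulRight_apply, LinearMap.proj_apply,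
      map_sum, map_smul, Finsupp.coe_finsetSum, Finset.sum_apply, Finsupp.smul_apply, smul_eq_mul,
      PiTensorProduct.map_tprod, hb]
    refine Finset.sum_congr rfl fun y _ => ?_
    rw [mul_comm]
    congr 1
    simp only [stdRep_apply, Matrix.mulVec_single_one, Matrix.col_apply]
    rw [entries, ← List.prod_ofFn]
    congr 1
    apply List.ext_get
    · simp [x.2, y.2]
    · intro n _ _
      simp [idx]
  change (∀ g, tensorRep u.length g (tensorOf u.length t) = tensorOf u.length t) ↔ _
  refine forall_congr' fun g => ?_
  rw [← b.repr.injective.eq_iff, DFunLike.ext_iff]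
  constructor
  · intro h x
    rw [← h2, h, h1]
  · intro h p
    obtain ⟨x, rfl⟩ := hsurj p
    rw [h2, h1, h]

theorem entries_cons (g : Matrix (Fin 2) (Fin 2) ℂ) (a b : Fin 2) (x y : List (Fin 2)) :
    entries g (a :: x) (b :: y) = g a b * entries g x y := by
  simp [entries]

theorem entries_append (g : Matrix (Fin 2) (Fin 2) ℂ) {x y : List (Fin 2)} (h : x.length = y.length)
    (x' y' : List (Fin 2)) : entries g (x ++ x') (y ++ y') = entries g x y * entries g x' y' := by
  simp [entries, List.zipWith_append h]

/-- Coordinates of tensors. -/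
abbrev Tens (u : List Unit) : Type := Seq (Fin 2) u.length → ℂ

/-- The choices of basis indices at the boundary of an inner disc, with the coordinate of its
label. -/
def tensLabels (u : List Unit) (t : Tens u) : Multiset (Σ _ : List (Fin 2), ℂ) :=
  Finset.univ.val.map fun e : Seq (Fin 2) u.length => ⟨e.1, t e⟩

theorem length_tensLabels : ∀ u t, ∀ y ∈ tensLabels u t, y.1.length = u.length :=
  length_familyLabels (scalars (Fin 2))

/-- The matrix coefficients of the linear map of tensors given by a diagram. -/
noncomputable def coeff (T : Word Tens) (x y : List (Fin 2)) : ℂ :=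
  typedSum tensLabels x y T weight

theorem coeff_append {S T : Word Tens} {u v : List Unit} (hS : Typed u S v)
    {x : List (Fin 2)} (hx : x.length = u.length) (y : List (Fin 2)) :
    coeff (S ++ T) x y = ∑ z : Seq (Fin 2) v.length, coeff S x z.1 * coeff T z.1 y := by
  classical
  refine (typedSum_append length_tensLabels hS hx _).trans (Finset.sum_congr rfl fun z _ => ?_)
  simp only [coeff, typedSum, colourSum, ← Multiset.sum_map_mul_right]
  congr 1
  apply Multiset.map_congr rfl
  intro X _
  split_ifs with h
  · rw [← Multiset.sum_map_mul_left]
    congr 1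
    apply Multiset.map_congr rfl
    intro Y _
    split_ifs
    · exact weight_append X Y
    · simp
  · simp

/-- The linear map given by a diagram commutes with the tensor powers of `g`. -/
def Equivariant (g : Matrix (Fin 2) (Fin 2) ℂ) (T : Word Tens) (m n : ℕ) : Prop :=
  ∀ (x : Seq (Fin 2) m) (y : Seq (Fin 2) n),
    ∑ z : Seq (Fin 2) n, entries g y.1 z.1 * coeff T x.1 z.1 =
      ∑ z : Seq (Fin 2) m, coeff T z.1 y.1 * entries g z.1 x.1

theorem Equivariant.append {g : Matrix (Fin 2) (Fin 2) ℂ} {S T : Word Tens}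
    {u v w : List Unit} (hS : Typed u S v) (h : Equivariant g S u.length v.length)
    (h' : Equivariant g T v.length w.length) : Equivariant g (S ++ T) u.length w.length := by
  intro x y
  simp only [coeff_append hS x.2, Finset.mul_sum]
  rw [Finset.sum_comm]
  have e1 : ∀ z : Seq (Fin 2) v.length,
      ∑ y' : Seq (Fin 2) w.length, entries g y.1 y'.1 * (coeff S x.1 z.1 * coeff T z.1 y'.1) =
        ∑ z' : Seq (Fin 2) v.length, coeff T z'.1 y.1 * (entries g z'.1 z.1 * coeff S x.1 z.1) := by
    intro z
    have := congrArg (coeff S x.1 z.1 * ·) (h' z y)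
    simp only [Finset.mul_sum] at this
    refine (Finset.sum_congr rfl fun _ _ => by ring).trans (this.trans
      (Finset.sum_congr rfl fun _ _ => by ring))
  rw [Finset.sum_congr rfl fun z _ => e1 z, Finset.sum_comm]
  simp only [← Finset.mul_sum, h x _]
  simp only [Finset.mul_sum]
  rw [Finset.sum_comm]
  refine Finset.sum_congr rfl fun z _ => ?_
  rw [coeff_append hS z.2, Finset.sum_mul]
  exact Finset.sum_congr rfl fun _ _ => by ring

/-- A nonempty sequence is a first entry followed by a sequence. -/
def seqCons (n : ℕ) : Seq (Fin 2) (n + 1) ≃ Fin 2 × Seq (Fin 2) n where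
  toFun z := match z with
    | ⟨[], h⟩ => absurd h (Nat.succ_ne_zero n).symm
    | ⟨c :: z, h⟩ => (c, ⟨z, Nat.succ.inj h⟩)
  invFun z := ⟨z.1 :: z.2.1, by simp [z.2.2]⟩
  left_inv := by
    rintro ⟨_ | ⟨c, z⟩, h⟩
    · simp at h
    · rfl
  right_inv := by
    rintro ⟨c, z, h⟩
    rfl

theorem sum_seq_succ {A : Type} [AddCommMonoid A] (n : ℕ) (f : List (Fin 2) → A) :
    ∑ z : Seq (Fin 2) (n + 1), f z.1 = ∑ c : Fin 2, ∑ z : Seq (Fin 2) n, f (c :: z.1) := by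
  rw [← Fintype.sum_prod_type' fun (c : Fin 2) (z : Seq (Fin 2) n) => f (c :: z.1)]
  exact ((seqCons n).symm.sum_comp fun z : Seq (Fin 2) (n + 1) => f z.1).symm

theorem coeff_singleton (s : Slice Tens) (x y : List (Fin 2)) :
    coeff [s] x y = ((s.piece.colourings tensLabels).map fun q =>
      open Classical in if (⟨s.pos, q⟩ : Slice fun _ : List (Fin 2) => ℂ).Typed x y then q.weight else 0).sum := by
  classical
  simp only [coeff, typedSum, colourSum_cons, colourSum_nil, typed_singleton]
  simp [weight]

theorem slice_typed_cons {L : List (Fin 2) → Type} (p : ℕ) (q : Piece L) (c d : Fin 2)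
    (x y : List (Fin 2)) : (⟨p + 1, q⟩ : Slice L).Typed (c :: x) (d :: y) ↔
      c = d ∧ (⟨p, q⟩ : Slice L).Typed x y := by
  constructor
  · rintro ⟨l, r, h1, h2, h3⟩
    cases l with
    | nil => simp at h1
    | cons e l =>
      simp only [List.cons_append, List.cons.injEq] at h2 h3
      obtain ⟨rfl, rfl⟩ := h2
      obtain ⟨rfl, rfl⟩ := h3
      exact ⟨rfl, l, r, by simpa using h1, rfl, rfl⟩
  · rintro ⟨rfl, l, r, h1, rfl, rfl⟩
    exact ⟨c :: l, r, by simpa using h1, rfl, rfl⟩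

theorem coeff_succ (p : ℕ) (π : Piece Tens) (c d : Fin 2) (x y : List (Fin 2)) :
    coeff [⟨p + 1, π⟩] (c :: x) (d :: y) = if c = d then coeff [⟨p, π⟩] x y else 0 := by
  classical
  simp only [coeff_singleton, slice_typed_cons]
  split_ifs with h <;> simp [h]

theorem coeff_cup (a b : Fin 2) (x y : List (Fin 2)) :
    coeff [⟨0, .cup ()⟩] x (a :: b :: y) = if a = b then (if x = y then 1 else 0) else 0 := by
  classical
  have key : ∀ c : Fin 2, (⟨0, .cup c⟩ : Slice fun _ : List (Fin 2) => ℂ).Typed x (a :: b :: y) ↔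
      c = a ∧ a = b ∧ x = y := by
    intro c
    constructor
    · rintro ⟨l, r, h1, h2, h3⟩
      obtain rfl := List.length_eq_zero_iff.1 h1
      simp only [Piece.dom, Piece.cod, List.nil_append, List.cons_append, List.cons.injEq] at h2 h3
      obtain ⟨rfl, rfl, rfl⟩ := h3
      exact ⟨rfl, rfl, h2⟩
    · rintro ⟨rfl, rfl, rfl⟩
      exact ⟨[], x, rfl, rfl, rfl⟩
  simp only [coeff_singleton, Piece.colourings, Multiset.map_map, Function.comp_def, key,
    Piece.weight]
  change ∑ c : Fin 2, _ = _
  simp [ite_and]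

theorem coeff_cap (a b : Fin 2) (x y : List (Fin 2)) :
    coeff [⟨0, .cap ()⟩] (a :: b :: x) y = if a = b then (if x = y then 1 else 0) else 0 := by
  classical
  have key : ∀ c : Fin 2, (⟨0, .cap c⟩ : Slice fun _ : List (Fin 2) => ℂ).Typed (a :: b :: x) y ↔
      c = a ∧ a = b ∧ x = y := by
    intro c
    constructor
    · rintro ⟨l, r, h1, h2, h3⟩
      obtain rfl := List.length_eq_zero_iff.1 h1
      simp only [Piece.dom, Piece.cod, List.nil_append, List.cons_append, List.cons.injEq] at h2 h3
      obtain ⟨rfl, rfl, rfl⟩ := h2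
      exact ⟨rfl, rfl, h3.symm⟩
    · rintro ⟨rfl, rfl, rfl⟩
      exact ⟨[], x, rfl, rfl, rfl⟩
  simp only [coeff_singleton, Piece.colourings, Multiset.map_map, Function.comp_def, key,
    Piece.weight]
  change ∑ c : Fin 2, _ = _
  simp [ite_and]

theorem coeff_box {w : List Unit} (t : Tens w) (z : Seq (Fin 2) w.length)
    (x y : List (Fin 2)) :
    coeff [⟨0, .box w t⟩] x (z.1 ++ y) = if x = y then t z else 0 := by
  classical
  have key : ∀ c : Seq (Fin 2) w.length,
      (⟨0, .box c.1 (t c)⟩ : Slice fun _ : List (Fin 2) => ℂ).Typed x (z.1 ++ y) ↔ c = z ∧ x = y := by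
    intro c
    constructor
    · rintro ⟨l, r, h1, h2, h3⟩
      obtain rfl := List.length_eq_zero_iff.1 h1
      simp only [Piece.dom, Piece.cod, List.nil_append] at h2 h3
      obtain ⟨h4, rfl⟩ := List.append_inj h3 (z.2.trans c.2.symm)
      exact ⟨Subtype.ext h4.symm, h2⟩
    · rintro ⟨rfl, rfl⟩
      exact ⟨[], x, rfl, rfl, rfl⟩
  simp only [coeff_singleton, Piece.colourings, tensLabels, Multiset.map_map, Function.comp_def,
    key, Piece.weight]
  change ∑ c : Seq (Fin 2) w.length, _ = _
  simp [ite_and]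

/-- A sequence of length `m + n` is a sequence of length `m` followed by one of length `n`. -/
def seqAppend (m n : ℕ) : Seq (Fin 2) m × Seq (Fin 2) n ≃ Seq (Fin 2) (m + n) where
  toFun z := ⟨z.1.1 ++ z.2.1, by simp [z.1.2, z.2.2]⟩
  invFun z := (⟨z.1.take m, by simp [z.2]⟩, ⟨z.1.drop m, by simp [z.2]⟩)
  left_inv := by
    rintro ⟨⟨x, rfl⟩, ⟨y, rfl⟩⟩
    simp
  right_inv z := by simp

theorem sum_seq_append {A : Type} [AddCommMonoid A] (m n : ℕ) (f : List (Fin 2) → A) :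
    ∑ z : Seq (Fin 2) (m + n), f z.1 =
      ∑ c : Seq (Fin 2) m, ∑ z : Seq (Fin 2) n, f (c.1 ++ z.1) := by
  rw [← Fintype.sum_prod_type' fun (c : Seq (Fin 2) m) (z : Seq (Fin 2) n) => f (c.1 ++ z.1)]
  exact ((seqAppend m n).sum_comp fun z => f z.1).symm

theorem seq_cases {n : ℕ} (x : Seq (Fin 2) (n + 1)) : ∃ (c : Fin 2) (z : Seq (Fin 2) n),
    x.1 = c :: z.1 := by
  obtain ⟨_ | ⟨c, z⟩, h⟩ := x
  · simp at h
  · exact ⟨c, ⟨z, by simpa using h⟩, rfl⟩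

theorem seq_eq_iff {n : ℕ} (x y : Seq (Fin 2) n) : x.1 = y.1 ↔ x = y := Subtype.ext_iff.symm

theorem Equivariant.succ {g : Matrix (Fin 2) (Fin 2) ℂ} {p : ℕ} {π : Piece Tens} {m n : ℕ}
    (h : Equivariant g [⟨p, π⟩] m n) : Equivariant g [⟨p + 1, π⟩] (m + 1) (n + 1) := by
  intro x y
  obtain ⟨c, x, hx⟩ := seq_cases x
  obtain ⟨d, y, hy⟩ := seq_cases y
  rw [hx, hy, sum_seq_succ n fun z => entries g (d :: y.1) z * coeff [⟨p + 1, π⟩] (c :: x.1) z,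
    sum_seq_succ m fun z => coeff [⟨p + 1, π⟩] z (d :: y.1) * entries g z (c :: x.1)]
  simp only [coeff_succ, entries_cons, mul_ite, ite_mul, mul_zero, zero_mul]
  have h' := congrArg (g d c * ·) (h x y)
  simp only [Finset.mul_sum] at h'
  simp only [Finset.sum_ite_irrel, Finset.sum_const_zero, Finset.sum_ite_eq, Finset.sum_ite_eq',
    Finset.mem_univ, if_true]
  refine (Finset.sum_congr rfl fun _ _ => by ring).trans (h'.trans
    (Finset.sum_congr rfl fun _ _ => by ring))

theorem equivariant_cup {g : Matrix (Fin 2) (Fin 2) ℂ} (hg : g * g.transpose = 1) (m : ℕ) :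
    Equivariant g [⟨0, .cup ()⟩] m (m + 1 + 1) := by
  intro x y
  obtain ⟨a, y, hy⟩ := seq_cases y
  obtain ⟨b, y, hy'⟩ := seq_cases y
  rw [hy, hy', sum_seq_succ (m + 1) fun z => entries g (a :: b :: y.1) z *
    coeff [⟨0, .cup ()⟩] x.1 z]
  have e : ∀ c : Fin 2, ∑ z : Seq (Fin 2) (m + 1), entries g (a :: b :: y.1) (c :: z.1) *
      coeff [⟨0, .cup ()⟩] x.1 (c :: z.1) = _ := fun c =>
    sum_seq_succ m fun z => entries g (a :: b :: y.1) (c :: z) * coeff [⟨0, .cup ()⟩] x.1 (c :: z)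
  simp only [e]
  simp only [coeff_cup, entries_cons]
  have hg' := congrFun (congrFun hg a) b
  simp only [Matrix.mul_apply, Matrix.transpose_apply, Matrix.one_apply] at hg'
  simp only [seq_eq_iff, mul_ite, ite_mul, mul_zero, zero_mul, mul_one, one_mul, Finset.sum_ite_irrel,
    Finset.sum_const_zero, Finset.sum_ite_eq, Finset.sum_ite_eq', Finset.mem_univ, if_true]
  simp only [← mul_assoc, ← Finset.sum_mul, hg']
  split_ifs <;> simp

theorem equivariant_cap {g : Matrix (Fin 2) (Fin 2) ℂ} (hg : g.transpose * g = 1) (m : ℕ) :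
    Equivariant g [⟨0, .cap ()⟩] (m + 1 + 1) m := by
  intro x y
  obtain ⟨a, x, hx⟩ := seq_cases x
  obtain ⟨b, x, hx'⟩ := seq_cases x
  rw [hx, hx', sum_seq_succ (m + 1) fun z => coeff [⟨0, .cap ()⟩] z y.1 *
    entries g z (a :: b :: x.1)]
  have e : ∀ c : Fin 2, ∑ z : Seq (Fin 2) (m + 1), coeff [⟨0, .cap ()⟩] (c :: z.1) y.1 *
      entries g (c :: z.1) (a :: b :: x.1) = _ := fun c =>
    sum_seq_succ m fun z => coeff [⟨0, .cap ()⟩] (c :: z) y.1 * entries g (c :: z) (a :: b :: x.1)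
  simp only [e]
  simp only [coeff_cap, entries_cons]
  have hg' := congrFun (congrFun hg a) b
  simp only [Matrix.mul_apply, Matrix.transpose_apply, Matrix.one_apply] at hg'
  simp only [seq_eq_iff, mul_ite, ite_mul, mul_zero, zero_mul, mul_one, one_mul, Finset.sum_ite_irrel,
    Finset.sum_const_zero, Finset.sum_ite_eq, Finset.sum_ite_eq', Finset.mem_univ, if_true]
  simp only [← mul_assoc, ← Finset.sum_mul, hg']
  split_ifs <;> simp

theorem equivariant_box {g : Matrix (Fin 2) (Fin 2) ℂ} {w : List Unit} (t : Tens w)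
    (ht : ∀ x : Seq (Fin 2) w.length, ∑ y : Seq (Fin 2) w.length, entries g x.1 y.1 * t y = t x)
    (m : ℕ) : Equivariant g [⟨0, .box w t⟩] m (w.length + m) := by
  intro x y
  obtain ⟨⟨y, z⟩, rfl⟩ := (seqAppend _ _).surjective y
  change ∑ v : Seq (Fin 2) (w.length + m), entries g (y.1 ++ z.1) v.1 *
    coeff [⟨0, .box w t⟩] x.1 v.1 = ∑ v : Seq (Fin 2) m,
      coeff [⟨0, .box w t⟩] v.1 (y.1 ++ z.1) * entries g v.1 x.1
  rw [sum_seq_append w.length m fun v => entries g (y.1 ++ z.1) v * coeff [⟨0, .box w t⟩] x.1 v]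
  simp only [coeff_box, fun c : Seq (Fin 2) w.length => entries_append g (y.2.trans c.2.symm),
    seq_eq_iff, mul_ite, ite_mul, mul_zero, zero_mul, Finset.sum_ite_eq, Finset.sum_ite_eq',
    Finset.mem_univ, if_true]
  rw [← ht y, Finset.sum_mul]
  exact Finset.sum_congr rfl fun _ _ => by ring

/-- Coordinates of invariant tensors. -/
def inclTens (u : List Unit) (t : invariantTensors u) : Tens u := t.1

theorem equivariant_slice (g : Matrix.orthogonalGroup (Fin 2) ℝ) (p : ℕ)
    (π : Piece fun u => invariantTensors u) (k : ℕ) :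
    Equivariant (g.1.map Complex.ofReal)
      [⟨p, π.map inclTens⟩]
      (p + π.dom.length + k) (p + π.cod.length + k) := by
  induction p with
  | zero =>
    cases π with
    | cup c =>
      have h1 : (g.1.map Complex.ofReal) * (g.1.map Complex.ofReal).transpose = 1 := by
        have := congrArg Complex.ofRealHom.mapMatrix ((Matrix.mem_orthogonalGroup_iff _ _).1 g.2)
        rwa [map_mul, map_one] at this
      have := equivariant_cup h1 k
      have e : 0 + 2 + k = k + 1 + 1 := by omega
      simpa [Piece.dom, Piece.cod, Piece.map, e] using this
    | cap c =>
      have h1 : (g.1.map Complex.ofReal).transpose * (g.1.map Complex.ofReal) = 1 := by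
        have := congrArg Complex.ofRealHom.mapMatrix ((Matrix.mem_orthogonalGroup_iff' _ _).1 g.2)
        rwa [map_mul, map_one] at this
      have := equivariant_cap h1 k
      have e : 0 + 2 + k = k + 1 + 1 := by omega
      simpa [Piece.dom, Piece.cod, Piece.map, e] using this
    | box w t =>
      have := equivariant_box t.1 ((mem_invariantTensors _).1 t.2 g) k
      simpa [Piece.dom, Piece.cod, Piece.map, inclTens] using this
  | succ p ih =>
    have e1 : p + 1 + π.dom.length + k = p + π.dom.length + k + 1 := by omega
    have e2 : p + 1 + π.cod.length + k = p + π.cod.length + k + 1 := by omega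
    rw [e1, e2]
    exact ih.succ

theorem equivariant_word (g : Matrix.orthogonalGroup (Fin 2) ℝ)
    {T : Word fun u => invariantTensors u} {u v : List Unit} (h : Typed u T v) :
    Equivariant (g.1.map Complex.ofReal)
      (relabel inclTens T) u.length v.length := by
  induction T generalizing u with
  | nil =>
    obtain rfl : u = v := h
    intro x y
    simp [relabel, coeff, typedSum, Typed, weight, seq_eq_iff]
  | cons s T ih =>
    obtain ⟨x, h1, h2⟩ := h
    have h3 : Typed u (relabel inclTens [s]) x :=
      (typed_relabel _).2 (typed_singleton.2 h1)
    refine Equivariant.append (S := relabel _ [s]) h3 ?_ (ih h2)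
    obtain ⟨l, r, hl, rfl, rfl⟩ := h1
    have := equivariant_slice g s.pos s.piece r.length
    simpa [relabel, hl, ← add_assoc] using this

theorem act_mem_invariantTensors (w : List Unit) (D : Diagram (fun u => invariantTensors u) w) :
    tensors.act (D.relabel inclTens) ∈
      invariantTensors w := by
  have key : ∀ x : Seq (Fin 2) w.length,
      tensors.act (D.relabel inclTens) x =
        coeff (relabel inclTens D.1) [] x.1 := by
    intro x
    classical
    apply colourSum_congr
    intro X _
    rfl
  refine (mem_invariantTensors _).2 fun g x => ?_
  have := equivariant_word g D.2 ⟨[], rfl⟩ x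
  simp only [key]
  refine this.trans ?_
  refine (Finset.sum_eq_single (⟨[], rfl⟩ : Seq (Fin 2) 0) ?_ ?_).trans ?_
  · rintro ⟨z, hz⟩ _ h
    exact absurd (Subtype.ext (List.length_eq_zero_iff.1 hz)) h
  · simp
  · simp [entries]

/-- The planar algebra `Rep(O(2))`: invariant tensors in the tensor powers of the standard
representation `ℂ²` of `O(2)`, that is, the morphisms from the trivial representation to these
tensor powers, with the contraction of tensors along strings. -/
noncomputable def RepO2 : PlanarAlgebra Unit :=
  tensors.sub invariantTensors act_mem_invariantTensors

end Tensors

section Crossings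

/-- The kinds of crossings of a virtual tangle: in an `overpass` crossing the string from the bottom left
to the top right runs above the other one, in an `underpass` crossing it runs below it, and `virt` is
the virtual crossing. -/
inductive Crossing : Type
  | overpass
  | underpass
  | virt

/-- The effect of a quarter turn on a crossing. -/
def Crossing.rot : Crossing → Crossing
  | overpass => underpass
  | underpass => overpass
  | virt => virt

/-- The unoriented crossings. The endpoints are listed clockwise: top left, top right, bottom right,
bottom left. -/
inductive UCross : List Unit → Type
  | mk (k : Crossing) : UCross [(), (), (), ()]

/-- The oriented crossings: `c` is `true` if the string joining the bottom left and the top right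
endpoints goes up, and `d` is `true` if the string joining the bottom right and the top left
endpoints goes up. The last two endpoints of the crossing are at its bottom; when they are led to
the top, their direction is reversed. -/
inductive OCross : List Bool → Type
  | mk (k : Crossing) (c d : Bool) : OCross [d, c, !d, !c]

/-- The four orientations of a crossing. -/
def crossingOrientations : ∀ u, UCross u → Multiset (Σ e, OCross e)
  | _, .mk k => (Finset.univ : Finset (Bool × Bool)).val.map fun p => ⟨_, OCross.mk k p.1 p.2⟩

/-- An unoriented crossing of the strings number `n` and `n + 1` of a row: the bottom endpoints of the
crossing are joined to the strings below by two maxima. -/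
def ucross (k : Crossing) (n : ℕ) : Word UCross :=
  [⟨n, .box _ (.mk k)⟩, ⟨n + 3, .cap ()⟩, ⟨n + 2, .cap ()⟩]

/-- An oriented crossing of the first two strings of a row. -/
def ocross (k : Crossing) (c d : Bool) : Word OCross :=
  [⟨0, .box _ (.mk k c d)⟩, ⟨3, .cap !c⟩, ⟨2, .cap !d⟩]

/-- The virtual Reidemeister moves for unoriented diagrams (without the first Reidemeister move for
`overpass` and `underpass` crossings, that is, for framed tangles), and the quarter turns of crossings. -/
inductive VirtualMove : Word UCross → Word UCross → Prop
  | quarter_turn (k : Crossing) :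
      VirtualMove (rot () [⟨0, .box _ (.mk k)⟩]) [⟨0, .box _ (.mk k.rot)⟩]
  | virtual_one : VirtualMove ([⟨1, .cup ()⟩] ++ ucross .virt 0 ++ [⟨1, .cap ()⟩]) []
  | two (k : Crossing) : VirtualMove (ucross k 0 ++ ucross k.rot 0) []
  | three (k : Crossing) (hk : k ≠ .virt) :
      VirtualMove (ucross .overpass 0 ++ ucross .overpass 1 ++ ucross k 0)
        (ucross k 1 ++ ucross .overpass 0 ++ ucross .overpass 1)
  | virtual_three (k : Crossing) :
      VirtualMove (ucross .virt 0 ++ ucross .virt 1 ++ ucross k 0)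
        (ucross k 1 ++ ucross .virt 0 ++ ucross .virt 1)

/-- The defining relations of `Rep(S¹, a)`: the virtual Reidemeister moves with all orientations of
the strings, the two oriented circles are `1`, the virtual crossing of two upward strings is the
identity on two upward strings, the `overpass` crossing of two upward strings is `a` times this
identity, and the `underpass` crossing is `a⁻¹` times this identity. -/
inductive RelS1 (a : ℂ) : List Bool → List Bool → Word OCross → ℂ → Word OCross → Prop
  | move {S T : Word UCross} {u v : List Bool} {X Y : Word OCross} (h : VirtualMove S T)
      (hX : X ∈ colourings crossingOrientations S) (hY : Y ∈ colourings crossingOrientations T)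
      (hX' : Typed u X v) (hY' : Typed u Y v) : RelS1 a u v X 1 Y
  | circle (c : Bool) : RelS1 a [] [] [⟨0, .cup c⟩, ⟨0, .cap c⟩] 1 []
  | virt : RelS1 a [true, true] [true, true] (ocross .virt true true) 1 []
  | overpass : RelS1 a [true, true] [true, true] (ocross .overpass true true) a []
  | underpass : RelS1 a [true, true] [true, true] (ocross .underpass true true) a⁻¹ []

/-- The oriented planar algebra `Rep(S¹, a)`: a quotient of the planar algebra of oriented virtual
tangles. -/
noncomputable def RepS1 (a : ℂ) : PlanarAlgebra Bool := presented (RelS1 a)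

/-- The element of the unoriented planar algebra underlying `Rep(S¹, a)` that is given by the sum of
all orientations of an unoriented diagram with crossings. -/
noncomputable def sumOfOrientations (a : ℂ) {w : List Unit} (D : Diagram UCross w) :
    (RepS1 a).unoriented.V w :=
  fun e => colourSum crossingOrientations D.1 (cls (RelS1 a) e.1)

/-- The coordinates of the element of `(ℂ²)^{⊗4}` corresponding to the flip `v ⊗ w ↦ w ⊗ v`. -/
def flipTensor : Tens [(), (), (), ()] := fun x =>
  if x.1[0]! = x.1[2]! ∧ x.1[1]! = x.1[3]! then 1 else 0

theorem flipTensor_mem : flipTensor ∈ invariantTensors [(), (), (), ()] := by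
  rw [mem_invariantTensors]
  intro g x
  have h := congrArg Complex.ofRealHom.mapMatrix ((Matrix.mem_orthogonalGroup_iff _ _).1 g.2)
  rw [map_mul, map_one] at h
  have h' : ∀ a b : Fin 2, g.1.map Complex.ofReal a 0 * g.1.map Complex.ofReal b 0 +
      g.1.map Complex.ofReal a 1 * g.1.map Complex.ofReal b 1 = if a = b then 1 else 0 := by
    intro a b
    have := congrFun (congrFun h a) b
    simpa [Matrix.mul_apply, Matrix.one_apply] using this
  generalize g.1.map Complex.ofReal = G at h'
  obtain ⟨x, hx⟩ := x
  obtain ⟨a, b, c, d, rfl⟩ : ∃ a b c d, x = [a, b, c, d] := by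
    match x, hx with
    | [a, b, c, d], _ => exact ⟨a, b, c, d, rfl⟩
  let F : List (Fin 2) → ℂ := fun l =>
    entries G [a, b, c, d] l * if l[0]! = l[2]! ∧ l[1]! = l[3]! then 1 else 0
  change ∑ y : Seq (Fin 2) 4, F y.1 = if a = c ∧ b = d then 1 else 0
  have e0 : ∀ f : List (Fin 2) → ℂ, ∑ y : Seq (Fin 2) 0, f y.1 = f [] := by
    intro f
    refine (Finset.sum_eq_single (⟨[], rfl⟩ : Seq (Fin 2) 0) ?_ ?_).trans rfl
    · rintro ⟨z, hz⟩ _ h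
      exact absurd (Subtype.ext (List.length_eq_zero_iff.1 hz)) h
    · simp
  rw [sum_seq_succ 3 F]
  simp only [fun p => sum_seq_succ 2 fun l => F (p :: l),
    fun p q => sum_seq_succ 1 fun l => F (p :: q :: l),
    fun p q r => sum_seq_succ 0 fun l => F (p :: q :: r :: l),
    fun p q r s => e0 fun l => F (p :: q :: r :: s :: l), Fin.sum_univ_two]
  have e1 : (if a = c ∧ b = d then (1 : ℂ) else 0) =
      (if a = c then 1 else 0) * if b = d then 1 else 0 := by
    split_ifs <;> simp_all
  rw [e1, ← h', ← h']
  simp [F, entries]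
  ring

/-- The element of `Rep(O(2))` corresponding to the flip: the virtual crossing. -/
noncomputable def flipElement : RepO2.V [(), (), (), ()] := ⟨flipTensor, flipTensor_mem⟩

/-- Two parallel vertical strings. -/
noncomputable def parallel : RepO2.V [(), (), (), ()] :=
  RepO2.act ⟨[⟨0, .cup ()⟩, ⟨1, .cup ()⟩],
    [(), ()], ⟨[], [], rfl, rfl, rfl⟩, _, ⟨[()], [()], rfl, rfl, rfl⟩, rfl⟩

/-- A minimum above a maximum. -/
noncomputable def cupcap : RepO2.V [(), (), (), ()] :=
  RepO2.act ⟨[⟨0, .cup ()⟩, ⟨2, .cup ()⟩],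
    [(), ()], ⟨[], [], rfl, rfl, rfl⟩, _, ⟨[(), ()], [], rfl, rfl, rfl⟩, rfl⟩

/-- The interpretation of crossings in `Rep(O(2))`. -/
noncomputable def crossingO2 (a : ℂ) : ∀ u, UCross u → RepO2.V u
  | _, .mk .virt => flipElement
  | _, .mk .overpass =>
      ((a - a⁻¹) / 2) • parallel - ((a - a⁻¹) / 2) • cupcap + ((a + a⁻¹) / 2) • flipElement
  | _, .mk .underpass =>
      ((a⁻¹ - a) / 2) • parallel - ((a⁻¹ - a) / 2) • cupcap + ((a + a⁻¹) / 2) • flipElement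

end Crossings

end PlanarAlg

/-!
Both planar algebras are compared with the oriented planar algebra of scalars, all of whose box
spaces are `ℂ` and in which a diagram multiplies the labels of its inner discs.

Over `ℂ`, the vectors `e₁ + i e₂` and `(e₁ - i e₂) / 2` are isotropic and pair to `1`. In these
coordinates the tensor of an unoriented minimum is the sum of the tensors of its two orientations,
and likewise for a maximum. Therefore the change of coordinates is an injective map of planar
algebras `coordHom` from `Rep(O(2))` to the unoriented planar algebra underlying the scalars. It
works because the action of diagrams is given by matrix coefficients (`matCoeff`) that the matrix
of the change of coordinates intertwines (`baseChange_act`). Both basis vectors are eigenvectors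
of the rotations, with inverse eigenvalues; hence the coordinates of an invariant tensor vanish at
all boundaries that are not balanced, that is, have different numbers of strings with either
orientation (`baseChange_eq_zero_of_count_ne`).

In `Rep(S¹, a)` a crossing is `a`, `a⁻¹` or `1` times its oriented smoothing. The product of these
scalars over all crossings, the weight of a diagram, respects the relations, so that it defines a
map of planar algebras `weightHom` from `Rep(S¹, a)` to the scalars; in particular the relations
do not collapse `Rep(S¹, a)`. This map is injective (`weightMap_injective`), since any two
diagrams with the same boundary have classes in the ratio of their weights
(`proportional_of_typed`). Indeed, crossings of upward strings can be smoothed by definition, and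
the other ones are quarter turns of these; the second virtual Reidemeister move for antiparallel
strings, together with the value of a circle, then shows that a maximum below a minimum equals two
vertical strings (`Proportional.saddle`). With this relation every diagram is a multiple of one
without crossings and maxima, and any two such diagrams with the same boundary are equal. Diagrams
exist for all balanced boundaries (`exists_typed_of_count_eq`).

Hence the image of `coordHom` lies in that of the map of unoriented planar algebras induced by
`weightHom`, and the embedding is `coordHom` followed by the inverse of the latter. It remains to
compare crossings: at a given boundary a crossing has at most one orientation, and the coordinates
of the three tensors that represent the crossings are the scalars of their orientations
(`coordHom_crossingO2`). The general case follows since the sum of all orientations of a diagram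
is the action of the diagram without the crossings on the sums of the orientations of its
crossings (`colourSum_ev_eq`).
-/

namespace PlanarAlg

/-! ### Change of coordinates of tensors -/

section BaseChange

variable {C C' C'' : Type}

/-- Families of coordinates indexed by the choices of types of the boundary points `u`. -/
abbrev Coord (C : Type) (u : List Unit) : Type := Seq C u.length → ℂ

/-- The tensor power of the matrix `G`: the product of its entries along two sequences. -/
def tensorPower (G : C' → C → ℂ) (x : List C') (y : List C) : ℂ := (List.zipWith G x y).prod

@[simp] theorem tensorPower_nil (G : C' → C → ℂ) : tensorPower G [] [] = 1 := rfl

theorem tensorPower_cons (G : C' → C → ℂ) (a : C') (b : C) (x : List C') (y : List C) :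
    tensorPower G (a :: x) (b :: y) = G a b * tensorPower G x y := by
  simp [tensorPower]

theorem tensorPower_append (G : C' → C → ℂ) {x : List C'} {y : List C} (h : x.length = y.length)
    (x' : List C') (y' : List C) :
    tensorPower G (x ++ x') (y ++ y') = tensorPower G x y * tensorPower G x' y' := by
  simp [tensorPower, List.zipWith_append h]

/-- A nonempty sequence is a first entry followed by a sequence. -/
def seqConsEquiv (C : Type) (n : ℕ) : C × Seq C n ≃ Seq C (n + 1) where
  toFun z := ⟨z.1 :: z.2.1, by simp [z.2.2]⟩
  invFun z := match z with
    | ⟨[], h⟩ => absurd h (Nat.succ_ne_zero n).symm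
    | ⟨c :: z, h⟩ => (c, ⟨z, Nat.succ.inj h⟩)
  left_inv := by
    rintro ⟨c, z, h⟩
    rfl
  right_inv := by
    rintro ⟨_ | ⟨c, z⟩, h⟩
    · simp at h
    · rfl

theorem exists_seq_cons {n : ℕ} (x : Seq C (n + 1)) : ∃ (c : C) (z : Seq C n), x.1 = c :: z.1 := by
  obtain ⟨⟨c, z⟩, rfl⟩ := (seqConsEquiv C n).surjective x
  exact ⟨c, z, rfl⟩

/-- A leftmost string that a slice does not involve passes it with its type unchanged. -/
theorem slice_typed_cons_iff [StringType C] {L : List C → Type} (p : ℕ) (q : Piece L) (c d : C)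
    (x y : List C) : (⟨p + 1, q⟩ : Slice L).Typed (c :: x) (d :: y) ↔
      c = d ∧ (⟨p, q⟩ : Slice L).Typed x y := by
  constructor
  · rintro ⟨l, r, h1, h2, h3⟩
    cases l with
    | nil => simp at h1
    | cons e l =>
      simp only [List.cons_append, List.cons.injEq] at h2 h3
      obtain ⟨rfl, rfl⟩ := h2
      obtain ⟨rfl, rfl⟩ := h3
      exact ⟨rfl, l, r, by simpa using h1, rfl, rfl⟩
  · rintro ⟨rfl, l, r, h1, rfl, rfl⟩
    exact ⟨c :: l, r, by simpa using h1, rfl, rfl⟩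

/-- A sequence of length `m + n` is a sequence of length `m` followed by one of length `n`. -/
def seqAppendEquiv (C : Type) (m n : ℕ) : Seq C m × Seq C n ≃ Seq C (m + n) where
  toFun z := ⟨z.1.1 ++ z.2.1, by simp [z.1.2, z.2.2]⟩
  invFun z := (⟨z.1.take m, by simp [z.2]⟩, ⟨z.1.drop m, by simp [z.2]⟩)
  left_inv := by
    rintro ⟨⟨x, rfl⟩, ⟨y, rfl⟩⟩
    simp
  right_inv z := by simp

theorem tensorPower_one [DecidableEq C] {x y : List C} (h : x.length = y.length) :
    tensorPower (fun a b : C => if a = b then 1 else 0) x y = if x = y then 1 else 0 := by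
  induction x generalizing y with
  | nil =>
    obtain rfl := List.length_eq_zero_iff.1 h.symm
    simp
  | cons a x ih =>
    cases y with
    | nil => simp at h
    | cons b y =>
      rw [tensorPower_cons, ih (by simpa using h)]
      by_cases h1 : a = b <;> simp [h1]

variable [Fintype C]

theorem sum_seq_zero {A : Type} [AddCommMonoid A] (f : List C → A) :
    ∑ z : Seq C 0, f z.1 = f [] := by
  refine (Finset.sum_eq_single (⟨[], rfl⟩ : Seq C 0) ?_ ?_).trans rfl
  · rintro ⟨z, hz⟩ _ h
    exact absurd (Subtype.ext (List.length_eq_zero_iff.1 hz)) h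
  · simp

theorem sum_seq_cons {A : Type} [AddCommMonoid A] (n : ℕ) (f : List C → A) :
    ∑ z : Seq C (n + 1), f z.1 = ∑ c : C, ∑ z : Seq C n, f (c :: z.1) := by
  rw [← Fintype.sum_prod_type' fun (c : C) (z : Seq C n) => f (c :: z.1)]
  exact ((seqConsEquiv C n).sum_comp fun z : Seq C (n + 1) => f z.1).symm

theorem sum_seq_add {A : Type} [AddCommMonoid A] (m n : ℕ) (f : List C → A) :
    ∑ z : Seq C (m + n), f z.1 = ∑ c : Seq C m, ∑ z : Seq C n, f (c.1 ++ z.1) := by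
  rw [← Fintype.sum_prod_type' fun (c : Seq C m) (z : Seq C n) => f (c.1 ++ z.1)]
  exact ((seqAppendEquiv C m n).sum_comp fun z => f z.1).symm

theorem sum_tensorPower_mul (G : C'' → C → ℂ) (H : C → C' → ℂ) {x : List C''} {z : List C'}
    (n : ℕ) (hx : x.length = n) (hz : z.length = n) :
    ∑ y : Seq C n, tensorPower G x y.1 * tensorPower H y.1 z =
      tensorPower (fun a c => ∑ b, G a b * H b c) x z := by
  induction n generalizing x z with
  | zero =>
    obtain rfl := List.length_eq_zero_iff.1 hx
    obtain rfl := List.length_eq_zero_iff.1 hz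
    rw [sum_seq_zero fun y => tensorPower G [] y * tensorPower H y []]
    simp
  | succ n ih =>
    cases x with
    | nil => simp at hx
    | cons a x =>
      cases z with
      | nil => simp at hz
      | cons c z =>
        rw [sum_seq_cons n fun y => tensorPower G (a :: x) y * tensorPower H y (c :: z)]
        simp only [tensorPower_cons]
        rw [← ih (by simpa using hx) (by simpa using hz), Finset.sum_mul]
        refine Finset.sum_congr rfl fun b _ => ?_
        rw [Finset.mul_sum]
        exact Finset.sum_congr rfl fun _ _ => by ring

/-- The linear map of tensors given by the tensor powers of the matrix `G`. -/
noncomputable def baseChange (G : C' → C → ℂ) (u : List Unit) : Coord C u →ₗ[ℂ] Coord C' u where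
  toFun t e := ∑ x : Seq C u.length, tensorPower G e.1 x.1 * t x
  map_add' s t := by
    funext e
    simp [mul_add, Finset.sum_add_distrib]
  map_smul' z t := by
    funext e
    simp only [Pi.smul_apply, smul_eq_mul, RingHom.id_apply, Finset.mul_sum]
    exact Finset.sum_congr rfl fun _ _ => by ring

theorem baseChange_apply (G : C' → C → ℂ) (u : List Unit) (t : Coord C u)
    (e : Seq C' u.length) :
    baseChange G u t e = ∑ x : Seq C u.length, tensorPower G e.1 x.1 * t x := rfl

variable [Fintype C']

/-- If `H` is a left inverse of `G`, the tensor powers of `H` are left inverses of those of `G`. -/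
theorem baseChange_injective [DecidableEq C] {G : C' → C → ℂ} {H : C → C' → ℂ}
    (h : ∀ a b : C, ∑ c, H a c * G c b = if a = b then 1 else 0) (u : List Unit) :
    Function.Injective (baseChange G u) := by
  have key : ∀ (t : Coord C u) x, ∑ e : Seq C' u.length, tensorPower H x.1 e.1 *
      baseChange G u t e = t x := by
    intro t x
    simp only [baseChange_apply, Finset.mul_sum, ← mul_assoc]
    rw [Finset.sum_comm]
    simp only [← Finset.sum_mul]
    have e : (fun a c => ∑ b, H a b * G b c) = fun a c : C => if a = c then (1 : ℂ) else 0 :=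
      funext fun a => funext fun c => h a c
    have e' : ∀ y : Seq C u.length, tensorPower (fun a b : C => if a = b then (1 : ℂ) else 0)
        x.1 y.1 = if x = y then 1 else 0 := fun y => by
      rw [tensorPower_one (x.2.trans y.2.symm)]
      simp only [Subtype.ext_iff]
    simp [fun y : Seq C u.length => sum_tensorPower_mul H G _ x.2 y.2, e, e']
  intro s t hst
  funext x
  rw [← key s, ← key t, hst]

variable [StringType C] [StringType C']

/-- The choices of types at the boundary of an inner disc, with the coordinate of its label. -/
def coordLabels (u : List Unit) (t : Coord C u) : Multiset (Σ _ : List C, ℂ) :=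
  Finset.univ.val.map fun e : Seq C u.length => ⟨e.1, t e⟩

theorem length_coordLabels :
    ∀ u (t : Coord C u), ∀ y ∈ coordLabels u t, y.1.length = u.length :=
  length_familyLabels (scalars C)

/-- The matrix coefficients of the linear map of tensors given by a diagram. -/
noncomputable def matCoeff (T : Word (Coord C)) (x y : List C) : ℂ :=
  typedSum coordLabels x y T weight

/-- The coordinates of tensors form the unoriented planar algebra underlying the scalars. -/
theorem unoriented_scalars_act {w : List Unit} (D : Diagram (Coord C) w) (e : Seq C w.length) :
    (scalars C).unoriented.act (w := w) D e = matCoeff D.1 [] e.1 := by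
  classical
  apply colourSum_congr
  intro X _
  rfl

theorem matCoeff_append {S T : Word (Coord C)} {u v : List Unit} (hS : Typed u S v)
    {x : List C} (hx : x.length = u.length) (y : List C) :
    matCoeff (S ++ T) x y = ∑ z : Seq C v.length, matCoeff S x z.1 * matCoeff T z.1 y := by
  classical
  refine (typedSum_append length_coordLabels hS hx _).trans (Finset.sum_congr rfl fun z _ => ?_)
  simp only [matCoeff, typedSum, colourSum, ← Multiset.sum_map_mul_right]
  congr 1
  apply Multiset.map_congr rfl
  intro X _
  split_ifs with h
  · rw [← Multiset.sum_map_mul_left]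
    congr 1
    apply Multiset.map_congr rfl
    intro Y _
    split_ifs
    · exact weight_append X Y
    · simp
  · simp

theorem matCoeff_singleton (s : Slice (Coord C)) (x y : List C) :
    matCoeff [s] x y = ((s.piece.colourings coordLabels).map fun q =>
      open Classical in
      if (⟨s.pos, q⟩ : Slice fun _ : List C => ℂ).Typed x y then q.weight else 0).sum := by
  classical
  simp only [matCoeff, typedSum, colourSum_cons, colourSum_nil, typed_singleton]
  simp [weight]

theorem matCoeff_succ [DecidableEq C] (p : ℕ) (π : Piece (Coord C)) (c d : C) (x y : List C) :
    matCoeff [⟨p + 1, π⟩] (c :: x) (d :: y) = if c = d then matCoeff [⟨p, π⟩] x y else 0 := by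
  classical
  simp only [matCoeff_singleton, slice_typed_cons_iff]
  split_ifs with h <;> simp [h]

theorem matCoeff_cup [DecidableEq C] (a b : C) (x y : List C) :
    matCoeff [⟨0, .cup ()⟩] x (a :: b :: y) =
      if StringType.dual a = b then (if x = y then 1 else 0) else 0 := by
  classical
  have key : ∀ c : C, (⟨0, .cup c⟩ : Slice fun _ : List C => ℂ).Typed x (a :: b :: y) ↔
      c = a ∧ StringType.dual a = b ∧ x = y := by
    intro c
    constructor
    · rintro ⟨l, r, h1, h2, h3⟩
      obtain rfl := List.length_eq_zero_iff.1 h1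
      simp only [Piece.dom, Piece.cod, List.nil_append, List.cons_append, List.cons.injEq] at h2 h3
      obtain ⟨rfl, rfl, rfl⟩ := h3
      exact ⟨rfl, rfl, h2⟩
    · rintro ⟨rfl, rfl, rfl⟩
      exact ⟨[], x, rfl, rfl, rfl⟩
  simp only [matCoeff_singleton, Piece.colourings, Multiset.map_map, Function.comp_def, key,
    Piece.weight]
  change ∑ c : C, _ = _
  simp [ite_and]

theorem matCoeff_cap [DecidableEq C] (a b : C) (x y : List C) :
    matCoeff [⟨0, .cap ()⟩] (a :: b :: x) y =
      if StringType.dual a = b then (if x = y then 1 else 0) else 0 := by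
  classical
  have key : ∀ c : C, (⟨0, .cap c⟩ : Slice fun _ : List C => ℂ).Typed (a :: b :: x) y ↔
      c = a ∧ StringType.dual a = b ∧ x = y := by
    intro c
    constructor
    · rintro ⟨l, r, h1, h2, h3⟩
      obtain rfl := List.length_eq_zero_iff.1 h1
      simp only [Piece.dom, Piece.cod, List.nil_append, List.cons_append, List.cons.injEq] at h2 h3
      obtain ⟨rfl, rfl, rfl⟩ := h2
      exact ⟨rfl, rfl, h3.symm⟩
    · rintro ⟨rfl, rfl, rfl⟩
      exact ⟨[], x, rfl, rfl, rfl⟩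
  simp only [matCoeff_singleton, Piece.colourings, Multiset.map_map, Function.comp_def, key,
    Piece.weight]
  change ∑ c : C, _ = _
  simp [ite_and]

theorem matCoeff_box [DecidableEq C] {w : List Unit} (t : Coord C w) (z : Seq C w.length)
    (x y : List C) :
    matCoeff [⟨0, .box w t⟩] x (z.1 ++ y) = if x = y then t z else 0 := by
  classical
  have key : ∀ c : Seq C w.length,
      (⟨0, .box c.1 (t c)⟩ : Slice fun _ : List C => ℂ).Typed x (z.1 ++ y) ↔ c = z ∧ x = y := by
    intro c
    constructor
    · rintro ⟨l, r, h1, h2, h3⟩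
      obtain rfl := List.length_eq_zero_iff.1 h1
      simp only [Piece.dom, Piece.cod, List.nil_append] at h2 h3
      obtain ⟨h4, rfl⟩ := List.append_inj h3 (z.2.trans c.2.symm)
      exact ⟨Subtype.ext h4.symm, h2⟩
    · rintro ⟨rfl, rfl⟩
      exact ⟨[], x, rfl, rfl, rfl⟩
  simp only [matCoeff_singleton, Piece.colourings, coordLabels, Multiset.map_map,
    Function.comp_def, key, Piece.weight]
  change ∑ c : Seq C w.length, _ = _
  simp [ite_and]

/-- The tensor powers of `G` intertwine the linear maps given by two diagrams. -/
def Intertwines (G : C' → C → ℂ) (T : Word (Coord C)) (T' : Word (Coord C')) (m n : ℕ) : Prop :=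
  ∀ (x : Seq C m) (y : Seq C' n),
    ∑ z : Seq C n, tensorPower G y.1 z.1 * matCoeff T x.1 z.1 =
      ∑ z : Seq C' m, matCoeff T' z.1 y.1 * tensorPower G z.1 x.1

theorem Intertwines.append {G : C' → C → ℂ} {S T : Word (Coord C)} {S' T' : Word (Coord C')}
    {u v w : List Unit} (hS : Typed u S v) (hS' : Typed u S' v)
    (h : Intertwines G S S' u.length v.length) (h' : Intertwines G T T' v.length w.length) :
    Intertwines G (S ++ T) (S' ++ T') u.length w.length := by
  intro x y
  simp only [matCoeff_append hS x.2, Finset.mul_sum]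
  rw [Finset.sum_comm]
  have e1 : ∀ z : Seq C v.length,
      ∑ y' : Seq C w.length, tensorPower G y.1 y'.1 * (matCoeff S x.1 z.1 * matCoeff T z.1 y'.1) =
        ∑ z' : Seq C' v.length,
          matCoeff T' z'.1 y.1 * (tensorPower G z'.1 z.1 * matCoeff S x.1 z.1) := by
    intro z
    have := congrArg (matCoeff S x.1 z.1 * ·) (h' z y)
    simp only [Finset.mul_sum] at this
    refine (Finset.sum_congr rfl fun _ _ => by ring).trans (this.trans
      (Finset.sum_congr rfl fun _ _ => by ring))
  rw [Finset.sum_congr rfl fun z _ => e1 z, Finset.sum_comm]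
  simp only [← Finset.mul_sum, h x _]
  simp only [Finset.mul_sum]
  rw [Finset.sum_comm]
  refine Finset.sum_congr rfl fun z _ => ?_
  rw [matCoeff_append hS' z.2, Finset.sum_mul]
  exact Finset.sum_congr rfl fun _ _ => by ring

theorem Intertwines.succ [DecidableEq C] [DecidableEq C'] {G : C' → C → ℂ} {p : ℕ}
    {π : Piece (Coord C)} {π' : Piece (Coord C')} {m n : ℕ}
    (h : Intertwines G [⟨p, π⟩] [⟨p, π'⟩] m n) :
    Intertwines G [⟨p + 1, π⟩] [⟨p + 1, π'⟩] (m + 1) (n + 1) := by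
  intro x y
  obtain ⟨c, x, hx⟩ := exists_seq_cons x
  obtain ⟨d, y, hy⟩ := exists_seq_cons y
  rw [hx, hy,
    sum_seq_cons n fun z => tensorPower G (d :: y.1) z * matCoeff [⟨p + 1, π⟩] (c :: x.1) z,
    sum_seq_cons m fun z => matCoeff [⟨p + 1, π'⟩] z (d :: y.1) * tensorPower G z (c :: x.1)]
  simp only [matCoeff_succ, tensorPower_cons, mul_ite, ite_mul, mul_zero, zero_mul]
  have h' := congrArg (G d c * ·) (h x y)
  simp only [Finset.mul_sum] at h'
  simp only [Finset.sum_ite_irrel, Finset.sum_const_zero, Finset.sum_ite_eq, Finset.sum_ite_eq',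
    Finset.mem_univ, if_true]
  refine (Finset.sum_congr rfl fun _ _ => by ring).trans (h'.trans
    (Finset.sum_congr rfl fun _ _ => by ring))

/-- A minimum is the tensor dual to the pairing, and `hG` says that `G` preserves this tensor. -/
theorem intertwines_cup [DecidableEq C] [DecidableEq C'] {G : C' → C → ℂ}
    (hG : ∀ a b, ∑ c, G a c * G b (StringType.dual c) = if StringType.dual a = b then 1 else 0)
    (m : ℕ) : Intertwines G [⟨0, .cup ()⟩] [⟨0, .cup ()⟩] m (m + 1 + 1) := by
  intro x y
  obtain ⟨a, y, hy⟩ := exists_seq_cons y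
  obtain ⟨b, y, hy'⟩ := exists_seq_cons y
  rw [hy, hy', sum_seq_cons (m + 1) fun z => tensorPower G (a :: b :: y.1) z *
    matCoeff [⟨0, .cup ()⟩] x.1 z]
  have e : ∀ c : C, ∑ z : Seq C (m + 1), tensorPower G (a :: b :: y.1) (c :: z.1) *
      matCoeff [⟨0, .cup ()⟩] x.1 (c :: z.1) = _ := fun c =>
    sum_seq_cons m fun z => tensorPower G (a :: b :: y.1) (c :: z) *
      matCoeff [⟨0, .cup ()⟩] x.1 (c :: z)
  simp only [e]
  simp only [matCoeff_cup, tensorPower_cons]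
  simp only [← Subtype.ext_iff, mul_ite, ite_mul, mul_zero, zero_mul, mul_one, one_mul,
    Finset.sum_ite_irrel, Finset.sum_const_zero, Finset.sum_ite_eq, Finset.sum_ite_eq',
    Finset.mem_univ, if_true]
  simp only [← mul_assoc, ← Finset.sum_mul, hG]
  split_ifs <;> simp

/-- A maximum is the pairing, and `hG` says that `G` preserves it. -/
theorem intertwines_cap [DecidableEq C] [DecidableEq C'] {G : C' → C → ℂ}
    (hG : ∀ a b, ∑ c, G c a * G (StringType.dual c) b = if StringType.dual a = b then 1 else 0)
    (m : ℕ) : Intertwines G [⟨0, .cap ()⟩] [⟨0, .cap ()⟩] (m + 1 + 1) m := by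
  intro x y
  obtain ⟨a, x, hx⟩ := exists_seq_cons x
  obtain ⟨b, x, hx'⟩ := exists_seq_cons x
  rw [hx, hx', sum_seq_cons (m + 1) fun z => matCoeff [⟨0, .cap ()⟩] z y.1 *
    tensorPower G z (a :: b :: x.1)]
  have e : ∀ c : C', ∑ z : Seq C' (m + 1), matCoeff [⟨0, .cap ()⟩] (c :: z.1) y.1 *
      tensorPower G (c :: z.1) (a :: b :: x.1) = _ := fun c =>
    sum_seq_cons m fun z => matCoeff [⟨0, .cap ()⟩] (c :: z) y.1 *
      tensorPower G (c :: z) (a :: b :: x.1)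
  simp only [e]
  simp only [matCoeff_cap, tensorPower_cons]
  simp only [← Subtype.ext_iff, mul_ite, ite_mul, mul_zero, zero_mul, mul_one, one_mul,
    Finset.sum_ite_irrel, Finset.sum_const_zero, Finset.sum_ite_eq, Finset.sum_ite_eq',
    Finset.mem_univ, if_true]
  simp only [← mul_assoc, ← Finset.sum_mul, hG]
  split_ifs <;> simp

theorem intertwines_box [DecidableEq C] [DecidableEq C'] (G : C' → C → ℂ) {w : List Unit}
    (t : Coord C w) (m : ℕ) :
    Intertwines G [⟨0, .box w t⟩] [⟨0, .box w (baseChange G w t)⟩] m (w.length + m) := by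
  intro x y
  obtain ⟨⟨y, z⟩, rfl⟩ := (seqAppendEquiv C' _ _).surjective y
  change ∑ v : Seq C (w.length + m), tensorPower G (y.1 ++ z.1) v.1 *
    matCoeff [⟨0, .box w t⟩] x.1 v.1 = ∑ v : Seq C' m,
      matCoeff [⟨0, .box w (baseChange G w t)⟩] v.1 (y.1 ++ z.1) * tensorPower G v.1 x.1
  rw [sum_seq_add w.length m fun v => tensorPower G (y.1 ++ z.1) v *
    matCoeff [⟨0, .box w t⟩] x.1 v]
  simp only [matCoeff_box, fun c : Seq C w.length => tensorPower_append G (y.2.trans c.2.symm),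
    ← Subtype.ext_iff, mul_ite, ite_mul, mul_zero, zero_mul, Finset.sum_ite_eq, Finset.sum_ite_eq',
    Finset.mem_univ, if_true]
  rw [baseChange_apply, Finset.sum_mul]
  exact Finset.sum_congr rfl fun _ _ => by ring

theorem intertwines_slice [DecidableEq C] [DecidableEq C'] {G : C' → C → ℂ}
    (h1 : ∀ a b, ∑ c, G a c * G b (StringType.dual c) = if StringType.dual a = b then 1 else 0)
    (h2 : ∀ a b, ∑ c, G c a * G (StringType.dual c) b = if StringType.dual a = b then 1 else 0)
    (p : ℕ) (π : Piece (Coord C)) (k : ℕ) :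
    Intertwines G [⟨p, π⟩] [⟨p, π.map fun u t => baseChange G u t⟩]
      (p + π.dom.length + k) (p + π.cod.length + k) := by
  induction p with
  | zero =>
    cases π with
    | cup c =>
      have e : 0 + 2 + k = k + 1 + 1 := by omega
      simpa [Piece.dom, Piece.cod, Piece.map, e] using intertwines_cup h1 k
    | cap c =>
      have e : 0 + 2 + k = k + 1 + 1 := by omega
      simpa [Piece.dom, Piece.cod, Piece.map, e] using intertwines_cap h2 k
    | box w t => simpa [Piece.dom, Piece.cod, Piece.map] using intertwines_box G t k
  | succ p ih =>
    have e1 : p + 1 + π.dom.length + k = p + π.dom.length + k + 1 := by omega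
    have e2 : p + 1 + π.cod.length + k = p + π.cod.length + k + 1 := by omega
    rw [e1, e2]
    exact ih.succ

theorem intertwines_word [DecidableEq C] [DecidableEq C'] {G : C' → C → ℂ}
    (h1 : ∀ a b, ∑ c, G a c * G b (StringType.dual c) = if StringType.dual a = b then 1 else 0)
    (h2 : ∀ a b, ∑ c, G c a * G (StringType.dual c) b = if StringType.dual a = b then 1 else 0)
    {T : Word (Coord C)} {u v : List Unit} (h : Typed u T v) :
    Intertwines G T (relabel (fun u t => baseChange G u t) T) u.length v.length := by
  induction T generalizing u with
  | nil =>
    obtain rfl : u = v := h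
    intro x y
    have e : ∀ x y : Seq C u.length, matCoeff [] x.1 y.1 = if x = y then (1 : ℂ) else 0 := by
      intro x y
      simp [matCoeff, typedSum, Typed, weight, Subtype.ext_iff]
    have e' : ∀ x y : Seq C' u.length, matCoeff [] x.1 y.1 = if x = y then (1 : ℂ) else 0 := by
      intro x y
      simp [matCoeff, typedSum, Typed, weight, Subtype.ext_iff]
    simp [relabel, e, e']
  | cons s T ih =>
    obtain ⟨x, h1, h2⟩ := h
    have h3 : Typed u [s] x := typed_singleton.2 h1
    have h4 : Typed u (relabel (fun u t => baseChange G u t) [s]) x := (typed_relabel _).2 h3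
    refine Intertwines.append (S := [s]) (S' := relabel _ [s]) h3 h4 ?_ (ih h2)
    obtain ⟨l, r, hl, rfl, rfl⟩ := h1
    have := intertwines_slice (G := G) ‹_› ‹_› s.pos s.piece r.length
    simpa [relabel, hl, ← add_assoc] using this

/-- A matrix that carries the pairing of the types of strings to that of other types defines a map
of planar algebras. -/
theorem baseChange_act [DecidableEq C] [DecidableEq C'] {G : C' → C → ℂ}
    (h1 : ∀ a b, ∑ c, G a c * G b (StringType.dual c) = if StringType.dual a = b then 1 else 0)
    (h2 : ∀ a b, ∑ c, G c a * G (StringType.dual c) b = if StringType.dual a = b then 1 else 0)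
    {w : List Unit} (D : Diagram (Coord C) w) :
    baseChange G w ((scalars C).unoriented.act (w := w) D) =
      (scalars C').unoriented.act (w := w) (D.relabel fun u t => baseChange G u t) := by
  funext e
  have := intertwines_word h1 h2 D.2 ⟨[], rfl⟩ e
  refine (Finset.sum_congr rfl fun x _ => congrArg _ (unoriented_scalars_act D x)).trans ?_
  refine Eq.trans ?_ (unoriented_scalars_act (D.relabel fun u t => baseChange G u t) e).symm
  refine this.trans ((sum_seq_zero fun z => matCoeff _ z e.1 * tensorPower G z []).trans ?_)
  simp [Diagram.relabel]

end BaseChange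

/-! ### Weights of oriented virtual tangle diagrams -/

section CrossingWeights

/-- The scalar by which an oriented crossing differs from its oriented smoothing in `Rep(S¹, a)`. -/
noncomputable def crossingScalar (a : ℂ) : ∀ e, OCross e → ℂ
  | _, .mk .overpass c d => if c = d then a else a⁻¹
  | _, .mk .underpass c d => if c = d then a⁻¹ else a
  | _, .mk .virt _ _ => 1

/-- The product of the scalars of the crossings of an oriented diagram. -/
noncomputable def crossingWeight (a : ℂ) (X : Word OCross) : ℂ :=
  weight (relabel (crossingScalar a) X)

@[simp] theorem crossingWeight_nil (a : ℂ) : crossingWeight a [] = 1 := by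
  simp [crossingWeight, relabel, weight]

theorem crossingWeight_append (a : ℂ) (X Y : Word OCross) :
    crossingWeight a (X ++ Y) = crossingWeight a X * crossingWeight a Y := by
  simp [crossingWeight, relabel_append, weight_append]

theorem crossingWeight_shift (a : ℂ) (n : ℕ) (X : Word OCross) :
    crossingWeight a (shift n X) = crossingWeight a X := by
  simp [crossingWeight, relabel_shift, weight_shift]

@[simp] theorem crossingWeight_cup (a : ℂ) (p : ℕ) (c : Bool) (X : Word OCross) :
    crossingWeight a (⟨p, .cup c⟩ :: X) = crossingWeight a X := by
  simp [crossingWeight, relabel, weight, Piece.weight, Piece.map]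

@[simp] theorem crossingWeight_cap (a : ℂ) (p : ℕ) (c : Bool) (X : Word OCross) :
    crossingWeight a (⟨p, .cap c⟩ :: X) = crossingWeight a X := by
  simp [crossingWeight, relabel, weight, Piece.weight, Piece.map]

@[simp] theorem crossingWeight_box (a : ℂ) (p : ℕ) (w : List Bool) (x : OCross w)
    (X : Word OCross) :
    crossingWeight a (⟨p, .box w x⟩ :: X) = crossingScalar a w x * crossingWeight a X := by
  simp [crossingWeight, relabel, weight, Piece.weight, Piece.map]

theorem crossingScalar_ne_zero {a : ℂ} (ha : a ≠ 0) {w : List Bool} (x : OCross w) :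
    crossingScalar a w x ≠ 0 := by
  obtain ⟨_ | _ | _, c, d⟩ := x <;> simp only [crossingScalar] <;>
    first | split_ifs <;> simp [ha] | simp

theorem crossingWeight_ne_zero {a : ℂ} (ha : a ≠ 0) (X : Word OCross) :
    crossingWeight a X ≠ 0 := by
  induction X with
  | nil => simp
  | cons s X ih =>
    obtain ⟨p, _ | _ | ⟨w, x⟩⟩ := s <;> simp [ih, crossingScalar_ne_zero ha]

theorem crossingWeight_isotopic (a : ℂ) {u v : List Bool} {X Y : Word OCross}
    (h : Isotopic u v X Y) : crossingWeight a X = crossingWeight a Y :=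
  weight_isotopic (h.relabel _)

theorem mem_colourings_append {C : Type} [Fintype C] {L : List Unit → Type} {M : List C → Type}
    {lab : ∀ u, L u → Multiset (Σ e, M e)} {S T : Word L} {X : Word M} :
    X ∈ colourings lab (S ++ T) ↔
      ∃ Y ∈ colourings lab S, ∃ Z ∈ colourings lab T, X = Y ++ Z := by
  induction S generalizing X with
  | nil => simp [colourings]
  | cons s S ih =>
    simp only [List.cons_append, colourings, Multiset.mem_bind, Multiset.mem_map, ih]
    constructor
    · rintro ⟨q, hq, _, ⟨Y, hY, Z, hZ, rfl⟩, rfl⟩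
      exact ⟨_, ⟨q, hq, Y, hY, rfl⟩, Z, hZ, rfl⟩
    · rintro ⟨_, ⟨q, hq, Y, hY, rfl⟩, Z, hZ, rfl⟩
      exact ⟨q, hq, _, ⟨Y, hY, Z, hZ, rfl⟩, rfl⟩

theorem mem_colourings_cup {X : Word OCross} {p : ℕ} {T : Word UCross} :
    X ∈ colourings crossingOrientations (⟨p, .cup ()⟩ :: T) ↔
      ∃ c, ∃ Y ∈ colourings crossingOrientations T, X = ⟨p, .cup c⟩ :: Y := by
  simp only [colourings, Piece.colourings, Multiset.mem_bind, Multiset.mem_map, Finset.mem_val,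
    Finset.mem_univ, true_and, exists_exists_eq_and, eq_comm (b := X)]

theorem mem_colourings_cap {X : Word OCross} {p : ℕ} {T : Word UCross} :
    X ∈ colourings crossingOrientations (⟨p, .cap ()⟩ :: T) ↔
      ∃ c, ∃ Y ∈ colourings crossingOrientations T, X = ⟨p, .cap c⟩ :: Y := by
  simp only [colourings, Piece.colourings, Multiset.mem_bind, Multiset.mem_map, Finset.mem_val,
    Finset.mem_univ, true_and, exists_exists_eq_and, eq_comm (b := X)]

theorem mem_colourings_box {X : Word OCross} {p : ℕ} {k : Crossing} {T : Word UCross} :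
    X ∈ colourings crossingOrientations (⟨p, .box _ (.mk k)⟩ :: T) ↔
      ∃ c d, ∃ Y ∈ colourings crossingOrientations T, X = ⟨p, .box _ (.mk k c d)⟩ :: Y := by
  simp only [colourings, Piece.colourings, crossingOrientations, Multiset.mem_bind,
    Multiset.mem_map, Finset.mem_val, Finset.mem_univ, true_and, Prod.exists, eq_comm (b := X)]
  constructor
  · rintro ⟨_, ⟨_, ⟨c, d, rfl⟩, rfl⟩, Y, hY, rfl⟩
    exact ⟨c, d, Y, hY, rfl⟩
  · rintro ⟨c, d, Y, hY, rfl⟩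
    exact ⟨_, ⟨_, ⟨c, d, rfl⟩, rfl⟩, Y, hY, rfl⟩

theorem mem_colourings_nil {X : Word OCross} :
    X ∈ colourings crossingOrientations [] ↔ X = [] := by
  simp [colourings]

/-- A consistently oriented crossing of the strings number `n` and `n + 1` exchanges the types of
these strings, and these types determine the orientation of the crossing. -/
theorem typed_colouring_ucross (a : ℂ) {k : Crossing} {n : ℕ} {u v : List Bool} {X : Word OCross}
    (hX : X ∈ colourings crossingOrientations (ucross k n)) (h : Typed u X v) :
    ∃ l r c d, l.length = n ∧ u = l ++ c :: d :: r ∧ v = l ++ d :: c :: r ∧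
      crossingWeight a X = crossingScalar a _ (.mk k c d) := by
  simp only [ucross, mem_colourings_box, mem_colourings_cap, mem_colourings_nil] at hX
  obtain ⟨c, d, _, ⟨b, _, ⟨b', _, rfl, rfl⟩, rfl⟩, rfl⟩ := hX
  obtain ⟨x, ⟨l, r, hl, rfl, rfl⟩, y, ⟨l1, r1, hl1, h1, rfl⟩, z, ⟨l2, r2, hl2, h2, rfl⟩, rfl⟩ := h
  simp only [Piece.dom, Piece.cod, List.append_nil, List.append_assoc, List.cons_append,
    List.nil_append] at *
  have h1' : (l ++ [d, c, !d]) ++ (!c) :: r = l1 ++ b :: StringType.dual b :: r1 := by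
    simpa using h1
  obtain ⟨rfl, h3⟩ := List.append_inj h1' (by simp [hl, hl1])
  obtain ⟨rfl, rfl⟩ := List.cons.inj h3
  have h2' : (l ++ [d, c]) ++ (!d) :: r1 = l2 ++ b' :: StringType.dual b' :: r2 := by simpa using h2
  obtain ⟨rfl, h4⟩ := List.append_inj h2' (by simp [hl, hl2])
  obtain ⟨rfl, rfl⟩ := List.cons.inj h4
  refine ⟨l, r2, c, d, hl, ?_, by simp, by simp⟩
  change l ++ (!!c) :: (!!d) :: r2 = _
  simp

/-- The inverse of a crossing is its quarter turn, with the two strings exchanged, and the scalars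
are inverse to each other: this is the second Reidemeister move. -/
theorem crossingScalar_mul_rot {a : ℂ} (ha : a ≠ 0) (k : Crossing) (c d : Bool) :
    crossingScalar a _ (.mk k c d) * crossingScalar a _ (.mk k.rot d c) = 1 := by
  cases k <;> simp only [crossingScalar, Crossing.rot, eq_comm (a := d)] <;>
    first | split_ifs <;> simp [ha] | simp

/-- A quarter turn exchanges over- and undercrossings, and reverses one of the two strings relative
to the other, so that it preserves the scalar of a crossing. -/
theorem crossingScalar_rot (a : ℂ) (k : Crossing) (c d : Bool) :
    crossingScalar a _ (.mk k.rot (!d) c) = crossingScalar a _ (.mk k c d) := by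
  cases k <;> cases c <;> cases d <;> simp [crossingScalar, Crossing.rot]

/-- Both sides of a third Reidemeister move have the same crossings, whatever the orientations. -/
theorem crossingWeight_three (a : ℂ) (j k : Crossing) {u v : List Bool} {X Y : Word OCross}
    (hX : X ∈ colourings crossingOrientations (ucross j 0 ++ ucross j 1 ++ ucross k 0))
    (hY : Y ∈ colourings crossingOrientations (ucross k 1 ++ ucross j 0 ++ ucross j 1))
    (hX' : Typed u X v) (hY' : Typed u Y v) : crossingWeight a X = crossingWeight a Y := by
  simp only [mem_colourings_append] at hX hY
  obtain ⟨_, ⟨X1, h1, X2, h2, rfl⟩, X3, h3, rfl⟩ := hX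
  obtain ⟨_, ⟨Y1, k1, Y2, k2, rfl⟩, Y3, k3, rfl⟩ := hY
  simp only [typed_append] at hX' hY'
  obtain ⟨x, ⟨y, p1, p2⟩, p3⟩ := hX'
  obtain ⟨x', ⟨y', q1, q2⟩, q3⟩ := hY'
  obtain ⟨l1, r1, c1, d1, hl1, rfl, rfl, e1⟩ := typed_colouring_ucross a h1 p1
  obtain ⟨l2, r2, c2, d2, hl2, h5, rfl, e2⟩ := typed_colouring_ucross a h2 p2
  obtain ⟨l3, r3, c3, d3, hl3, h6, rfl, e3⟩ := typed_colouring_ucross a h3 p3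
  obtain ⟨m1, s1, f1, g1, hm1, h7, rfl, e4⟩ := typed_colouring_ucross a k1 q1
  obtain ⟨m2, s2, f2, g2, hm2, h8, rfl, e5⟩ := typed_colouring_ucross a k2 q2
  obtain ⟨m3, s3, f3, g3, hm3, h9, h10, e6⟩ := typed_colouring_ucross a k3 q3
  obtain rfl := List.length_eq_zero_iff.1 hl1
  obtain rfl := List.length_eq_zero_iff.1 hl3
  obtain rfl := List.length_eq_zero_iff.1 hm2
  obtain ⟨t, rfl⟩ := List.length_eq_one_iff.1 hl2
  obtain ⟨t1, rfl⟩ := List.length_eq_one_iff.1 hm1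
  obtain ⟨t3, rfl⟩ := List.length_eq_one_iff.1 hm3
  simp only [List.nil_append, List.cons_append, List.cons.injEq] at h5 h6 h7 h8 h9
  obtain ⟨rfl, rfl, rfl⟩ := h5
  obtain ⟨rfl, rfl, rfl⟩ := h6
  obtain ⟨rfl, rfl, rfl, rfl⟩ := h7
  obtain ⟨rfl, rfl, rfl⟩ := h8
  obtain ⟨rfl, rfl, h9⟩ := h9
  obtain ⟨rfl, rfl⟩ := List.cons.inj h9
  simp only [crossingWeight_append, e1, e2, e3, e4, e5, e6]
  ring

/-- Consistent orientations of the two sides of a move that induce the same orientation of the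
boundary have the same weight. -/
theorem crossingWeight_move {a : ℂ} (ha : a ≠ 0) {S T : Word UCross} {u v : List Bool}
    {X Y : Word OCross} (h : VirtualMove S T)
    (hX : X ∈ colourings crossingOrientations S) (hY : Y ∈ colourings crossingOrientations T)
    (hX' : Typed u X v) (hY' : Typed u Y v) : crossingWeight a X = crossingWeight a Y := by
  cases h with
  | quarter_turn k =>
    have e : rot () [⟨0, .box _ (.mk k)⟩] =
      ([⟨0, .cup ()⟩, ⟨1, .box _ (.mk k)⟩, ⟨0, .cap ()⟩] : Word UCross) := rfl
    rw [e] at hX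
    simp only [mem_colourings_cup, mem_colourings_box, mem_colourings_cap,
      mem_colourings_nil] at hX hY
    obtain ⟨b, _, ⟨c, d, _, ⟨b', _, rfl, rfl⟩, rfl⟩, rfl⟩ := hX
    obtain ⟨c', d', _, rfl, rfl⟩ := hY
    obtain ⟨x, ⟨l, r, hl, h1, rfl⟩, y, ⟨l1, r1, hl1, h2, rfl⟩, z, ⟨l2, r2, hl2, h3, rfl⟩, h4⟩ := hX'
    obtain ⟨x, ⟨l3, r3, hl3, h5, rfl⟩, rfl⟩ := hY'
    obtain rfl := List.length_eq_zero_iff.1 hl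
    obtain rfl := List.length_eq_zero_iff.1 hl2
    obtain rfl := List.length_eq_zero_iff.1 hl3
    obtain ⟨f, rfl⟩ := List.length_eq_one_iff.1 hl1
    simp only [Piece.dom, Piece.cod, List.append_nil, List.nil_append,
      List.cons_append, List.cons.injEq] at h1 h2 h3 h4 h5
    obtain ⟨rfl, rfl⟩ := h2
    obtain ⟨-, -, rfl⟩ := h3
    simp only [Typed, List.cons.injEq] at h4
    obtain ⟨rfl, rfl, -⟩ := h4
    simp [crossingScalar_rot]
  | virtual_one =>
    simp only [List.cons_append, List.nil_append, ucross, mem_colourings_cup,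
      mem_colourings_box, mem_colourings_cap, mem_colourings_nil] at hX hY
    obtain ⟨b, _, ⟨c, d, _, ⟨b1, _, ⟨b2, _, ⟨b3, _, rfl, rfl⟩, rfl⟩, rfl⟩, rfl⟩, rfl⟩ := hX
    subst hY
    simp [crossingScalar]
  | two k =>
    rw [mem_colourings_append] at hX
    obtain ⟨X1, h1, X2, h2, rfl⟩ := hX
    obtain rfl := mem_colourings_nil.1 hY
    obtain ⟨x, hx1, hx2⟩ := typed_append.1 hX'
    obtain ⟨l, r, c, d, hl, -, rfl, e1⟩ := typed_colouring_ucross a h1 hx1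
    obtain ⟨l', r', c', d', hl', h3, -, e2⟩ := typed_colouring_ucross a h2 hx2
    obtain rfl := List.length_eq_zero_iff.1 hl
    obtain rfl := List.length_eq_zero_iff.1 hl'
    simp only [List.nil_append, List.cons.injEq] at h3
    obtain ⟨rfl, rfl, -⟩ := h3
    rw [crossingWeight_append, e1, e2, crossingScalar_mul_rot ha, crossingWeight_nil]
  | three k hk => exact crossingWeight_three a .overpass k hX hY hX' hY'
  | virtual_three k => exact crossingWeight_three a .virt k hX hY hX' hY'

/-- The weight respects the relations of `Rep(S¹, a)`. -/
theorem crossingWeight_rel {a : ℂ} (ha : a ≠ 0) {u v : List Bool} {X Y : Word OCross} {z : ℂ}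
    (h : RelS1 a u v X z Y) : crossingWeight a X = z * crossingWeight a Y := by
  cases h with
  | move h hX hY hX' hY' => rw [one_mul, crossingWeight_move ha h hX hY hX' hY']
  | circle c => simp
  | virt => simp [ocross, crossingScalar]
  | overpass => simp [ocross, crossingScalar]
  | underpass => simp [ocross, crossingScalar]

/-- The linear functional on a box space of `Rep(S¹, a)` that replaces each diagram by its
weight. -/
noncomputable def weightMap {a : ℂ} (ha : a ≠ 0) (w : List Bool) :
    Presented (RelS1 a) w →ₗ[ℂ] ℂ :=
  (relators (RelS1 a) w).liftQ
    (Finsupp.linearCombination ℂ fun D : Diagram OCross w => crossingWeight a D.1) (by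
      refine Submodule.span_le.2 ?_
      intro g hg
      change Finsupp.linearCombination ℂ _ g = 0
      cases hg with
      | isotopy S T h =>
        simp [crossingWeight_isotopic a h]
      | skein h hA hS hT hB =>
        simp only [map_sub, map_smul, Finsupp.linearCombination_single, crossingWeight_append,
          crossingWeight_shift, crossingWeight_rel ha h, smul_eq_mul]
        ring)

theorem weightMap_mkQ {a : ℂ} (ha : a ≠ 0) (w : List Bool) (f : Diagram OCross w →₀ ℂ) :
    weightMap ha w ((relators (RelS1 a) w).mkQ f) = f.sum fun D z => z * crossingWeight a D.1 :=
  rfl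

theorem weightMap_cls {a : ℂ} (ha : a ≠ 0) {w : List Bool} {X : Word OCross}
    (h : Typed [] X w) : weightMap ha w (cls (RelS1 a) w X) = crossingWeight a X := by
  rw [cls_of_typed h, weightMap_mkQ]
  simp

/-- The expansion of a diagram in linear combinations of diagrams is multiplicative for weights. -/
theorem expand_crossingWeight (a : ℂ) (T : Word fun w => Diagram OCross w →₀ ℂ) (z : ℂ) :
    expand T (fun X => z * crossingWeight a X) = z * weight (C := Bool)
      (relabel (fun _ f => f.sum fun D z => z * crossingWeight a D.1) T) := by
  induction T generalizing z with
  | nil => simp [expand, relabel, weight]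
  | cons s T ih =>
    obtain ⟨p, _ | _ | ⟨w, f⟩⟩ := s
    · simpa [expand, relabel, weight, Piece.map, Piece.weight] using ih z
    · simpa [expand, relabel, weight, Piece.map, Piece.weight] using ih z
    · simp only [expand, crossingWeight_append, crossingWeight_shift, ← mul_assoc, ih]
      simp only [relabel, weight, List.map_cons, Piece.map, Piece.weight, List.prod_cons,
        Finsupp.sum, smul_eq_mul, Finset.mul_sum, Finset.sum_mul]
      exact Finset.sum_congr rfl fun _ _ => by ring

/-- The weights of diagrams define a map of planar algebras from `Rep(S¹, a)` to the scalars. -/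
noncomputable def weightHom {a : ℂ} (ha : a ≠ 0) :
    PlanarAlgebra.Hom (RepS1 a) (scalars Bool) where
  toFun := weightMap ha
  map_act {w} D := by
    have h1 : Typed [] (relabel (lift (RelS1 a)) D.1) w := (typed_relabel _).2 D.2
    change weightMap ha w (expand (relabel (lift (RelS1 a)) D.1) (cls (RelS1 a) w)) =
      weight (relabel (fun w => weightMap ha w) D.1)
    rw [expand_map, expand_congr h1 (ψ := fun X => 1 * crossingWeight a X), expand_crossingWeight,
      one_mul]
    · congr 1
      refine List.map_map.trans (List.map_congr_left fun s _ => ?_)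
      obtain ⟨p, _ | _ | ⟨w, x⟩⟩ := s
      · rfl
      · rfl
      · simp only [Function.comp_apply, Piece.map]
        rw [← weightMap_mkQ ha, mkQ_lift]
    · intro X hX
      rw [weightMap_cls ha hX, one_mul]

end CrossingWeights

/-! ### Proportionality of diagrams in `Rep(S¹, a)` -/

section Proportional

/-- Two oriented diagrams are proportional if, inside every diagram, they represent elements of
`Rep(S¹, a)` whose ratio is that of their weights. -/
def Proportional (a : ℂ) (u v : List Bool) (S T : Word OCross) : Prop :=
  Typed u S v ∧ Typed u T v ∧ ∀ (w l r : List Bool) (A B : Word OCross),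
    Typed [] A (l ++ u ++ r) → Typed (l ++ v ++ r) B w →
      crossingWeight a T • cls (RelS1 a) w (A ++ shift l.length S ++ B) =
        crossingWeight a S • cls (RelS1 a) w (A ++ shift l.length T ++ B)

variable {a : ℂ} {u v x y : List Bool} {S T S' T' A B : Word OCross}

namespace Proportional

theorem refl (h : Typed u S v) : Proportional a u v S S := ⟨h, h, fun _ _ _ _ _ _ _ => rfl⟩

theorem symm (h : Proportional a u v S T) : Proportional a u v T S :=
  ⟨h.2.1, h.1, fun w l r A B hA hB => (h.2.2 w l r A B hA hB).symm⟩

theorem trans (ha : a ≠ 0) (h : Proportional a u v S T) (h' : Proportional a u v T T') :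
    Proportional a u v S T' := by
  refine ⟨h.1, h'.2.1, fun w l r A B hA hB => ?_⟩
  have h1 := h.2.2 w l r A B hA hB
  have h2 := h'.2.2 w l r A B hA hB
  apply smul_right_injective _ (crossingWeight_ne_zero ha T)
  simp only
  rw [smul_comm, h1, smul_comm, h2, smul_comm]

theorem context {l r : List Bool} (h : Proportional a u v S T) (hA : Typed x A (l ++ u ++ r))
    (hB : Typed (l ++ v ++ r) B y) :
    Proportional a x y (A ++ shift l.length S ++ B) (A ++ shift l.length T ++ B) := by
  have hS := typed_whisker l r h.1
  have hT := typed_whisker l r h.2.1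
  refine ⟨typed_append.2 ⟨_, typed_append.2 ⟨_, hA, hS⟩, hB⟩,
    typed_append.2 ⟨_, typed_append.2 ⟨_, hA, hT⟩, hB⟩, fun w m s A' B' hA' hB' => ?_⟩
  have h1 : Typed [] (A' ++ shift m.length A) ((m ++ l) ++ u ++ (r ++ s)) :=
    typed_append.2 ⟨_, hA', by simpa using typed_whisker m s hA⟩
  have h2 : Typed ((m ++ l) ++ v ++ (r ++ s)) (shift m.length B ++ B') w :=
    typed_append.2 ⟨_, by simpa using typed_whisker m s hB, hB'⟩
  have key := congrArg ((crossingWeight a A * crossingWeight a B) • ·) (h.2.2 w _ _ _ _ h1 h2)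
  simp only [smul_smul, shift_append, shift_shift, List.length_append, List.append_assoc,
    crossingWeight_append, crossingWeight_shift] at key ⊢
  convert key using 2 <;> ring

theorem append_left (hA : Typed x A u) (h : Proportional a u v S T) :
    Proportional a x v (A ++ S) (A ++ T) := by
  simpa [shift_zero] using h.context (l := []) (r := []) (by simpa using hA) (B := []) (y := v)
    (by simp [Typed])

theorem append_right (hB : Typed v B y) (h : Proportional a u v S T) :
    Proportional a u y (S ++ B) (T ++ B) := by
  simpa [shift_zero] using h.context (l := []) (r := []) (A := []) (x := u) (by simp [Typed])
    (by simpa using hB)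

theorem of_isotopic (h : Isotopic u v S T) : Proportional a u v S T := by
  refine ⟨h.typed.1, h.typed.2, fun w l r A B hA hB => ?_⟩
  rw [crossingWeight_isotopic a h]
  congr 1
  exact cls_isotopic (((Isotopic.refl hA).comp (h.whisker l r)).comp (.refl hB))

theorem of_rel (ha : a ≠ 0) {z : ℂ} (h : RelS1 a u v S z T) (hS : Typed u S v)
    (hT : Typed u T v) : Proportional a u v S T := by
  refine ⟨hS, hT, fun w l r A B hA hB => ?_⟩
  rw [crossingWeight_rel ha h, cls_skein h hA hS hT hB, smul_smul, mul_comm z]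

end Proportional

/-- The effect of a slice on a row of strings, if it can be applied. -/
def runSlice {L : List Bool → Type} (u : List Bool) (s : Slice L) : Option (List Bool) :=
  if s.pos ≤ u.length ∧ s.piece.dom <+: u.drop s.pos then
    some (u.take s.pos ++ s.piece.cod ++ u.drop (s.pos + s.piece.dom.length)) else none

/-- The top boundary of a diagram, computed from its bottom boundary. -/
def run {L : List Bool → Type} : List Bool → Word L → Option (List Bool)
  | u, [] => some u
  | u, s :: T => (runSlice u s).bind fun x => run x T

/-- The boundary of an explicit diagram can be found by evaluation. -/
theorem typed_of_run {L : List Bool → Type} {T : Word L} {u v : List Bool}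
    (h : run u T = some v) : Typed u T v := by
  induction T generalizing u with
  | nil => exact Option.some.inj h
  | cons s T ih =>
    simp only [run, Option.bind_eq_some_iff] at h
    obtain ⟨x, h1, h2⟩ := h
    refine ⟨x, ?_, ih h2⟩
    simp only [runSlice] at h1
    split_ifs at h1 with h3
    obtain ⟨h3, t, h4⟩ := h3
    obtain rfl := Option.some.inj h1
    have h5 : u.drop (s.pos + s.piece.dom.length) = t := by
      rw [← List.drop_drop, ← h4, List.drop_left]
    refine ⟨u.take s.pos, t, by simp [h3], ?_, by rw [h5]⟩
    rw [List.append_assoc, h4, List.take_append_drop]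

/-- Replacement of a part of an explicit diagram. -/
theorem Proportional.replace {l r : List Bool} (h : Proportional a u v S T)
    (hA : run x A = some (l ++ u ++ r)) (hB : run (l ++ v ++ r) B = some y) :
    Proportional a x y (A ++ shift l.length S ++ B) (A ++ shift l.length T ++ B) :=
  h.context (typed_of_run hA) (typed_of_run hB)

namespace Proportional

theorem circle (ha : a ≠ 0) (c : Bool) :
    Proportional a [] [] [⟨0, .cup c⟩, ⟨0, .cap c⟩] [] :=
  of_rel ha (.circle c) (typed_of_run (by cases c <;> rfl)) rfl

theorem zigzag_left (c : Bool) : Proportional a [c] [c] [⟨0, .cup c⟩, ⟨1, .cap !c⟩] [] :=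
  of_isotopic (.zigzag_left c)

theorem zigzag_right (c : Bool) : Proportional a [c] [c] [⟨1, .cup !c⟩, ⟨0, .cap c⟩] [] :=
  of_isotopic (.zigzag_right c)

/-- A minimum to the right of a maximum may be moved above it. -/
theorem cup_cap (c d : Bool) (m : List Bool) :
    Proportional a ([c, !c] ++ m) (m ++ [d, !d])
      [⟨2 + m.length, .cup d⟩, ⟨0, .cap c⟩] [⟨0, .cap c⟩, ⟨m.length, .cup d⟩] := by
  have h1 : Typed (L := OCross) [c, !c] [⟨0, .cap c⟩] [] :=
    typed_singleton.2 ⟨[], [], rfl, rfl, rfl⟩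
  have h2 : Typed (L := OCross) m [⟨m.length, .cup d⟩] (m ++ [d, !d]) :=
    typed_singleton.2 ⟨m, [], rfl, by simp [Piece.dom], by simp [Piece.cod, StringType.dual]⟩
  simpa [shift, zero_add] using (of_isotopic (.interchange h1 h2)).symm

/-- A minimum to the left of a maximum may be moved above it. -/
theorem cup_cap' (c d : Bool) (m : List Bool) :
    Proportional a (m ++ [c, !c]) ([d, !d] ++ m)
      [⟨0, .cup d⟩, ⟨2 + m.length, .cap c⟩] [⟨m.length, .cap c⟩, ⟨0, .cup d⟩] := by
  have h1 : Typed (L := OCross) [] [⟨0, .cup d⟩] [d, !d] :=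
    typed_singleton.2 ⟨[], [], rfl, rfl, rfl⟩
  have h2 : Typed (L := OCross) (m ++ [c, !c]) [⟨m.length, .cap c⟩] m :=
    typed_singleton.2 ⟨m, [], rfl, by simp [Piece.dom, StringType.dual], by simp [Piece.cod]⟩
  simpa [shift, zero_add] using of_isotopic (.interchange h1 h2)

/-- A crossing of two upward strings is proportional to two nested minima. -/
theorem box_up (ha : a ≠ 0) (k : Crossing) :
    Proportional a [] [true, true, false, false] [⟨0, .box _ (.mk k true true)⟩]
      [⟨0, .cup true⟩, ⟨1, .cup true⟩] := by
  have e0 : Proportional a [true, true] [true, true] (ocross k true true) [] := by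
    cases k
    · exact of_rel ha .overpass (typed_of_run rfl) rfl
    · exact of_rel ha .underpass (typed_of_run rfl) rfl
    · exact of_rel ha .virt (typed_of_run rfl) rfl
  -- Straighten the two strings that lead from the bottom of the crossing to its top.
  have e1 := e0.replace (x := []) (A := [⟨0, .cup true⟩, ⟨1, .cup true⟩]) (B := []) (l := [])
    (r := [false, false]) (y := [true, true, false, false]) rfl rfl
  have e2 : Proportional a [] _ _ _ := of_isotopic (.interchange
    (S := [⟨0, .box _ (.mk k true true)⟩]) (S' := [⟨0, .cup true⟩, ⟨1, .cup true⟩])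
    (u := []) (u' := []) (v := [true, true, false, false]) (v' := [true, true, false, false])
    (typed_of_run rfl) (typed_of_run rfl))
  have e3 := e2.replace (x := []) (A := []) (B := [⟨3, .cap false⟩, ⟨2, .cap false⟩]) (l := [])
    (r := []) (y := [true, true, false, false]) rfl rfl
  have e4 := (cup_cap (a := a) false true []).replace (x := [])
    (A := [⟨0, .box _ (.mk k true true)⟩, ⟨4, .cup true⟩]) (B := [⟨2, .cap false⟩])
    (l := [true, true, false]) (r := [false]) (y := [true, true, false, false]) rfl rfl
  have e5 := (zigzag_right (a := a) false).replace (x := [])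
    (A := [⟨0, .box _ (.mk k true true)⟩]) (B := [⟨3, .cup true⟩, ⟨2, .cap false⟩])
    (l := [true, true, false]) (r := []) (y := [true, true, false, false]) rfl rfl
  have e6 := (zigzag_right (a := a) false).replace (x := [])
    (A := [⟨0, .box _ (.mk k true true)⟩]) (B := [])
    (l := [true, true]) (r := [false]) (y := [true, true, false, false]) rfl rfl
  exact ((e3.symm.trans ha (e4.trans ha (e5.trans ha e6))).symm).trans ha e1

/-- A quarter turn of an oriented crossing. -/
theorem quarter_turn (ha : a ≠ 0) (k : Crossing) (c d : Bool) :
    Proportional a [] [c, !d, !c, d] (rot d [⟨0, .box _ (.mk k c d)⟩])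
      [⟨0, .box _ (.mk k.rot (!d) c)⟩] := by
  have hX : Typed (L := OCross) [] (rot d [⟨0, .box _ (.mk k c d)⟩]) [c, !d, !c, d] :=
    typed_of_run (by cases c <;> cases d <;> rfl)
  have hY : Typed (L := OCross) [] [⟨0, .box _ (.mk k.rot (!d) c)⟩] [c, !d, !c, d] :=
    typed_of_run (by cases c <;> cases d <;> rfl)
  refine of_rel ha (.move (.quarter_turn k) ?_ ?_ hX hY) hX hY
  · exact mem_colourings_cup.2 ⟨_, _, mem_colourings_box.2
      ⟨c, d, _, mem_colourings_cap.2 ⟨_, _, mem_colourings_nil.2 rfl, rfl⟩, rfl⟩, rfl⟩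
  · exact mem_colourings_box.2 ⟨_, _, _, mem_colourings_nil.2 rfl, rfl⟩

theorem rot_congr {d : Bool} {w : List Bool} (h : Proportional a [] (d :: w) S T) :
    Proportional a [] (w ++ [d]) (rot d S) (rot d T) := by
  have h1 : Typed (L := OCross) [] [⟨0, .cup !d⟩] [!d, d] :=
    typed_of_run (by cases d <;> rfl)
  have h2 : Typed (L := OCross) ([!d] ++ d :: w ++ [d]) [⟨0, .cap !d⟩] (w ++ [d]) :=
    typed_singleton.2 ⟨[], w ++ [d], rfl, by simp [Piece.dom, StringType.dual], by simp [Piece.cod]⟩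
  exact h.context (l := [!d]) (r := [d]) h1 h2

/-- The virtual crossing of two antiparallel strings is proportional to two minima side by side. -/
theorem box_virt (ha : a ≠ 0) : Proportional a [] [true, false, false, true]
    [⟨0, .box _ (.mk .virt false true)⟩] [⟨0, .cup true⟩, ⟨2, .cup false⟩] := by
  have e1 := (quarter_turn ha .virt true true).symm.trans ha (rot_congr (box_up ha .virt))
  have e2 := (cup_cap (a := a) false true []).replace (x := [])
    (A := [⟨0, .cup false⟩, ⟨1, .cup true⟩]) (B := [])
    (l := []) (r := [false, true]) (y := [true, false, false, true]) rfl rfl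
  have e3 := (zigzag_right (a := a) false).replace (x := []) (A := [⟨0, .cup false⟩])
    (B := [⟨0, .cup true⟩]) (l := []) (r := [true]) (y := [true, false, false, true]) rfl rfl
  have e4 : Proportional a [] [true, false, false, true] _ _ := of_isotopic (.interchange
    (S := [⟨0, .cup true⟩]) (S' := [⟨0, .cup false⟩]) (u := []) (u' := []) (v := [true, false])
    (v' := [false, true]) (typed_of_run rfl) (typed_of_run rfl))
  exact e1.trans ha (e2.trans ha (e3.trans ha e4.symm))

/-- A maximum below a minimum is proportional to two vertical strings. -/
theorem saddle (ha : a ≠ 0) (c : Bool) :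
    Proportional a [c, !c] [c, !c] [⟨0, .cap c⟩, ⟨0, .cup c⟩] [] := by
  -- The crossing of a downward and an upward string is a maximum below a minimum.
  have e1 := (box_virt ha).replace (x := [false, true]) (A := [])
    (B := [⟨3, .cap true⟩, ⟨2, .cap false⟩]) (l := []) (r := [false, true]) (y := [true, false])
    rfl rfl
  have e2 := (zigzag_left (a := a) false).replace (x := [false, true]) (A := [⟨0, .cup true⟩])
    (B := [⟨2, .cap false⟩]) (l := [true, false]) (r := [true])
    (y := [true, false]) rfl rfl
  have e3 := (cup_cap' (a := a) false true []).replace (x := [false, true]) (A := [])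
    (B := []) (l := []) (r := []) (y := [true, false]) rfl rfl
  have e4 : Proportional a [false, true] [true, false] (ocross .virt false true)
      ([⟨0, .cap false⟩] ++ [⟨0, .cup true⟩]) := e1.trans ha (e2.trans ha e3)
  -- Its inverse is the crossing of an upward and a downward string.
  have two : ∀ c d : Bool, Proportional a [c, d] [c, d]
      (ocross .virt c d ++ ocross .virt d c) [] := by
    intro c d
    have hX : Typed [c, d] (ocross .virt c d ++ ocross .virt d c) [c, d] :=
      typed_of_run (by cases c <;> cases d <;> rfl)
    have hm : ∀ c d, ocross .virt c d ∈ colourings crossingOrientations (ucross .virt 0) :=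
      fun c d => mem_colourings_box.2 ⟨c, d, _, mem_colourings_cap.2
        ⟨_, _, mem_colourings_cap.2 ⟨_, _, mem_colourings_nil.2 rfl, rfl⟩, rfl⟩, rfl⟩
    exact of_rel ha (.move (.two .virt) (mem_colourings_append.2 ⟨_, hm c d, _, hm d c, rfl⟩)
      (mem_colourings_nil.2 rfl) hX rfl) hX rfl
  have hβ : Typed [true, false] (ocross .virt true false) [false, true] := typed_of_run rfl
  -- A one-sided inverse of a minimum or of a maximum is two-sided, since circles can be removed.
  cases c with
  | true =>
    have e5 := ((e4.append_left hβ).symm.trans ha (two true false))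
    have e6 := (circle ha true).symm.append_left (A := ocross .virt true false ++ [⟨0, .cap false⟩])
      (x := [true, false]) (typed_of_run rfl)
    have e7 := e5.append_right (B := [⟨0, .cap true⟩]) (y := []) (typed_of_run rfl)
    exact (((e7.symm.trans ha e6.symm).append_right (B := [⟨0, .cup true⟩]) (y := [true, false])
      (typed_of_run rfl))).trans ha e5
  | false =>
    have e5 := (e4.append_right hβ).symm.trans ha (two false true)
    have e6 := (circle ha false).append_right
      (B := [⟨0, .cup true⟩] ++ ocross .virt true false) (y := [false, true]) (typed_of_run rfl)
    have e7 := e5.append_left (A := [⟨0, .cup false⟩]) (x := []) (typed_of_run rfl)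
    exact ((e7.symm.trans ha e6).append_left (A := [⟨0, .cap false⟩]) (x := [false, true])
      (typed_of_run rfl)).trans ha e5

end Proportional

/-- All slices are minima. -/
def IsCups (T : Word OCross) : Prop := ∀ s ∈ T, ∃ c, s.piece = .cup c

theorem IsCups.append (h : IsCups S) (h' : IsCups T) : IsCups (S ++ T) := fun s hs =>
  (List.mem_append.1 hs).elim (h s) (h' s)

theorem IsCups.cons (p : ℕ) (c : Bool) (h : IsCups T) : IsCups (⟨p, .cup c⟩ :: T) := by
  rintro s (_ | ⟨_, hs⟩)
  · exact ⟨c, rfl⟩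
  · exact h s hs

theorem isCups_nil : IsCups [] := by simp [IsCups]

theorem isCups_singleton (p : ℕ) (c : Bool) : IsCups [⟨p, .cup c⟩] := isCups_nil.cons p c

theorem IsCups.shift (n : ℕ) (h : IsCups T) : IsCups (shift n T) := by
  intro s hs
  obtain ⟨t, ht, rfl⟩ := List.mem_map.1 hs
  exact h t ht

theorem slice_typed_cup {p : ℕ} {c : Bool} :
    (⟨p, .cup c⟩ : Slice OCross).Typed x y ↔ ∃ l r, l.length = p ∧ x = l ++ r ∧
      y = l ++ c :: (!c) :: r := by
  simp [Slice.Typed, Piece.dom, Piece.cod, StringType.dual]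

theorem slice_typed_cap {p : ℕ} {c : Bool} :
    (⟨p, .cap c⟩ : Slice OCross).Typed x y ↔ ∃ l r, l.length = p ∧ x = l ++ c :: (!c) :: r ∧
      y = l ++ r := by
  simp [Slice.Typed, Piece.dom, Piece.cod, StringType.dual]

/-- A maximum above minima can be removed: it meets the highest minimum in a circle or in a zigzag,
or it passes below this minimum. -/
theorem exists_isCups_of_cap (ha : a ≠ 0) (hT : IsCups T) {q : ℕ} {c : Bool} (h : Typed [] T x)
    (h' : (⟨q, .cap c⟩ : Slice OCross).Typed x y) :
    ∃ T', IsCups T' ∧ Proportional a [] y (T ++ [⟨q, .cap c⟩]) T' := by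
  induction T using List.reverseRecOn generalizing q x y with
  | nil =>
    obtain rfl : [] = x := h
    obtain ⟨l, r, -, h1, -⟩ := slice_typed_cap.1 h'
    simp at h1
  | append_singleton T s ih =>
    obtain ⟨d, hd⟩ := hT s (by simp)
    obtain ⟨p, π⟩ := s
    obtain rfl : π = .cup d := hd
    have hT' : IsCups T := fun t ht => hT t (by simp [ht])
    obtain ⟨z, h1, h2⟩ := typed_append.1 h
    obtain ⟨l, r, rfl, rfl, rfl⟩ := slice_typed_cup.1 (typed_singleton.1 h2)
    obtain ⟨l', r', rfl, h3, rfl⟩ := slice_typed_cap.1 h'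
    rcases List.append_eq_append_iff.1 h3 with ⟨m, rfl, h4⟩ | ⟨m, rfl, h4⟩
    · match m, h4 with
      | [], h4 =>
        simp only [List.nil_append, List.cons.injEq] at h4
        obtain ⟨rfl, -, rfl⟩ := h4
        refine ⟨T, hT', ?_⟩
        simpa [shift] using (Proportional.circle ha d).context (l := l) (r := r) (B := [])
          (by simpa using h1) rfl
      | [e], h4 =>
        simp only [List.cons_append, List.nil_append, List.cons.injEq] at h4
        obtain ⟨rfl, rfl, rfl⟩ := h4
        refine ⟨T, hT', ?_⟩
        simpa [shift] using (Proportional.zigzag_left (a := a) d).context (l := l) (r := r')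
          (A := T) (x := []) (B := []) (by simpa using h1) rfl
      | e :: e' :: m, h4 =>
        simp only [List.cons_append, List.cons.injEq] at h4
        obtain ⟨rfl, rfl, rfl⟩ := h4
        obtain ⟨T', hT1, hT2⟩ := ih hT' (q := (l ++ m).length) h1
          (slice_typed_cap.2 ⟨l ++ m, r', rfl, by simp, rfl⟩)
        refine ⟨T' ++ [⟨l.length, .cup d⟩], hT1.append (isCups_singleton _ _), ?_⟩
        have e1 := (Proportional.cup_cap' (a := a) c d m).context (l := l) (r := r')
          (A := T) (x := []) (B := []) (by simpa using h1) rfl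
        have e2 := hT2.append_right (B := [⟨l.length, .cup d⟩]) (y := l ++ d :: (!d) :: (m ++ r'))
          (typed_singleton.2 (slice_typed_cup.2 ⟨l, m ++ r', rfl, by simp, rfl⟩))
        refine Proportional.trans ha (T := T ++ [⟨(l ++ m).length, .cap c⟩, ⟨l.length, .cup d⟩])
          ?_ (by simpa using e2)
        convert e1 using 1 <;> simp [shift]; omega
    · match m, h4 with
      | [], h4 =>
        simp only [List.nil_append, List.cons.injEq] at h4
        obtain ⟨rfl, -, rfl⟩ := h4
        refine ⟨T, hT', ?_⟩
        simpa [shift] using (Proportional.circle ha c).context (l := l') (r := r') (B := [])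
          (by simpa using h1) rfl
      | [e], h4 =>
        simp only [List.cons_append, List.nil_append, List.cons.injEq] at h4
        obtain ⟨rfl, rfl, rfl⟩ := h4
        refine ⟨T, hT', ?_⟩
        simpa [shift] using (Proportional.zigzag_right (a := a) c).context (l := l') (r := r)
          (A := T) (x := []) (B := []) (by simpa using h1) (by simp [Typed])
      | e :: e' :: m, h4 =>
        simp only [List.cons_append, List.cons.injEq] at h4
        obtain ⟨rfl, rfl, rfl⟩ := h4
        obtain ⟨T', hT1, hT2⟩ := ih hT' (q := l'.length) h1
          (slice_typed_cap.2 ⟨l', m ++ r, rfl, by simp, rfl⟩)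
        refine ⟨T' ++ [⟨(l' ++ m).length, .cup d⟩], hT1.append (isCups_singleton _ _), ?_⟩
        have e1 := (Proportional.cup_cap (a := a) c d m).context (l := l') (r := r)
          (A := T) (x := []) (B := []) (by simpa using h1) rfl
        have e2 := hT2.append_right (B := [⟨(l' ++ m).length, .cup d⟩])
          (y := l' ++ m ++ d :: (!d) :: r)
          (typed_singleton.2 (slice_typed_cup.2 ⟨l' ++ m, r, rfl, by simp, rfl⟩))
        refine Proportional.trans ha (T := T ++ [⟨l'.length, .cap c⟩, ⟨(l' ++ m).length, .cup d⟩])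
          ?_ (by simpa using e2)
        convert e1 using 1 <;> simp [shift]; omega

/-- Every oriented crossing is proportional to a diagram made of two minima. -/
theorem exists_isCups_of_box (ha : a ≠ 0) {w : List Bool} (z : OCross w) :
    ∃ T, IsCups T ∧ Proportional a [] w [⟨0, .box w z⟩] T := by
  -- A quarter turn adds a minimum and a maximum, and the maximum can be removed.
  have turn : ∀ c d, (∀ k, ∃ T, IsCups T ∧
      Proportional a [] [d, c, !d, !c] [⟨0, .box _ (.mk k c d)⟩] T) → ∀ k, ∃ T, IsCups T ∧
        Proportional a [] [c, !d, !c, !!d] [⟨0, .box _ (.mk k (!d) c)⟩] T := by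
    intro c d h k
    obtain ⟨T, hT, hT'⟩ := h k.rot
    have h1 := (Proportional.quarter_turn ha k.rot c d).symm.trans ha (Proportional.rot_congr hT')
    have hk : k.rot.rot = k := by cases k <;> rfl
    rw [hk] at h1
    have h2 : Typed [] (⟨0, .cup !d⟩ :: shift 1 T) ([!d] ++ (d :: c :: (!d) :: [!c]) ++ [d]) := by
      have h3 := typed_whisker [!d] [d] hT'.2.1
      exact ⟨[!d, d], slice_typed_cup.2 ⟨[], [], rfl, rfl, by simp⟩, h3⟩
    obtain ⟨T', hT1, hT2⟩ := exists_isCups_of_cap ha (hT.shift 1 |>.cons 0 !d) h2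
      (c := !d) (slice_typed_cap.2 ⟨[], [c, !d, !c, d], rfl, by simp, rfl⟩)
    have h3 := h1.trans ha hT2
    exact ⟨T', hT1, by cases d <;> exact h3⟩
  -- The quarter turns of the crossing of upward strings are its other orientations.
  have h1 : ∀ k, ∃ T, IsCups T ∧ Proportional a [] [true, true, false, false]
      [⟨0, .box _ (.mk k true true)⟩] T :=
    fun k => ⟨_, (isCups_singleton 1 true).cons 0 true, Proportional.box_up ha k⟩
  have h2 := turn _ _ h1
  have h3 := turn _ _ h2
  have h4 := turn _ _ h3
  obtain ⟨k, _ | _, _ | _⟩ := z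
  exacts [h3 k, h2 k, h4 k, h1 k]

/-- Every diagram is proportional to one made of minima. -/
theorem exists_isCups (ha : a ≠ 0) (h : Typed [] T x) :
    ∃ T', IsCups T' ∧ Proportional a [] x T T' := by
  induction T using List.reverseRecOn generalizing x with
  | nil => exact ⟨[], isCups_nil, .refl h⟩
  | append_singleton T s ih =>
    obtain ⟨z, h1, h2⟩ := typed_append.1 h
    obtain ⟨T', hT1, hT2⟩ := ih h1
    have e1 := hT2.append_right h2
    obtain ⟨p, c | c | ⟨w, k⟩⟩ := s
    · exact ⟨_, hT1.append (isCups_singleton p c), e1⟩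
    · obtain ⟨T'', h3, h4⟩ := exists_isCups_of_cap ha hT1 hT2.2.1 (typed_singleton.1 h2)
      exact ⟨T'', h3, e1.trans ha h4⟩
    · obtain ⟨l, r, rfl, rfl, rfl⟩ := typed_singleton.1 h2
      obtain ⟨U, h3, h4⟩ := exists_isCups_of_box ha k
      refine ⟨T' ++ shift l.length U, hT1.append (h3.shift _), e1.trans ha ?_⟩
      simpa [shift, Piece.cod] using h4.context (l := l) (r := r) (B := []) hT2.2.1 rfl

/-- A diagram made of minima is invertible up to proportionality. -/
theorem IsCups.exists_inverse (ha : a ≠ 0) (hT : IsCups T) (h : Typed x T y) :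
    ∃ V, Typed y V x ∧ Proportional a y y (V ++ T) [] := by
  induction T using List.reverseRecOn generalizing y with
  | nil =>
    obtain rfl : x = y := h
    exact ⟨[], rfl, .refl rfl⟩
  | append_singleton T s ih =>
    obtain ⟨d, hd⟩ := hT s (by simp)
    obtain ⟨p, π⟩ := s
    obtain rfl : π = .cup d := hd
    obtain ⟨z, h1, h2⟩ := typed_append.1 h
    obtain ⟨V, hV', hV⟩ := ih (fun t ht => hT t (by simp [ht])) h1
    obtain ⟨l, r, rfl, rfl, rfl⟩ := slice_typed_cup.1 (typed_singleton.1 h2)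
    have h3 : Typed (l ++ d :: (!d) :: r) [⟨l.length, .cap d⟩] (l ++ r) :=
      typed_singleton.2 (slice_typed_cap.2 ⟨l, r, rfl, rfl, rfl⟩)
    have e1 := (hV.append_right h2).append_left h3
    have e2 := (Proportional.saddle ha d).context (l := l) (r := r) (A := []) (B := [])
      (x := l ++ [d, !d] ++ r) rfl rfl
    refine ⟨⟨l.length, .cap d⟩ :: V, typed_append.2 ⟨_, h3, hV'⟩, ?_⟩
    refine Proportional.trans ha (by simpa using e1) (by simpa [PlanarAlg.shift] using e2)

theorem IsCups.eq_nil (hT : IsCups T) (h : Typed [] T []) : T = [] := by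
  induction T using List.reverseRecOn with
  | nil => rfl
  | append_singleton T s _ =>
    obtain ⟨d, hd⟩ := hT s (by simp)
    obtain ⟨p, π⟩ := s
    obtain rfl : π = .cup d := hd
    obtain ⟨z, -, h2⟩ := typed_append.1 h
    obtain ⟨l, r, -, -, h3⟩ := slice_typed_cup.1 (typed_singleton.1 h2)
    simp at h3

/-- Any two diagrams with the same boundary are proportional. -/
theorem proportional_of_typed (ha : a ≠ 0) (hS : Typed [] S x) (hT : Typed [] T x) :
    Proportional a [] x S T := by
  obtain ⟨S', h1, h2⟩ := exists_isCups ha hS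
  obtain ⟨T', h3, h4⟩ := exists_isCups ha hT
  refine h2.trans ha (Proportional.trans ha ?_ h4.symm)
  obtain ⟨V, hV', hV⟩ := h3.exists_inverse ha h4.2.1
  -- The closed diagram `S' ++ V` can be removed.
  obtain ⟨W, h5, h6⟩ := exists_isCups ha (typed_append.2 ⟨x, h2.2.1, hV'⟩)
  obtain rfl := h5.eq_nil h6.2.1
  have e1 := hV.append_left h2.2.1
  have e2 := h6.append_right h4.2.1
  simp only [List.append_nil, List.nil_append, List.append_assoc] at e1 e2
  exact e1.symm.trans ha e2

/-- If the boundary bounds a diagram, the class of this diagram spans its box space and has nonzero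
weight; otherwise the box space is zero. -/
theorem weightMap_injective (ha : a ≠ 0) (w : List Bool) : Function.Injective (weightMap ha w) := by
  rw [injective_iff_map_eq_zero]
  intro z hz
  by_cases hw : ∃ D : Word OCross, Typed [] D w
  · obtain ⟨D, hD⟩ := hw
    have h : LinearMap.id = ((crossingWeight a D)⁻¹ • weightMap ha w).smulRight
        (cls (RelS1 a) w D) := by
      refine Submodule.linearMap_qext _ (Finsupp.lhom_ext' fun T => LinearMap.ext_ring ?_)
      have h1 : (relators (RelS1 a) w).mkQ (Finsupp.single T 1) = cls (RelS1 a) w T.1 :=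
        (cls_of_typed T.2).symm
      have h2 := (proportional_of_typed ha T.2 hD).2.2 w [] [] [] [] rfl (by simp [Typed])
      simp only [List.nil_append, List.length_nil, shift_zero, List.append_nil] at h2
      simp only [LinearMap.comp_apply, Finsupp.lsingle_apply, LinearMap.id_apply, h1,
        LinearMap.smulRight_apply, LinearMap.smul_apply, weightMap_cls ha T.2, smul_eq_mul,
        mul_smul]
      rw [← h2, smul_smul, inv_mul_cancel₀ (crossingWeight_ne_zero ha D), one_smul]
    have := LinearMap.congr_fun h z
    simpa [hz] using this
  · obtain ⟨f, rfl⟩ := (relators (RelS1 a) w).mkQ_surjective z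
    have : f = 0 := Finsupp.ext fun D => (hw ⟨D.1, D.2⟩).elim
    rw [this, map_zero]

/-- A sequence of orientations without adjacent opposite entries is constant. -/
theorem exists_adjacent_or_eq_replicate (w : List Bool) :
    (∃ l c r, w = l ++ c :: (!c) :: r) ∨ ∃ c, w = List.replicate w.length c := by
  induction w with
  | nil => exact .inr ⟨true, rfl⟩
  | cons b w ih =>
    rcases ih with ⟨l, c, r, rfl⟩ | ⟨c, h⟩
    · exact .inl ⟨b :: l, c, r, rfl⟩
    · cases w with
      | nil => exact .inr ⟨b, rfl⟩
      | cons d w =>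
        obtain ⟨rfl, -⟩ := List.cons.inj h
        by_cases hb : b = d
        · subst hb
          exact .inr ⟨b, by rw [h]; simp [List.replicate_succ]⟩
        · exact .inl ⟨[], b, w, by simp [Bool.eq_not_of_ne (Ne.symm hb)]⟩

/-- A boundary with as many outgoing as incoming strings bounds a diagram made of minima. -/
theorem exists_typed_of_count_eq {w : List Bool} (h : w.count true = w.count false) :
    ∃ T : Word OCross, Typed [] T w := by
  induction hn : w.length using Nat.strong_induction_on generalizing w with
  | _ n ih =>
    subst hn
    rcases exists_adjacent_or_eq_replicate w with ⟨l, c, r, rfl⟩ | ⟨c, hw⟩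
    · obtain ⟨T, hT⟩ := ih (l ++ r).length (by simp) (w := l ++ r)
        (by cases c <;> simp at h ⊢ <;> omega) rfl
      exact ⟨T ++ [⟨l.length, .cup c⟩], typed_append.2 ⟨_, hT, typed_singleton.2
        (slice_typed_cup.2 ⟨l, r, rfl, rfl, rfl⟩)⟩⟩
    · have h0 : w.length = 0 := by
        rw [hw] at h
        cases c <;> simp only [List.count_replicate, beq_self_eq_true, if_true] at h <;>
          simpa [eq_comm] using h
      obtain rfl := List.length_eq_zero_iff.1 h0
      exact ⟨[], rfl⟩

end Proportional

/-! ### The isotropic basis of `ℂ²` -/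

section IsotropicBasis

/-- The coordinates of the vectors `e₁ + i e₂` and `(e₁ - i e₂) / 2` of `ℂ²`, eigenvectors of the
rotations that are isotropic for the standard symmetric bilinear form and pair to `1`. -/
noncomputable def isotropicBasis : Bool → Fin 2 → ℂ
  | true => ![1, Complex.I]
  | false => ![1 / 2, -Complex.I / 2]

theorem isotropicBasis_pairing (a b : Bool) :
    ∑ c, isotropicBasis a c * isotropicBasis b (StringType.dual c) =
      if StringType.dual a = b then 1 else 0 := by
  have h := Complex.I_mul_I
  cases a <;> cases b <;> simp [isotropicBasis, StringType.dual, Fin.sum_univ_two] <;>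
    ring_nf <;> simp <;> norm_num

/-- The tensor of the symmetric bilinear form is the sum of the tensors of the isotropic vectors,
each with its dual: an unoriented string is the sum of its two orientations. -/
theorem isotropicBasis_copairing (a b : Fin 2) :
    ∑ c, isotropicBasis c a * isotropicBasis (StringType.dual c) b =
      if StringType.dual a = b then 1 else 0 := by
  fin_cases a <;> fin_cases b <;> simp [isotropicBasis, StringType.dual]
  all_goals ring_nf
  all_goals simp

theorem baseChange_isotropicBasis_injective (u : List Unit) :
    Function.Injective (baseChange isotropicBasis u) := by
  refine baseChange_injective (H := fun i b => isotropicBasis (!b) i) (fun a b => ?_) u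
  refine Eq.trans ?_ (isotropicBasis_copairing a b)
  simp [StringType.dual, add_comm]

open Matrix in
/-- The rotation by the angle `θ`. -/
noncomputable def rotation (θ : ℝ) : Matrix.orthogonalGroup (Fin 2) ℝ :=
  ⟨!![Real.cos θ, -Real.sin θ; Real.sin θ, Real.cos θ], by
    rw [Matrix.mem_orthogonalGroup_iff]
    have := Real.sin_sq_add_cos_sq θ
    ext i j
    fin_cases i <;> fin_cases j <;> simp [Matrix.mul_apply, Fin.sum_univ_two] <;> nlinarith⟩

/-- The eigenvalues of the rotation by the angle `θ`. -/
noncomputable def rotationEigenvalue (θ : ℝ) : Bool → ℂ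
  | true => Complex.exp (θ * Complex.I)
  | false => Complex.exp (-(θ * Complex.I))

/-- The vectors of the isotropic basis are eigenvectors of the transposed rotations. -/
theorem isotropicBasis_rotation (θ : ℝ) (b : Bool) (j : Fin 2) :
    ∑ i, isotropicBasis b i * (rotation θ).1.map Complex.ofReal i j =
      rotationEigenvalue θ b * isotropicBasis b j := by
  have h1 := Complex.exp_mul_I θ
  have h2 : Complex.exp (-(θ * Complex.I)) = Complex.cos θ - Complex.sin θ * Complex.I := by
    rw [← neg_mul, Complex.exp_mul_I, Complex.cos_neg, Complex.sin_neg]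
    ring
  cases b <;> fin_cases j <;>
    simp [isotropicBasis, rotation, rotationEigenvalue, h1, h2, Fin.sum_univ_two]
  all_goals
    ring_nf
    try simp
    try ring

theorem tensorPower_mul_left {C C' : Type} (c : C' → ℂ) (G : C' → C → ℂ) {x : List C'}
    {y : List C} (h : x.length = y.length) :
    tensorPower (fun a b => c a * G a b) x y = (x.map c).prod * tensorPower G x y := by
  induction x generalizing y with
  | nil =>
    obtain rfl := List.length_eq_zero_iff.1 h.symm
    simp
  | cons a x ih =>
    cases y with
    | nil => simp at h
    | cons b y =>
      rw [tensorPower_cons, tensorPower_cons, ih (by simpa using h), List.map_cons, List.prod_cons]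
      ring

theorem prod_rotationEigenvalue (θ : ℝ) (e : List Bool) :
    (e.map (rotationEigenvalue θ)).prod =
      Complex.exp (((e.count true : ℂ) - e.count false) * (θ * Complex.I)) := by
  induction e with
  | nil => simp
  | cons b e ih =>
    rw [List.map_cons, List.prod_cons, ih]
    cases b <;> simp only [rotationEigenvalue, ← Complex.exp_add] <;> congr 1 <;> simp <;> ring

/-- The coordinates of an invariant tensor with respect to the isotropic basis vanish unless both
basis vectors occur equally often, as the tensor is fixed by all rotations. -/
theorem baseChange_eq_zero_of_count_ne {u : List Unit} {t : Coord (Fin 2) u}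
    (ht : t ∈ invariantTensors u) {e : Seq Bool u.length}
    (he : e.1.count true ≠ e.1.count false) : baseChange isotropicBasis u t e = 0 := by
  have hd : ((e.1.count true : ℂ) - e.1.count false) ≠ 0 := by
    rw [sub_ne_zero]
    exact_mod_cast he
  -- A rotation that acts on the basis tensor `e` by `-1`.
  let θ : ℝ := Real.pi / ((e.1.count true : ℝ) - e.1.count false)
  have hθ : (e.1.map (rotationEigenvalue θ)).prod = -1 := by
    rw [prod_rotationEigenvalue, ← Complex.exp_pi_mul_I]
    congr 1
    simp only [θ]
    push_cast
    field_simp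
  have h1 := (mem_invariantTensors _).1 ht (rotation θ)
  have h2 : baseChange isotropicBasis u t e = -baseChange isotropicBasis u t e := by
    calc baseChange isotropicBasis u t e
        = ∑ x : Seq (Fin 2) u.length, ∑ y : Seq (Fin 2) u.length,
            tensorPower isotropicBasis e.1 x.1 *
              tensorPower (fun i j => (rotation θ).1.map Complex.ofReal i j) x.1 y.1 * t y := by
          rw [baseChange_apply]
          refine Finset.sum_congr rfl fun x _ => ?_
          rw [← h1 x, Finset.mul_sum]
          exact Finset.sum_congr rfl fun y _ => (mul_assoc _ _ _).symm
      _ = ∑ y : Seq (Fin 2) u.length, -tensorPower isotropicBasis e.1 y.1 * t y := by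
          rw [Finset.sum_comm]
          refine Finset.sum_congr rfl fun y _ => ?_
          rw [← Finset.sum_mul, sum_tensorPower_mul _ _ _ e.2 y.2]
          simp only [isotropicBasis_rotation]
          rw [tensorPower_mul_left _ _ (e.2.trans y.2.symm), hθ, neg_one_mul]
      _ = -baseChange isotropicBasis u t e := by
          rw [baseChange_apply, ← Finset.sum_neg_distrib]
          exact Finset.sum_congr rfl fun _ _ => neg_mul _ _
  linear_combination h2 / 2

theorem sum_seq_four {C : Type} [Fintype C] (f : List C → ℂ) :
    ∑ z : Seq C 4, f z.1 = ∑ p, ∑ q, ∑ r, ∑ s, f [p, q, r, s] := by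
  rw [sum_seq_cons 3 f]
  refine Finset.sum_congr rfl fun p _ => ?_
  rw [sum_seq_cons 2 fun l => f (p :: l)]
  refine Finset.sum_congr rfl fun q _ => ?_
  rw [sum_seq_cons 1 fun l => f (p :: q :: l)]
  refine Finset.sum_congr rfl fun r _ => ?_
  rw [sum_seq_cons 0 fun l => f (p :: q :: r :: l)]
  exact Finset.sum_congr rfl fun s _ => sum_seq_zero fun l => f (p :: q :: r :: s :: l)

theorem baseChange_flipTensor (p q r s : Bool) :
    baseChange isotropicBasis [(), (), (), ()] flipTensor ⟨[p, q, r, s], rfl⟩ =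
      if r = !p ∧ s = !q then 1 else 0 := by
  have h1 := isotropicBasis_pairing p r
  have h2 := isotropicBasis_pairing q s
  refine (sum_seq_four fun l => tensorPower isotropicBasis [p, q, r, s] l *
    if l[0]! = l[2]! ∧ l[1]! = l[3]! then 1 else 0).trans ?_
  simp only [StringType.dual, id, Fin.sum_univ_two] at h1 h2
  have h3 : (if r = !p ∧ s = !q then (1 : ℂ) else 0) =
      (if (!p) = r then 1 else 0) * if (!q) = s then 1 else 0 := by
    cases p <;> cases q <;> cases r <;> cases s <;> simp
  rw [h3, ← h1, ← h2]
  simp [Fin.sum_univ_two, tensorPower]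
  ring

/-- The lower of two minima is the sum of its two orientations. -/
theorem matCoeff_two_cups (m : ℕ) (p q r s : Bool) :
    matCoeff (C := Bool) [⟨0, .cup ()⟩, ⟨m, .cup ()⟩] [] [p, q, r, s] =
      matCoeff (C := Bool) [⟨m, .cup ()⟩] [true, false] [p, q, r, s] +
        matCoeff (C := Bool) [⟨m, .cup ()⟩] [false, true] [p, q, r, s] := by
  have h1 : Typed (L := Coord Bool) [] [⟨0, .cup ()⟩] [(), ()] :=
    typed_singleton.2 ⟨[], [], rfl, rfl, rfl⟩
  refine (matCoeff_append (T := [⟨m, .cup ()⟩]) h1 (x := []) rfl [p, q, r, s]).trans ?_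
  refine (sum_seq_cons 1 fun z : List Bool => matCoeff [⟨0, .cup ()⟩] [] z *
    matCoeff [⟨m, .cup ()⟩] z [p, q, r, s]).trans ?_
  have h2 : ∀ c : Bool, ∑ z : Seq Bool 1, matCoeff [⟨0, .cup ()⟩] [] (c :: z.1) *
      matCoeff [⟨m, .cup ()⟩] (c :: z.1) [p, q, r, s] =
        matCoeff [⟨m, .cup ()⟩] [c, !c] [p, q, r, s] := by
    intro c
    refine (sum_seq_cons 0 fun z : List Bool => matCoeff [⟨0, .cup ()⟩] [] (c :: z) *
      matCoeff [⟨m, .cup ()⟩] (c :: z) [p, q, r, s]).trans ?_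
    simp only [fun d : Bool => sum_seq_zero fun z : List Bool =>
      matCoeff [⟨0, .cup ()⟩] [] (c :: d :: z) * matCoeff [⟨m, .cup ()⟩] (c :: d :: z) [p, q, r, s]]
    simp only [matCoeff_cup]
    cases c <;> simp [StringType.dual]
  simp [h2]

theorem matCoeff_parallel (p q r s : Bool) :
    matCoeff (C := Bool) [⟨0, .cup ()⟩, ⟨1, .cup ()⟩] [] [p, q, r, s] =
      if r = !q ∧ s = !p then 1 else 0 := by
  rw [matCoeff_two_cups]
  simp only [matCoeff_succ, matCoeff_cup, StringType.dual]
  cases p <;> cases q <;> cases r <;> cases s <;> simp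

theorem matCoeff_cupcap (p q r s : Bool) :
    matCoeff (C := Bool) [⟨0, .cup ()⟩, ⟨2, .cup ()⟩] [] [p, q, r, s] =
      if q = !p ∧ s = !r then 1 else 0 := by
  rw [matCoeff_two_cups]
  simp only [matCoeff_succ, matCoeff_cup, StringType.dual]
  cases p <;> cases q <;> cases r <;> cases s <;> simp

end IsotropicBasis

/-! ### Maps of underlying unoriented planar algebras -/

section Maps

variable {C : Type}

theorem relabel_relabel {L M N : List C → Type} (f : ∀ w, L w → M w) (g : ∀ w, M w → N w)
    (T : Word L) : relabel g (relabel f T) = relabel (fun w x => g w (f w x)) T := by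
  refine List.map_map.trans (List.map_congr_left fun s _ => ?_)
  obtain ⟨p, _ | _ | _⟩ := s <;> rfl

theorem map_colourSum [Fintype C] {L : List Unit → Type} {M : List C → Type}
    {lab : ∀ u, L u → Multiset (Σ e, M e)} {V W : Type} [AddCommGroup V] [Module ℂ V]
    [AddCommGroup W] [Module ℂ W] (Λ : V →ₗ[ℂ] W) (T : Word L) (φ : Word M → V) :
    Λ (colourSum lab T φ) = colourSum lab T fun X => Λ (φ X) := by
  rw [colourSum, map_multiset_sum, Multiset.map_map]
  rfl

/-- Relabelling before or after the choice of the types of strings. -/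
theorem colourSum_relabel [Fintype C] {L L' : List Unit → Type} {M M' : List C → Type}
    {lab : ∀ u, L u → Multiset (Σ e, M e)} {lab' : ∀ u, L' u → Multiset (Σ e, M' e)}
    {A : Type} [AddCommMonoid A] (f : ∀ u, L u → L' u) (g : ∀ e, M e → M' e)
    (h : ∀ u x, lab' u (f u x) = (lab u x).map fun y => ⟨y.1, g y.1 y.2⟩) (T : Word L)
    (φ : Word M' → A) :
    colourSum lab' (relabel f T) φ = colourSum lab T fun X => φ (relabel g X) := by
  induction T generalizing φ with
  | nil => simp [relabel]
  | cons s T ih =>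
    have e : relabel f (s :: T) = ⟨s.pos, s.piece.map f⟩ :: relabel f T := rfl
    rw [e, colourSum_cons, colourSum_cons]
    simp only [ih]
    obtain ⟨p, c | c | ⟨u, x⟩⟩ := s
    · simp [Piece.map, Piece.colourings, relabel]
    · simp [Piece.map, Piece.colourings, relabel]
    · simp [Piece.map, Piece.colourings, relabel, h]

variable [StringType C]

/-- Maps of planar algebras commute with the action of words that need not be well typed, on which
`ev` is zero. -/
theorem PlanarAlgebra.Hom.map_ev {P Q : PlanarAlgebra C} (f : P.Hom Q) (w : List C)
    (X : Word P.V) : f.toFun w (P.ev w X) = Q.ev w (relabel (fun w => f.toFun w) X) := by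
  by_cases h : Typed [] X w
  · rw [P.ev_of_typed h, Q.ev_of_typed ((typed_relabel _).2 h)]
    exact f.map_act _
  · rw [P.ev_of_not h, Q.ev_of_not fun h' => h ((typed_relabel _).1 h'), map_zero]

/-- A map of planar algebras factors through an injective one if all its values lie in the range
of the latter. -/
theorem PlanarAlgebra.Hom.exists_factor {P Q R : PlanarAlgebra C} (g : P.Hom R) (i : Q.Hom R)
    (hi : ∀ w, Function.Injective (i.toFun w))
    (h : ∀ w x, ∃ y, i.toFun w y = g.toFun w x) :
    ∃ f : P.Hom Q, ∀ w x, i.toFun w (f.toFun w x) = g.toFun w x := by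
  choose f hf using h
  refine ⟨⟨fun w => ⟨⟨f w, fun x y => hi w ?_⟩, fun z x => hi w ?_⟩, fun {w} D => hi w ?_⟩,
    fun w x => hf w x⟩
  · simp only [map_add, hf]
  · simp only [map_smul, hf, RingHom.id_apply]
  · refine (hf w _).trans ?_
    rw [g.map_act, i.map_act]
    congr 1
    refine Subtype.ext ?_
    refine Eq.trans ?_ (relabel_relabel _ _ _).symm
    simp only [Diagram.relabel]
    congr 1
    funext w x
    exact (hf w x).symm

open Classical in
/-- The sum of a collection of elements of `P` with various boundaries, as a family with one element
for each boundary. -/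
noncomputable def labelFamily (P : PlanarAlgebra C) {u : List Unit} (m : Multiset (Σ e, P.V e)) :
    ∀ e : Seq C u.length, P.V e.1 := fun e =>
  (m.map fun y => if h : y.1 = e.1 then (h ▸ y.2 : P.V e.1) else 0).sum

open Classical in
theorem labelFamily_scalars {u : List Unit} (m : Multiset (Σ _ : List C, ℂ)) (e : Seq C u.length) :
    labelFamily (scalars C) m e = (m.map fun y => if y.1 = e.1 then y.2 else 0).sum := by
  refine congrArg Multiset.sum (Multiset.map_congr rfl fun y _ => ?_)
  obtain ⟨k, z⟩ := y
  obtain ⟨e, he⟩ := e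
  by_cases h : k = e
  · subst h
    simp
  · simp [h]
    rfl

variable [Fintype C]

/-- The map of underlying unoriented planar algebras given by a map of planar algebras. -/
noncomputable def PlanarAlgebra.Hom.unoriented {P Q : PlanarAlgebra C} (f : P.Hom Q) :
    P.unoriented.Hom Q.unoriented where
  toFun u := LinearMap.pi fun e : Seq C u.length => (f.toFun e.1).comp (LinearMap.proj e)
  map_act {w} D := by
    funext e
    change f.toFun e.1 (colourSum (familyLabels P) D.1 (P.ev e.1)) =
      colourSum (familyLabels Q) (PlanarAlg.relabel _ D.1) (Q.ev e.1)
    refine Eq.trans ?_ (colourSum_relabel (lab := familyLabels P) (lab' := familyLabels Q)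
      _ (fun w => f.toFun w) (fun u x => ?_) D.1 (Q.ev e.1)).symm
    · exact (map_colourSum (f.toFun e.1) D.1 (P.ev e.1)).trans
        (congrArg _ (funext fun X => f.map_ev e.1 X))
    · simp only [familyLabels, Multiset.map_map, Function.comp_def]
      rfl

theorem PlanarAlgebra.Hom.unoriented_injective {P Q : PlanarAlgebra C} (f : P.Hom Q)
    (h : ∀ w, Function.Injective (f.toFun w)) (u : List Unit) :
    Function.Injective (f.unoriented.toFun u) := by
  intro x y hxy
  funext e
  exact h _ (congrFun hxy e)

/-- A sum over choices of elements of `P` for the inner discs of an unoriented diagram is the action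
of this diagram on the sums of these elements. -/
theorem colourSum_ev_eq (P : PlanarAlgebra C) {L : List Unit → Type}
    {lab : ∀ u, L u → Multiset (Σ e, P.V e)} (hlab : ∀ u x, ∀ y ∈ lab u x, y.1.length = u.length)
    (w : List C) (T : Word L) (A : Word P.V) :
    colourSum lab T (fun X => P.ev w (A ++ X)) =
      colourSum (familyLabels P) (relabel (fun u x => labelFamily P (lab u x)) T)
        (fun Y => P.ev w (A ++ Y)) := by
  classical
  induction T generalizing A with
  | nil => simp [relabel]
  | cons s T ih =>
    have step : ∀ q : Piece P.V, (colourSum lab T fun X => P.ev w (A ++ ⟨s.pos, q⟩ :: X)) =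
        colourSum (familyLabels P) (relabel (fun u x => labelFamily P (lab u x)) T)
          (fun Y => P.ev w (A ++ ⟨s.pos, q⟩ :: Y)) := by
      intro q
      have e : ∀ X : Word P.V, A ++ [⟨s.pos, q⟩] ++ X = A ++ ⟨s.pos, q⟩ :: X := fun X =>
        List.append_assoc _ _ _
      have := ih (A ++ [⟨s.pos, q⟩])
      simp only [e] at this
      exact this
    rw [colourSum_cons]
    simp only [step]
    obtain ⟨p, c | c | ⟨u, x⟩⟩ := s
    · refine Eq.trans ?_ (colourSum_cons (lab := familyLabels P) ⟨p, .cup c⟩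
        (relabel (fun u x => labelFamily P (lab u x)) T) _).symm
      simp only [Piece.colourings, Multiset.map_map]
    · refine Eq.trans ?_ (colourSum_cons (lab := familyLabels P) ⟨p, .cap c⟩
        (relabel (fun u x => labelFamily P (lab u x)) T) _).symm
      simp only [Piece.colourings, Multiset.map_map]
    · refine Eq.trans ?_ (colourSum_box P p u (labelFamily P (lab u x)) _ _).symm
      let Ψ (k : List C) : P.V k →ₗ[ℂ] P.V w := (isLinearMap_colourSum
        (relabel (fun u x => labelFamily P (lab u x)) T) (lab := familyLabels P)
        fun Y => P.ev_linear (w := w) (k := k) A Y p).mk'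
      have h1 : ∀ e : Seq C u.length, Ψ e.1 (labelFamily P (lab u x) e) =
          ((lab u x).map fun y => Ψ e.1 (if h : y.1 = e.1 then h ▸ y.2 else 0)).sum := by
        intro e
        rw [labelFamily, map_multiset_sum, Multiset.map_map]
        rfl
      have h2 : ∀ y ∈ lab u x, Ψ y.1 y.2 =
          ∑ e : Seq C u.length, Ψ e.1 (if h : y.1 = e.1 then h ▸ y.2 else 0) := by
        intro y hy
        rw [Finset.sum_eq_single (⟨y.1, hlab u x y hy⟩ : Seq C u.length)]
        · simp
        · intro e _ he
          rw [dif_neg fun h => he (Subtype.ext h.symm), map_zero]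
        · simp
      have h3 : ((lab u x).map fun y => Ψ y.1 y.2).sum =
          ∑ e : Seq C u.length, Ψ e.1 (labelFamily P (lab u x) e) := by
        rw [Multiset.map_congr rfl h2]
        simp only [h1]
        exact Multiset.sum_map_sum_map _ _
      simp only [Piece.colourings, Multiset.map_map, Function.comp_def]
      exact h3

end Maps

/-! ### Invariant tensors in isotropic coordinates -/

section Embedding

/-- The change of coordinates of invariant tensors to the isotropic basis. -/
noncomputable def coordHom : PlanarAlgebra.Hom RepO2 (scalars Bool).unoriented where
  toFun u := (baseChange isotropicBasis u).comp (invariantTensors u).subtype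
  map_act {w} D := by
    refine (baseChange_act isotropicBasis_pairing isotropicBasis_copairing
      (D.relabel inclTens)).trans ?_
    refine congrArg _ (Subtype.ext ?_)
    exact relabel_relabel _ _ _

theorem coordHom_injective (u : List Unit) : Function.Injective (coordHom.toFun u) := by
  intro s t h
  exact Subtype.ext (baseChange_isotropicBasis_injective u h)

/-- The coordinates of invariant tensors lie in the image of `Rep(S¹, a)`: a coordinate whose
boundary is not balanced vanishes, and any other is a multiple of the weight of a diagram. -/
theorem exists_unoriented_weightHom_eq {a : ℂ} (ha : a ≠ 0) (u : List Unit) (t : RepO2.V u) :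
    ∃ z, (weightHom ha).unoriented.toFun u z = coordHom.toFun u t := by
  have h : ∀ e : Seq Bool u.length, ∃ z, weightMap ha e.1 z =
      baseChange isotropicBasis u t.1 e := by
    intro e
    by_cases he : e.1.count true = e.1.count false
    · obtain ⟨T, hT⟩ := exists_typed_of_count_eq he
      refine ⟨(baseChange isotropicBasis u t.1 e / crossingWeight a T) • cls (RelS1 a) e.1 T, ?_⟩
      rw [map_smul, weightMap_cls ha hT, smul_eq_mul,
        div_mul_cancel₀ _ (crossingWeight_ne_zero ha T)]
    · exact ⟨0, by rw [map_zero, baseChange_eq_zero_of_count_ne t.2 he]⟩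
  choose z hz using h
  exact ⟨z, funext hz⟩

/-- The orientations of a crossing, each represented by its weight. -/
noncomputable def crossingWeights (a : ℂ) (u : List Unit) (x : UCross u) :
    Multiset (Σ e, (scalars Bool).V e) :=
  (crossingOrientations u x).map fun y => ⟨y.1, crossingScalar a y.1 y.2⟩

theorem length_crossingWeights (a : ℂ) :
    ∀ u x, ∀ y ∈ crossingWeights a u x, y.1.length = u.length := by
  rintro _ ⟨k⟩ y hy
  simp only [crossingWeights, crossingOrientations, Multiset.map_map, Multiset.mem_map] at hy
  obtain ⟨p, -, rfl⟩ := hy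
  rfl

/-- In the isotropic basis, the element of `Rep(O(2))` represented by an unoriented crossing is the
sum of the orientations of this crossing. -/
theorem coordHom_crossingO2 {a : ℂ} (u : List Unit) (x : UCross u) :
    coordHom.toFun u (crossingO2 a u x) =
      labelFamily (scalars Bool) (crossingWeights a u x) := by
  obtain ⟨k⟩ := x
  funext ⟨e, he⟩
  obtain ⟨p, q, r, s, rfl⟩ : ∃ p q r s, e = [p, q, r, s] := by
    match e, he with
    | [p, q, r, s], _ => exact ⟨p, q, r, s, rfl⟩
  have h1 : coordHom.toFun _ flipElement ⟨[p, q, r, s], he⟩ =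
      if r = !p ∧ s = !q then (1 : ℂ) else 0 := baseChange_flipTensor p q r s
  have h2 : coordHom.toFun _ parallel ⟨[p, q, r, s], he⟩ =
      if r = !q ∧ s = !p then (1 : ℂ) else 0 := by
    rw [parallel, coordHom.map_act]
    exact (unoriented_scalars_act _ _).trans (matCoeff_parallel p q r s)
  have h3 : coordHom.toFun _ cupcap ⟨[p, q, r, s], he⟩ =
      if q = !p ∧ s = !r then (1 : ℂ) else 0 := by
    rw [cupcap, coordHom.map_act]
    exact (unoriented_scalars_act _ _).trans (matCoeff_cupcap p q r s)
  have lin : ∀ (α β γ : ℂ) (x y z : (scalars Bool).unoriented.V [(), (), (), ()]) (x' y' z' : ℂ),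
      x ⟨[p, q, r, s], he⟩ = x' → y ⟨[p, q, r, s], he⟩ = y' → z ⟨[p, q, r, s], he⟩ = z' →
        (α • x - β • y + γ • z) ⟨[p, q, r, s], he⟩ = α * x' - β * y' + γ * z' := by
    rintro α β γ x y z _ _ _ rfl rfl rfl
    rfl
  have h6 : (∑ x : Bool × Bool, if [x.2, x.1, !x.2, !x.1] = [p, q, r, s] then
      crossingScalar a _ (.mk k x.1 x.2) else (0 : ℂ)) =
        if r = !p ∧ s = !q then crossingScalar a _ (.mk k q p) else 0 := by
    rw [Fintype.sum_prod_type]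
    cases p <;> cases q <;> cases r <;> cases s <;> simp
  have h4 : labelFamily (scalars Bool) (crossingWeights a _ (.mk k)) ⟨[p, q, r, s], he⟩ =
      if r = !p ∧ s = !q then crossingScalar a _ (.mk k q p) else 0 := by
    classical
    refine (labelFamily_scalars _ _).trans ?_
    simp only [crossingWeights, crossingOrientations, Multiset.map_map, Function.comp_def]
    refine (congrArg Multiset.sum (Multiset.map_map _ _ _)).trans ?_
    refine (congrArg Multiset.sum (Multiset.map_congr rfl fun x _ => ?_)).trans h6
    by_cases h : [x.2, x.1, !x.2, !x.1] = [p, q, r, s]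
    · exact (if_pos h).trans (if_pos h).symm
    · exact (if_neg h).trans (if_neg h).symm
  refine Eq.trans ?_ h4.symm
  cases k with
  | virt => exact h1
  | overpass =>
    have h5 : coordHom.toFun _ (crossingO2 a _ (.mk .overpass)) =
        ((a - a⁻¹) / 2) • coordHom.toFun _ parallel - ((a - a⁻¹) / 2) • coordHom.toFun _ cupcap +
          ((a + a⁻¹) / 2) • coordHom.toFun _ flipElement := by
      simp only [crossingO2, map_add, map_sub, map_smul]
    have h7 : (a - a⁻¹) / 2 * (if r = !q ∧ s = !p then 1 else 0) -
        (a - a⁻¹) / 2 * (if q = !p ∧ s = !r then 1 else 0) +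
          (a + a⁻¹) / 2 * (if r = !p ∧ s = !q then 1 else 0) =
        if r = !p ∧ s = !q then crossingScalar a _ (.mk .overpass q p) else (0 : ℂ) := by
      cases p <;> cases q <;> cases r <;> cases s <;> simp [crossingScalar] <;> ring
    exact (congrFun h5 _).trans ((lin _ _ _ _ _ _ _ _ _ h2 h3 h1).trans h7)
  | underpass =>
    have h5 : coordHom.toFun _ (crossingO2 a _ (.mk .underpass)) =
        ((a⁻¹ - a) / 2) • coordHom.toFun _ parallel - ((a⁻¹ - a) / 2) • coordHom.toFun _ cupcap +
          ((a + a⁻¹) / 2) • coordHom.toFun _ flipElement := by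
      simp only [crossingO2, map_add, map_sub, map_smul]
    have h7 : (a⁻¹ - a) / 2 * (if r = !q ∧ s = !p then 1 else 0) -
        (a⁻¹ - a) / 2 * (if q = !p ∧ s = !r then 1 else 0) +
          (a + a⁻¹) / 2 * (if r = !p ∧ s = !q then 1 else 0) =
        if r = !p ∧ s = !q then crossingScalar a _ (.mk .underpass q p) else (0 : ℂ) := by
      cases p <;> cases q <;> cases r <;> cases s <;> simp [crossingScalar] <;> ring
    exact (congrFun h5 _).trans ((lin _ _ _ _ _ _ _ _ _ h2 h3 h1).trans h7)

end Embedding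

end PlanarAlg

open PlanarAlg in
theorem mainTheorem8 (a : ℂ) (ha : a ≠ 0) :
    ∃ f : PlanarAlg.PlanarAlgebra.Hom PlanarAlg.RepO2 (PlanarAlg.RepS1 a).unoriented,
      (∀ w : List Unit, Function.Injective (f.toFun w)) ∧
      ∀ (w : List Unit) (D : PlanarAlg.Diagram PlanarAlg.UCross w),
        f.toFun w (PlanarAlg.RepO2.act (D.relabel (PlanarAlg.crossingO2 a))) =
          PlanarAlg.sumOfOrientations a D := by
  have hi := (weightHom ha).unoriented_injective (weightMap_injective ha)
  obtain ⟨f, hf⟩ := coordHom.exists_factor (weightHom ha).unoriented hi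
    (exists_unoriented_weightHom_eq ha)
  refine ⟨f, fun w s t h => coordHom_injective w ?_, fun w D => hi w ?_⟩
  · rw [← hf, ← hf, h]
  · rw [hf, coordHom.map_act]
    funext e
    have h1 : (weightHom ha).unoriented.toFun w (sumOfOrientations a D) e =
        colourSum crossingOrientations D.1 fun X =>
          weightMap ha e.1 (cls (RelS1 a) e.1 X) :=
      map_colourSum (weightMap ha e.1) _ _
    have h2 : ∀ X, weightMap ha e.1 (cls (RelS1 a) e.1 X) =
        (scalars Bool).ev e.1 (relabel (crossingScalar a) X) := by
      intro X
      by_cases h : Typed [] X e.1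
      · rw [weightMap_cls ha h]
        exact ((scalars Bool).ev_of_typed ((typed_relabel _).2 h)).symm
      · rw [cls, dif_neg h, map_zero]
        exact ((scalars Bool).ev_of_not fun h' => h ((typed_relabel _).1 h')).symm
    -- Crossings are replaced by their scalars, and these are collected into one label per crossing.
    have h3 := colourSum_relabel (lab := crossingOrientations) (lab' := crossingWeights a)
      (fun _ x => x) (crossingScalar a) (fun _ _ => rfl) D.1 ((scalars Bool).ev e.1)
    have h4 := colourSum_ev_eq (scalars Bool) (length_crossingWeights a) e.1 D.1 []
    have h5 : relabel (fun _ x => x) D.1 = D.1 := by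
      refine (List.map_congr_left fun s _ => ?_).trans (List.map_id _)
      obtain ⟨p, _ | _ | _⟩ := s <;> rfl
    rw [h1]
    simp only [h2]
    rw [h5] at h3
    refine Eq.trans ?_ (h4.symm.trans h3)
    have h6 : (fun u x => coordHom.toFun u (crossingO2 a u x)) =
        fun u x => labelFamily (scalars Bool) (crossingWeights a u x) :=
      funext fun u => funext fun x => coordHom_crossingO2 u x
    let act (T : Word (scalars Bool).unoriented.V) : (scalars Bool).V e.1 :=
      colourSum (familyLabels (scalars Bool)) T ((scalars Bool).ev e.1)
    exact congrArg act ((relabel_relabel _ _ D.1).trans (congrArg (fun F => relabel F D.1) h6))
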